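/- All logarithms are to base $2$. **Model.** There are $N$ users and infinitely many items, identified with $\mathbb N$. User $u$ has a type $\tau_U(u)$ uniform on $[q_U]$, item $i$ has a type $\tau_I(i)$ uniform on $[q_I]$, and $\Xi=(\xi_{w,j})\in\{-1,+1\}^{q_U\times q_I}$ has uniform entries; all of these are jointly independent. User $u$ rates item $i$ by $L_{u,i}=\xi_{\tau_U(u),\tau_I(i)}$. At each time $t=1,2,\dots$ an algorithm recommends to every user $u$ an item $a_{u,t}$, depending only on the recommendations and ratings before time $t$ and on independent randomness, and then sees $L_{u,a_{u,t}}$. Its regret is $\mathrm{regret}(T)=\mathbb E\sum_{t=1}^T\frac1N\sum_{u=1}^N\mathbf 1[L_{u,a_{u,t}}=-1]$. Assume $N>100$, $20\,q_U\log^2 q_U<N$ and $q_U,q_I\ge 100\log N$. **Parameters.** Let $r_U=\lceil 2\log(Nq_U^2)\rceil$, $r_I=\lceil 2\log(Nq_I)\rceil$, $$k_{\rm Item}(T)=16\log T+2\sqrt{\tfrac{q_Ir_I}{N}T},\qquad k_{\rm Hybrid}(T)=8r_U+2\sqrt{\tfrac{r_Iq_IT}{q_U}},$$ $T_{\rm Item}=\max\{T>0:k_{\rm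 Item}(T)\le r_U\}$ and $T_{\rm Hybrid}=\max\{T>0:k_{\rm Hybrid}(T)\le q_I/3\}$ over real $T$, with $T_{\rm Hybrid}=0$ if there is no such $T$. Let $R_U(T)=r_U+\frac{q_U}{N}T$ and $$R_I(T)=\begin{cases}\log T+\sqrt{\frac{q_Ir_I}{N}T}&\text{if }T<T_{\rm Item},\\ r_U+\frac1N\sqrt{q_Iq_Ur_IT}&\text{if }T_{\rm Item}\le T<T_{\rm Hybrid},\\ r_U+\frac{q_U}{N}q_I\log(Nq_I)+\frac{r_I}{N}T&\text{otherwise.}\end{cases}$$ If $R_U(T)\le R_I(T)$, put $I_{\rm exp}=0$, $I_{\rm usr}=r_U$, $I_{\rm rep}=6T$. If $R_U(T)>R_I(T)$, let $\ell=k_{\rm Item}(T)$ if $k_{\rm Item}(T)\le r_U$; otherwise $\ell=k_{\rm Hybrid}(T)$ if $k_{\rm Hybrid}(T)\le q_I/3$; otherwise $\ell=q_I$; and put $I_{\rm exp}=\lceil 16\frac{q_I}{\ell}T\rceil$, $I_{\rm usr}=r_U\mathbf 1[\ell>r_U]$, and $I_{\rm rep}=\lceil 3\ell\rceil$ if $\ell\le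 q_I/3$, $I_{\rm rep}=\lceil q_I\log(Nq_I)\rceil$ if $\ell>q_I/3$. **Algorithm RecommendationSystem** (for a known horizon $T$). Items are drawn without repetition in an arbitrary order fixed independently of the model. The first $I_{\rm usr}$, the next $I_{\rm rep}$ and the next $I_{\rm exp}$ of them form the sets $\mathcal I_{\rm usr}$, $\mathcal I_{\rm rep}$, $\mathcal I_{\rm exp}$; a "fresh" item is a later one that is given to no user at any other time. The following phases are run one after the other, and the run is cut off at time $T$. 1. *User clustering* ($I_{\rm usr}$ steps). All items of $\mathcal I_{\rm usr}$ are recommended to all users. If $I_{\rm usr}\ge r_U$, two users are in the same cluster if and only if they agree on $\mathcal I_{\rm usr}$; otherwise every user is its own cluster. 2. *Finding preferences* ($\max_w\lceil I_{\rm rep}/|P_w|\rceil$ steps, over the user clusters $P_w$). Within each cluster, the items of $\mathcal I_{\rm rep}$ are handed out one by one, in order, to the users of the cluster in cyclic order; when they are used up, the users get fresh items. The rating of $j\in\mathcal I_{\rm rep}$ by the user of $P_w$ who got it is recorded as $L_{P_w,j}$. 3. *Item clustering* ($\lceil I_{\rm exp}r_I/N\rceil$ steps). The users are permuted uniformly at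 random, the permuted list is repeated $\lceil I_{\rm exp}r_I/N\rceil$ times, one copy per time step, and the items of $\mathcal I_{\rm exp}$ are assigned, in order, to successive contiguous blocks of $r_I$ users of this list; left-over users get fresh items. For $i\in\mathcal I_{\rm exp}$ and each cluster $P_w$ with a user who has rated $i$, $L_{P_w,i}$ is the rating of $i$ by the first such user. For $j\in\mathcal I_{\rm rep}$ the item cluster $S_j$ consists of $j$ and of all $i\in\mathcal I_{\rm exp}$ with $L_{P_w,i}=L_{P_w,j}$ for every cluster $P_w$ containing a user who has rated $i$. 4. *Exploitation* (the remaining steps). For $u\in P_w$ let $\mathcal R_u$ be the union of the $S_j$ over $j\in\mathcal I_{\rm rep}$ with $L_{P_w,j}=+1$. User $u$ gets the first item of $\mathcal R_u$ (in the order of drawing) that $u$ has not yet rated, or a fresh item if there is none. **Theorem.** There is a universal constant $C>0$ such that for all $N,q_U,q_I$ as above and every order of drawing the items, RecommendationSystem satisfies, for every integer $T\ge 2$, $$\mathrm{regret}(T)\le\min\Big\{\frac T2,\;C\,R_U(T),\;C\,R_I(T)\Big\},$$ and for $T=1$ it satisfies $\mathrm{regret}(1)\le\min\{\frac12,\,C\,R_U(1)\}$.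 -/

import Mathlib

open MeasureTheory ProbabilityTheory
open scoped BigOperators

noncomputable section

namespace RecSys

/-! ### The model -/

/-- The latent variables: the type of each of the `N` users, the type of each of the infinitely many
items, and the preference matrix. A preference is `true` for `+1` (like), `false` for `-1`. -/
abbrev Prefs (N qU qI : ℕ) : Type :=
  (Fin N → Fin qU) × (ℕ → Fin qI) × (Fin qU × Fin qI → Bool)

/-- The law of the latent variables: all of them are independent, each one uniform on its range. -/
def prefsLaw (N qU qI : ℕ) : Measure (Prefs N qU qI) :=
  (Measure.pi fun _ : Fin N => (uniformOn Set.univ : Measure (Fin qU))).prod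
    ((Measure.infinitePi fun _ : ℕ => (uniformOn Set.univ : Measure (Fin qI))).prod
      (Measure.pi fun _ : Fin qU × Fin qI => (uniformOn Set.univ : Measure Bool)))

/-- The rating `L u i` that user `u` gives to item `i`. -/
def Prefs.rating {N qU qI : ℕ} (x : Prefs N qU qI) (u : Fin N) (i : ℕ) : Bool :=
  x.2.2 (x.1 u, x.2.1 i)

/-- Past recommendations and feedback, in chronological order: the entry of a time step sends each
user to the item it was recommended and to the rating it gave. -/
abbrev History (N : ℕ) : Type := List (Fin N → ℕ × Bool)

/-- A recommendation rule: from the history so far, the item that each user gets next. -/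
abbrev Policy (N : ℕ) : Type := History N → Fin N → ℕ

/-- The history after `t` time steps, if the users rate according to `L`. -/
def history {N : ℕ} (f : Policy N) (L : Fin N → ℕ → Bool) : ℕ → History N
  | 0 => []
  | t + 1 => history f L t ++ [fun u => (f (history f L t) u, L u (f (history f L t) u))]

/-- `a u t`: the item recommended to user `u` right after `t` time steps. -/
def action {N : ℕ} (f : Policy N) (L : Fin N → ℕ → Bool) (u : Fin N) (t : ℕ) : ℕ :=
  f (history f L t) u

/-- The expected number of disliked recommendations per user in the first `T` time steps. The
algorithm may use a random seed, uniform on a finite set and independent of the model. -/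
def regret {N : ℕ} {S : Type*} [Fintype S] (qU qI : ℕ) (f : S → Policy N) (T : ℕ) : ℝ :=
  𝔼 s : S, ∫ x, (∑ t ∈ Finset.range T, (1 / (N : ℝ)) *
    ∑ u : Fin N, if x.rating u (action (f s) x.rating u t) = false then 1 else 0)
      ∂(prefsLaw N qU qI)

/-! ### The algorithm

Items are drawn without repetition in the order `draw 0, draw 1, …`. The draws `0, …, Iusr - 1` form
the user-clustering items, the next `Irep` ones the cluster representatives, the next `Iexp` ones the
items to be clustered; all later draws serve as fresh random items. -/

structure Params where
  rU : ℕ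
  rI : ℕ
  Iusr : ℕ
  Irep : ℕ
  Iexp : ℕ

section Algorithm

variable {N : ℕ}

def Rated (h : History N) (u : Fin N) (i : ℕ) : Prop := ∃ e ∈ h, (e u).1 = i

def Liked (h : History N) (u : Fin N) (i : ℕ) : Prop := ∃ e ∈ h, e u = (i, true)

/-- Draw numbers of the cluster representatives. -/
def repDraws (p : Params) : Finset ℕ := Finset.Ico p.Iusr (p.Iusr + p.Irep)

/-- Draw numbers of the items to be clustered. -/
def expDraws (p : Params) : Finset ℕ :=
  Finset.Ico (p.Iusr + p.Irep) (p.Iusr + p.Irep + p.Iexp)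

open Classical in
/-- The user cluster of `u`: the users that agree with `u` on all user-clustering items, if there are
at least `rU` such items, and `{u}` otherwise. -/
def cluster (p : Params) (draw : ℕ → ℕ) (h : History N) (u : Fin N) : Finset (Fin N) :=
  if p.rU ≤ p.Iusr then
    Finset.univ.filter fun v => ∀ k < p.Iusr, (Liked h v (draw k) ↔ Liked h u (draw k))
  else {u}

/-- Time that finding the preferences takes: cluster `P` needs `⌈Irep / |P|⌉` steps, and the phase
lasts until all clusters are finished. -/
def findPrefsTime (p : Params) (draw : ℕ → ℕ) (h : History N) : ℕ :=
  Finset.univ.sup fun u : Fin N => p.Irep ⌈/⌉ (cluster p draw h u).card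

/-- Time that item clustering takes: `⌈Iexp * rI / N⌉` steps. -/
def itemClusteringTime (N : ℕ) (p : Params) : ℕ := (p.Iexp * p.rI) ⌈/⌉ N

/-- The recorded preference of the cluster of `u` for item `i` is "like". If several users of the
cluster have rated `i`, then the rating of the first of them (in the order of `Fin N`) counts. -/
def ClusterLikes (p : Params) (draw : ℕ → ℕ) (h : History N) (u : Fin N) (i : ℕ) : Prop :=
  ∃ v ∈ cluster p draw h u, Liked h v i ∧ ∀ v' ∈ cluster p draw h u, Rated h v' i → v ≤ v'

open Classical in
/-- The item cluster of the representative with draw number `j`: `j` itself, and each item to be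
clustered on which every user cluster that has rated it agrees with `j`. -/
def itemCluster (p : Params) (draw : ℕ → ℕ) (h : History N) (j : ℕ) : Finset ℕ :=
  insert j ((expDraws p).filter fun k => ∀ v : Fin N, Rated h v (draw k) →
    (ClusterLikes p draw h v (draw k) ↔ ClusterLikes p draw h v (draw j)))

open Classical in
/-- Draw numbers of the exploitable items of user `u`, given the history `h` of the exploration. -/
def exploitable (p : Params) (draw : ℕ → ℕ) (h : History N) (u : Fin N) : Finset ℕ :=
  ((repDraws p).filter fun j => ClusterLikes p draw h u (draw j)).biUnion (itemCluster p draw h)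

/-- Position of `u` in its cluster. -/
def clusterRank (p : Params) (draw : ℕ → ℕ) (h : History N) (u : Fin N) : ℕ :=
  ((cluster p draw h u).filter fun v => v < u).card

open Classical in
/-- The draw number of the next recommendation to user `u` after history `h`. The permutation `σ`
gives the position of each user in the list that assigns users to items in item clustering. -/
def nextDraw (p : Params) (draw : ℕ → ℕ) (σ : Equiv.Perm (Fin N)) (h : History N) (u : Fin N) : ℕ :=
  let t := h.length
  -- a new item, which no user gets at any other time
  let fresh := p.Iusr + p.Irep + p.Iexp + (t * N + u)
  let t₁ := p.Iusr + findPrefsTime p draw h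
  let t₂ := t₁ + itemClusteringTime N p
  if t < p.Iusr then
    -- user clustering: each clustering item goes to all users
    t
  else if t < t₁ then
    -- finding preferences: within each cluster the representatives are handed out one by one
    let k := (t - p.Iusr) * (cluster p draw h u).card + clusterRank p draw h u
    if k < p.Irep then p.Iusr + k else fresh
  else if t < t₂ then
    -- item clustering: the permuted list of users is repeated and cut into blocks of length `rI`,
    -- and the `k`-th block of users gets the `k`-th item
    let k := ((t - t₁) * N + σ u) / p.rI
    if k < p.Iexp then p.Iusr + p.Irep + k else fresh
  else
    -- exploitation: the first exploitable item not yet rated by `u`, if there is one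
    let c := (exploitable p draw (h.take t₂) u).filter fun k => ¬ Rated h u (draw k)
    if hc : c.Nonempty then c.min' hc else fresh

/-- The algorithm with given parameters. -/
def policy (p : Params) (draw : ℕ → ℕ) (σ : Equiv.Perm (Fin N)) : Policy N :=
  fun h u => draw (nextDraw p draw σ h u)

end Algorithm

/-! ### Choice of the parameters, and the regret curves -/

def rU (N qU : ℕ) : ℕ := ⌈2 * Real.logb 2 (N * (qU : ℝ) ^ 2)⌉₊

def rI (N qI : ℕ) : ℕ := ⌈2 * Real.logb 2 (N * qI)⌉₊

def kItem (N qI : ℕ) (T : ℝ) : ℝ := 16 * Real.logb 2 T + 2 * √(qI * rI N qI / N * T)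

def kHybrid (N qU qI : ℕ) (T : ℝ) : ℝ := 8 * rU N qU + 2 * √(rI N qI * qI * T / qU)

/-- The largest `T > 0` with `kItem ≤ rU`. -/
def tItem (N qU qI : ℕ) : ℝ := sSup {T : ℝ | 0 < T ∧ kItem N qI T ≤ rU N qU}

/-- The largest `T > 0` with `kHybrid ≤ qI / 3`, and `0` if there is none. -/
def tHybrid (N qU qI : ℕ) : ℝ := sSup {T : ℝ | 0 < T ∧ kHybrid N qU qI T ≤ qI / 3}

def RU (N qU : ℕ) (T : ℝ) : ℝ := rU N qU + qU / N * T

open Classical in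
def RI (N qU qI : ℕ) (T : ℝ) : ℝ :=
  if T < tItem N qU qI then
    Real.logb 2 T + √(qI * rI N qI / N * T)
  else if T < tHybrid N qU qI then
    rU N qU + 1 / N * √(qI * qU * rI N qI * T)
  else
    rU N qU + qU / N * (qI * Real.logb 2 (N * qI)) + rI N qI / N * T

open Classical in
def ell (N qU qI : ℕ) (T : ℝ) : ℝ :=
  if kItem N qI T ≤ rU N qU then kItem N qI T
  else if kHybrid N qU qI T ≤ qI / 3 then kHybrid N qU qI T
  else qI

/-- Parameters when the item structure is not used. -/
def paramsNoItemClust (N qU qI T : ℕ) : Params where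
  rU := rU N qU
  rI := rI N qI
  Iusr := rU N qU
  Irep := 6 * T
  Iexp := 0

open Classical in
/-- Parameters when the item structure is used. -/
def paramsItemClust (N qU qI T : ℕ) : Params where
  rU := rU N qU
  rI := rI N qI
  Iusr := if (rU N qU : ℝ) < ell N qU qI T then rU N qU else 0
  Irep := if ell N qU qI T ≤ qI / 3 then ⌈3 * ell N qU qI T⌉₊
    else ⌈qI * Real.logb 2 (N * qI)⌉₊
  Iexp := ⌈16 * (qI / ell N qU qI T) * T⌉₊

open Classical in
def params (N qU qI T : ℕ) : Params :=
  if RU N qU T ≤ RI N qU qI T then paramsNoItemClust N qU qI T else paramsItemClust N qU qI T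

/-- The algorithm for time horizon `T`; its random seed is the permutation `σ` of the users. -/
def recommendationSystem (N qU qI T : ℕ) (draw : ℕ → ℕ) (σ : Equiv.Perm (Fin N)) : Policy N :=
  policy (params N qU qI T) draw σ

end RecSys

end

namespace RecSys

/-! ### Averages over finite product spaces -/

section Averages

variable {ι α β : Type*} [Fintype ι] [DecidableEq ι] [Fintype α] [Fintype β]

/-! Everything is reduced to finite averages. Within `T` steps only finitely many draws occur, the
algorithm never uses the names of items, and distinct items have independent uniform types. So the
regret is an average over user types, finitely many item types and the matrix (`history_renumber`,
`integral_prefsLaw`, `regret_eq_avg_sum`). All further estimates hold for each fixed permutation of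
the users.

The schedule of the exploration depends on the ratings only through the user clusters, that is,
through agreements. Negating the whole matrix keeps the schedule and turns likes into dislikes, so
exploration costs exactly half a dislike per step. Hence the regret is half of the expected
(truncated) exploration time plus the expected number of exploitation misses (`regret_eq_avg`).

A miss needs one of three accidents (`avg_misses_le`): a cluster of users with different tastes, a
pool with fewer than `T` items, or a confused item, which its block of users could not tell from a
representative of another type. In the first and the third case two rows or two columns of the
matrix agree on `k` randomly sampled types. A sample of size at most `q` from `q` types has many
distinct values, so this has probability at most `coinBase ^ k`. As `coinBase ^ 2 ≤ 1 / 2`, the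
lengths `rU` and `rI`, twice a logarithm, are enough. Pools are large by exponential moments: many
types among the representatives are liked, and many items have such types. When all user types are
about as frequent as expected, the exploration time is explicit; the choice of `ell` balances the
handing out of representatives against item clustering. This gives the curves `RU` and `RI` up to a
constant.

The bound `T / 2` leaves no constant to spare. It is immediate if exploration fills the horizon, and
if `T` is well above the exploration time, then the errors fit into the gap. The delicate case is
the hybrid regime with `T` at most `6 / 5 * rU`. There only representatives liked by a cluster mate
are exploited, unless these run out, and they are compared with a fresh item. The expected advantage
of a representative is half of the expectation of `gain`, which is nonnegative unless the two users
have different types and both items have types not seen in user clustering. On those samples the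
involution `exchange` reverses the sign of the gain, so they cancel. A positive contribution of
order `1 / qI` remains (`firstGain`), when the first candidate repeats the type of a clustering
item; it pays for the exponentially small probability that the liked candidates run out
(`regret_le_half_of_window`). -/

lemma avg_mono {f g : α → ℝ} (h : ∀ a, f a ≤ g a) : 𝔼 a, f a ≤ 𝔼 a, g a :=
  Finset.expect_le_expect fun a _ => h a

lemma avg_nonneg {f : α → ℝ} (h : ∀ a, 0 ≤ f a) : 0 ≤ 𝔼 a, f a :=
  Finset.expect_nonneg fun a _ => h a

lemma avg_le_const [Nonempty α] {f : α → ℝ} {b : ℝ} (h : ∀ a, f a ≤ b) : 𝔼 a, f a ≤ b :=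
  Finset.expect_le Finset.univ_nonempty fun a _ => h a

lemma avg_prod (f : α → β → ℝ) : 𝔼 x : α × β, f x.1 x.2 = 𝔼 a, 𝔼 b, f a b :=
  Finset.expect_product' Finset.univ Finset.univ f

/-- The average of a product of functions of the single coordinates is the product of the
averages. -/
lemma avg_pi_prod (φ : ι → α → ℝ) : 𝔼 x : ι → α, ∏ i, φ i (x i) = ∏ i, 𝔼 a, φ i a := by
  simp_rw [Fintype.expect_eq_sum_div_card]
  rw [Finset.prod_div_distrib, Finset.prod_univ_sum, Fintype.piFinset_univ]
  simp

lemma avg_pi_congr {π : ι → Type*} [∀ i, Fintype (π i)] (f : ((i : ι) → π i) → ℝ)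
    (e : ((i : ι) → π i) ≃ ((i : ι) → π i)) : 𝔼 x, f (e x) = 𝔼 x, f x :=
  Fintype.expect_equiv e _ _ fun _ => rfl

/-- Resampling the coordinates outside `s` does not change an average. -/
lemma avg_piecewise [Nonempty α] (s : Finset ι) (f : (ι → α) → ℝ) :
    𝔼 x : ι → α, f x = 𝔼 x : ι → α, 𝔼 y : ι → α, f (s.piecewise x y) := by
  -- Two independent copies exchange their coordinates outside `s`; this is an involution of the
  -- pairs, and its first component is the resampled point.
  let e : (ι → α) × (ι → α) ≃ (ι → α) × (ι → α) :=
    { toFun := fun z => (s.piecewise z.1 z.2, s.piecewise z.2 z.1)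
      invFun := fun z => (s.piecewise z.1 z.2, s.piecewise z.2 z.1)
      left_inv := fun z => by
        ext i <;> by_cases h : i ∈ s <;> simp [h]
      right_inv := fun z => by
        ext i <;> by_cases h : i ∈ s <;> simp [h] }
  rw [← avg_prod (fun x y : ι → α => f (s.piecewise x y))]
  rw [Fintype.expect_equiv e (fun z => f (s.piecewise z.1 z.2)) (fun z => f z.1) fun z => rfl,
    avg_prod (fun x _ : ι → α => f x)]
  simp

/-- Averages of functions on a matrix that factor over its columns. -/
lemma avg_columns [DecidableEq β] (φ : β → (α → Bool) → ℝ) [DecidableEq α] :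
    𝔼 ξ : α × β → Bool, ∏ b, φ b (fun a => ξ (a, b)) = ∏ b, 𝔼 x : α → Bool, φ b x := by
  let e : (α × β → Bool) ≃ (β → α → Bool) :=
    ((Equiv.prodComm β α).arrowCongr (Equiv.refl Bool)).symm.trans (Equiv.curry β α Bool)
  rw [← avg_pi_prod]
  exact Fintype.expect_equiv e _ _ fun ξ => rfl

/-- Averages of functions on a matrix that factor over its rows. -/
lemma avg_rows [DecidableEq β] (φ : α → (β → Bool) → ℝ) [DecidableEq α] :
    𝔼 ξ : α × β → Bool, ∏ a, φ a (fun b => ξ (a, b)) = ∏ a, 𝔼 x : β → Bool, φ a x := by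
  let e : (α × β → Bool) ≃ (α → β → Bool) := Equiv.curry α β Bool
  rw [← avg_pi_prod]
  exact Fintype.expect_equiv e _ _ fun ξ => rfl

/-- The average of a function of a single coordinate. -/
lemma avg_coord [Nonempty α] (i : ι) (f : α → ℝ) : 𝔼 x : ι → α, f (x i) = 𝔼 a, f a := by
  have h := avg_pi_prod (ι := ι) (fun j a => if j = i then f a else 1)
  have h1 : ∀ x : ι → α, ∏ j, (if j = i then f (x j) else 1) = f (x i) := fun x => by simp
  simp_rw [h1] at h
  rw [h, Finset.prod_eq_single i]
  · simp
  · intro j _ hj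
    simp [hj]
  · simp

lemma avg_indicator [DecidableEq α] (s : Finset α) :
    𝔼 a : α, (if a ∈ s then (1 : ℝ) else 0) = s.card / Fintype.card α := by
  rw [Fintype.expect_eq_sum_div_card]
  simp

/-- The probability that none of the coordinates in `I` falls into `s`. -/
lemma avg_avoid [Nonempty α] [DecidableEq α] (I : Finset ι) (s : Finset α) :
    𝔼 x : ι → α, (if ∀ i ∈ I, x i ∉ s then (1 : ℝ) else 0) =
      (1 - s.card / Fintype.card α) ^ I.card := by
  have h1 : ∀ x : ι → α, (if ∀ i ∈ I, x i ∉ s then (1 : ℝ) else 0) =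
      ∏ i, (if i ∈ I then (if x i ∈ s then 0 else 1) else 1) := fun x => by
    rw [Finset.prod_ite_mem, Finset.univ_inter]
    split_ifs with h
    · exact (Finset.prod_eq_one fun i hi => by simp [h i hi]).symm
    · push Not at h
      obtain ⟨i, hi, hs⟩ := h
      exact (Finset.prod_eq_zero hi (by simp [hs])).symm
  simp_rw [h1]
  rw [avg_pi_prod (fun i a => if i ∈ I then (if a ∈ s then (0 : ℝ) else 1) else 1)]
  have h2 : ∀ i, 𝔼 a : α, (if i ∈ I then (if a ∈ s then (0 : ℝ) else 1) else 1) =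
      if i ∈ I then 1 - (s.card : ℝ) / Fintype.card α else 1 := fun i => by
    split_ifs
    · rw [← avg_indicator s, ← Fintype.expect_const (ι := α) (1 : ℝ), ← Finset.expect_sub_distrib]
      refine Finset.expect_congr rfl fun a _ => ?_
      by_cases h : a ∈ s <;> simp [h]
    · simp
  simp_rw [h2]
  rw [Finset.prod_ite_mem, Finset.univ_inter, Finset.prod_const]

/-- The number of distinct values in `Q` that a uniform sample takes: its generating function on
`[0, 1]` is bounded as if the values were missed independently. -/
lemma avg_pow_card_image_le [Nonempty α] [DecidableEq α] (I : Finset ι) (Q : Finset α) {z : ℝ}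
    (h0 : 0 ≤ z) (h1 : z ≤ 1) :
    𝔼 x : ι → α, z ^ (I.image x ∩ Q).card ≤
      (z + (1 - z) * (1 - 1 / Fintype.card α) ^ I.card) ^ Q.card := by
  set q : ℝ := (Fintype.card α : ℝ) with hq
  have hq1 : 1 ≤ q := by
    rw [hq]; exact_mod_cast Fintype.card_pos
  -- Each value in `Q` contributes `z` if it is taken and `(1 - z) + z` if it is missed. Expanding
  -- the product leaves a sum over sets `t` of values that are all missed, with nonnegative weights.
  have e1 : ∀ x : ι → α, z ^ (I.image x ∩ Q).card =
      ∑ t ∈ Q.powerset, (if ∀ i ∈ I, x i ∉ t then (1 : ℝ) else 0) *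
        ((1 - z) ^ t.card * z ^ (Q \ t).card) := fun x => by
    have : z ^ (I.image x ∩ Q).card =
        ∏ b ∈ Q, ((if b ∈ I.image x then 0 else (1 - z)) + z) := by
      have : ∀ b ∈ Q, ((if b ∈ I.image x then 0 else (1 - z)) + z) =
        if b ∈ I.image x then z else 1 := fun b _ => by split_ifs <;> ring
      rw [Finset.prod_congr rfl this, Finset.prod_ite, Finset.prod_const_one, mul_one,
        Finset.prod_const, Finset.filter_mem_eq_inter, Finset.inter_comm]
    rw [this, Finset.prod_add]
    refine Finset.sum_congr rfl fun t _ => ?_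
    rw [Finset.prod_const, ← mul_assoc]
    congr 1
    split_ifs with h
    · rw [one_mul, ← Finset.prod_const]
      refine Finset.prod_congr rfl fun b hb => ?_
      rw [if_neg]
      intro hb'
      obtain ⟨i, hi, rfl⟩ := Finset.mem_image.1 hb'
      exact h i hi hb
    · push Not at h
      obtain ⟨i, hi, hs⟩ := h
      rw [zero_mul]
      exact Finset.prod_eq_zero hs (by rw [if_pos (Finset.mem_image_of_mem x hi)])
  simp_rw [e1]
  rw [Finset.expect_sum_comm]
  simp_rw [← Finset.expect_mul, avg_avoid]
  have e2 : (z + (1 - z) * (1 - 1 / q) ^ I.card) ^ Q.card =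
      ∑ t ∈ Q.powerset, ((1 - 1 / q) ^ I.card) ^ t.card *
        ((1 - z) ^ t.card * z ^ (Q \ t).card) := by
    rw [← Finset.prod_const, Finset.prod_congr rfl fun b _ => add_comm z _, Finset.prod_add]
    refine Finset.sum_congr rfl fun t _ => ?_
    rw [Finset.prod_const, Finset.prod_const, mul_pow]
    ring
  rw [e2]
  refine Finset.sum_le_sum fun t _ => ?_
  refine mul_le_mul_of_nonneg_right ?_ (mul_nonneg (pow_nonneg (by linarith) _) (pow_nonneg h0 _))
  have ht : (t.card : ℝ) ≤ q := by rw [hq]; exact_mod_cast t.card_le_univ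
  -- Bernoulli's inequality `1 - |t| / q ≤ (1 - 1 / q) ^ |t|`: missing all of `t` is at most as
  -- likely as under independence.
  rw [pow_right_comm]
  refine pow_le_pow_left₀ ?_ ?_ _
  · rw [sub_nonneg, div_le_one (by linarith)]; exact ht
  · have := one_add_mul_le_pow (a := -(1 / q)) (by
      have : 1 / q ≤ 1 := by rw [div_le_one (by linarith)]; exact hq1
      linarith) t.card
    calc 1 - t.card / q = 1 + t.card * (-(1 / q)) := by ring
      _ ≤ _ := this
      _ = _ := by ring

/-- The previous bound, for a sample of size `n` with `s ≤ n / q` in `[0, 1]`, in exponential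
form. -/
lemma avg_pow_card_image_le_exp [Nonempty α] [DecidableEq α] (I : Finset ι) (Q : Finset α) {z b s : ℝ}
    (h0 : 0 ≤ z) (h1 : z ≤ 1) (hs0 : 0 ≤ s) (hs1 : s ≤ 1)
    (hI : b * s * Fintype.card α ≤ I.card) :
    𝔼 x : ι → α, z ^ (I.image x ∩ Q).card ≤ (z + (1 - z) * Real.exp (-b)) ^ (s * Q.card) := by
  set q : ℝ := (Fintype.card α : ℝ) with hq
  have hq1 : 1 ≤ q := by
    rw [hq]; exact_mod_cast Fintype.card_pos
  refine (avg_pow_card_image_le I Q h0 h1).trans ?_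
  rw [← hq]
  have hE : (1 - 1 / q) ^ I.card ≤ (Real.exp (-b)) ^ s := by
    have h2 : 1 - 1 / q ≤ Real.exp (-(1 / q)) := by
      have := Real.add_one_le_exp (-(1 / q)); linarith
    have h3 : 0 ≤ 1 - 1 / q := by
      rw [sub_nonneg, div_le_one (by linarith)]; exact hq1
    calc (1 - 1 / q) ^ I.card ≤ Real.exp (-(1 / q)) ^ I.card := pow_le_pow_left₀ h3 h2 _
      _ = Real.exp (-(I.card / q)) := by rw [← Real.exp_nat_mul]; congr 1; ring
      _ ≤ Real.exp (-b * s) := by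
        refine Real.exp_le_exp.2 ?_
        have : b * s ≤ I.card / q := by rw [le_div_iff₀ (by linarith)]; exact hI
        linarith
      _ = _ := by rw [Real.exp_mul]
  have hz : z + (1 - z) * (1 - 1 / q) ^ I.card ≤ (z + (1 - z) * Real.exp (-b)) ^ s := by
    -- Concavity of `x ↦ x ^ s`, for the mean of `1` and `exp (-b)` with weights `z` and `1 - z`.
    have hc := (Real.concaveOn_rpow hs0 hs1).2 (x := 1) (y := Real.exp (-b)) (by simp)
      (by simpa using (Real.exp_pos _).le) h0 (by linarith : 0 ≤ 1 - z) (by ring)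
    simp only [smul_eq_mul, Real.one_rpow, mul_one] at hc
    refine le_trans ?_ hc
    have : 0 ≤ 1 - z := by linarith
    gcongr
  have h3 : 0 ≤ 1 - 1 / q := by
    rw [sub_nonneg, div_le_one (by linarith)]; exact hq1
  have h4 : 0 ≤ 1 - z := by linarith
  calc (z + (1 - z) * (1 - 1 / q) ^ I.card) ^ Q.card
      ≤ ((z + (1 - z) * Real.exp (-b)) ^ s) ^ Q.card := pow_le_pow_left₀ (by positivity) hz _
    _ = _ := by rw [Real.rpow_mul_natCast]; positivity

end Averages

/-! ### The law of the model as a finite average -/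

/-- The only infinite object is the sequence of item types. Its restriction to finitely many
distinct items is again uniform on a finite power, which turns the integral into iterated averages.
-/
lemma integral_prefsLaw {N qU qI K : ℕ} [NeZero qU] [NeZero qI] (d : Fin K → ℕ)
    (hd : Function.Injective d)
    (F : (Fin N → Fin qU) → (Fin K → Fin qI) → (Fin qU × Fin qI → Bool) → ℝ) :
    ∫ x, F x.1 (fun k => x.2.1 (d k)) x.2.2 ∂(prefsLaw N qU qI) =
      𝔼 τ, 𝔼 c, 𝔼 ξ, F τ c ξ := by
  have hu : ∀ (α : Type) [Fintype α] [Nonempty α] [MeasurableSpace α]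
      [MeasurableSingletonClass α], IsProbabilityMeasure (uniformOn (Set.univ : Set α)) :=
    fun α _ _ _ _ => isProbabilityMeasure_uniformOn Set.finite_univ Set.univ_nonempty
  have hs : ∀ (α : Type) [Fintype α] [Nonempty α] [MeasurableSpace α]
      [MeasurableSingletonClass α] (a : α),
      (uniformOn (Set.univ : Set α)) {a} = (Fintype.card α : ENNReal)⁻¹ := fun α _ _ _ _ a => by
    rw [uniformOn_univ]; simp
  have := hu (Fin qU)
  have := hu (Fin qI)
  have := hu Bool
  have hf : ∀ (ι α : Type) [Fintype ι] [DecidableEq ι] [Fintype α] [Nonempty α]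
      [MeasurableSpace α] [MeasurableSingletonClass α]
      (μ : Measure (ι → α)) (_ : IsProbabilityMeasure μ)
      (_ : ∀ y, μ {y} = ∏ _i : ι, (Fintype.card α : ENNReal)⁻¹) (f : (ι → α) → ℝ),
      ∫ y, f y ∂μ = 𝔼 y, f y := by
    intro ι α _ _ _ _ _ _ μ _ hμ f
    rw [integral_fintype (.of_finite), Fintype.expect_eq_sum_div_card, Finset.sum_div]
    refine Finset.sum_congr rfl fun y _ => ?_
    rw [Measure.real, hμ]
    simp [ENNReal.toReal_inv, div_eq_inv_mul]
  let μI : Measure (ℕ → Fin qI) :=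
    Measure.infinitePi fun _ : ℕ => (uniformOn Set.univ : Measure (Fin qI))
  let μ1 := Measure.pi fun _ : Fin N => (uniformOn Set.univ : Measure (Fin qU))
  let μ3 := Measure.pi fun _ : Fin qU × Fin qI => (uniformOn Set.univ : Measure Bool)
  have hr : Measurable (fun (y : ℕ → Fin qI) k => y (d k)) :=
    measurable_pi_lambda _ fun k => measurable_pi_apply _
  let μ2 : Measure (Fin K → Fin qI) := μI.map fun y k => y (d k)
  have hμ2 : IsProbabilityMeasure μ2 := Measure.isProbabilityMeasure_map hr.aemeasurable
  have hm : (prefsLaw N qU qI).map (Prod.map id (Prod.map (fun y k => y (d k)) id)) =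
      μ1.prod (μ2.prod μ3) := by
    rw [prefsLaw, ← Measure.map_prod_map _ _ measurable_id (hr.prodMap measurable_id),
      Measure.map_id, ← Measure.map_prod_map _ _ hr measurable_id, Measure.map_id]
  have hmeas : Measurable (Prod.map id (Prod.map (fun y k => y (d k)) id) :
      Prefs N qU qI → (Fin N → Fin qU) × (Fin K → Fin qI) × (Fin qU × Fin qI → Bool)) :=
    measurable_id.prodMap (hr.prodMap measurable_id)
  have : ∫ x, F x.1 (fun k => x.2.1 (d k)) x.2.2 ∂(prefsLaw N qU qI) =
      ∫ z, F z.1 z.2.1 z.2.2 ∂(μ1.prod (μ2.prod μ3)) := by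
    rw [← hm, integral_map hmeas.aemeasurable]
    · rfl
    · exact AEStronglyMeasurable.of_discrete
  rw [this, integral_prod _ (.of_finite), hf _ _ μ1 inferInstance]
  · refine Finset.expect_congr rfl fun τ _ => ?_
    rw [integral_prod _ (.of_finite), hf _ _ μ2 hμ2]
    · refine Finset.expect_congr rfl fun c _ => ?_
      rw [hf _ _ μ3 inferInstance]
      intro y
      rw [Measure.pi_singleton]
      simp only [hs]
    · intro y
      rw [Measure.map_apply hr (measurableSet_singleton y)]
      -- The preimage of a point is written as a cylinder over the range of `d`. By injectivity each
      -- of its side conditions pins down a single value.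
      have : (fun (y : ℕ → Fin qI) k => y (d k)) ⁻¹' {y} =
          Set.pi (Finset.univ.image d : Finset ℕ)
            fun i => {z | ∀ k, d k = i → z = y k} := by
        ext z
        simp only [Set.mem_preimage, Set.mem_singleton_iff, Finset.coe_image, Finset.coe_univ,
          Set.image_univ, Set.mem_pi, Set.mem_range, forall_exists_index,
          forall_apply_eq_imp_iff, Set.mem_ofPred_eq, funext_iff]
        constructor
        · intro h k k' hk
          rw [← hd hk]; exact h k'
        · intro h k
          exact h k k rfl
      rw [this, Measure.infinitePi_pi _ (fun i _ => MeasurableSet.of_discrete),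
        Finset.prod_image fun a _ b _ h => hd h]
      refine Finset.prod_congr rfl fun k _ => ?_
      have : {z | ∀ k', d k' = d k → z = y k'} = {y k} := by
        ext z
        constructor
        · intro h; exact h k rfl
        · rintro rfl k' hk
          rw [hd hk]
      rw [this, hs]
  · intro y
    rw [Measure.pi_singleton]
    simp only [hs]


/-! ### The course of the algorithm -/

section Course

variable {N : ℕ}

/-- Replacing draw numbers by items in a history. -/
def renumber (draw : ℕ → ℕ) (h : History N) : History N :=
  h.map fun e u => (draw (e u).1, (e u).2)

lemma rated_renumber {draw : ℕ → ℕ} (hd : Function.Injective draw) (h : History N) (u : Fin N)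
    (k : ℕ) : Rated (renumber draw h) u (draw k) ↔ Rated h u k := by
  simp [Rated, renumber, hd.eq_iff]

lemma liked_renumber {draw : ℕ → ℕ} (hd : Function.Injective draw) (h : History N) (u : Fin N)
    (k : ℕ) : Liked (renumber draw h) u (draw k) ↔ Liked h u k := by
  simp [Liked, renumber, hd.eq_iff, Prod.ext_iff]

lemma cluster_renumber (p : Params) {draw : ℕ → ℕ} (hd : Function.Injective draw) (h : History N)
    (u : Fin N) : cluster p draw (renumber draw h) u = cluster p id h u := by
  classical
  simp only [cluster]
  congr 1
  ext v
  simp only [Finset.mem_filter, liked_renumber hd, id]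

lemma clusterLikes_renumber (p : Params) {draw : ℕ → ℕ} (hd : Function.Injective draw)
    (h : History N) (u : Fin N) (k : ℕ) :
    ClusterLikes p draw (renumber draw h) u (draw k) ↔ ClusterLikes p id h u k := by
  simp only [ClusterLikes, liked_renumber hd, rated_renumber hd, cluster_renumber p hd]

lemma exploitable_renumber (p : Params) {draw : ℕ → ℕ} (hd : Function.Injective draw)
    (h : History N) (u : Fin N) :
    exploitable p draw (renumber draw h) u = exploitable p id h u := by
  have : itemCluster p draw (renumber draw h) = itemCluster p id h := by
    funext j
    ext k
    simp only [itemCluster, Finset.mem_insert, Finset.mem_filter, rated_renumber hd,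
      clusterLikes_renumber p hd, id]
  ext k
  simp only [exploitable, Finset.mem_biUnion, Finset.mem_filter, clusterLikes_renumber p hd, this,
    id]

open Classical in
lemma nextDraw_renumber (p : Params) {draw : ℕ → ℕ} (hd : Function.Injective draw)
    (σ : Equiv.Perm (Fin N)) (h : History N) (u : Fin N) :
    nextDraw p draw σ (renumber draw h) u = nextDraw p id σ h u := by
  have h1 : (renumber draw h).length = h.length := by simp [renumber]
  have h2 : ∀ n, (renumber draw h).take n = renumber draw (h.take n) := fun n => by
    simp [renumber, List.map_take]
  have h3 : ∀ E : Finset ℕ, (E.filter fun k => ¬ Rated (renumber draw h) u (draw k)) =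
      E.filter fun k => ¬ Rated h u k := fun E => by
    ext k
    simp only [Finset.mem_filter, rated_renumber hd]
  simp only [nextDraw, h1, h2, findPrefsTime, clusterRank, cluster_renumber p hd,
    exploitable_renumber p hd, id]
  have key : ∀ (c c' : Finset ℕ) (d : ℕ), c = c' →
      (if hc : c.Nonempty then c.min' hc else d) =
        if hc : c'.Nonempty then c'.min' hc else d := by
    rintro c _ d rfl
    rfl
  congr 3
  exact key _ _ _ (h3 _)

/-- The algorithm compares items only for equality and addresses them by draw number, so an
injective renaming commutes with its whole course. This is why the order of drawing is irrelevant.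
-/
lemma history_renumber (p : Params) {draw : ℕ → ℕ} (hd : Function.Injective draw)
    (σ : Equiv.Perm (Fin N)) (L : Fin N → ℕ → Bool) (t : ℕ) :
    history (policy p draw σ) L t =
      renumber draw (history (policy p id σ) (fun u k => L u (draw k)) t) := by
  induction t with
  | zero => rfl
  | succ t ih =>
    simp only [history, ih, renumber, List.map_append, List.map_cons, List.map_nil]
    simp only [policy]
    rw [← renumber]
    simp only [nextDraw_renumber p hd, id]

/-- The ratings that the algorithm sees, as a function of the user and the draw number, determine
the draw numbers of its recommendations. -/
noncomputable def drawAt (p : Params) (σ : Equiv.Perm (Fin N)) (g : Fin N → ℕ → Bool) (u : Fin N) (t : ℕ) : ℕ :=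
  nextDraw p id σ (history (policy p id σ) g t) u

lemma action_policy (p : Params) {draw : ℕ → ℕ} (hd : Function.Injective draw)
    (σ : Equiv.Perm (Fin N)) (L : Fin N → ℕ → Bool) (u : Fin N) (t : ℕ) :
    action (policy p draw σ) L u t = draw (drawAt p σ (fun u k => L u (draw k)) u t) := by
  rw [action, history_renumber p hd, policy, nextDraw_renumber p hd, drawAt]

lemma history_length (f : Policy N) (g : Fin N → ℕ → Bool) (t : ℕ) :
    (history f g t).length = t := by
  induction t with
  | zero => rfl
  | succ t ih => simp [history, ih]

lemma history_take (f : Policy N) (g : Fin N → ℕ → Bool) {s t : ℕ} (h : s ≤ t) :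
    (history f g t).take s = history f g s := by
  induction t, h using Nat.le_induction with
  | base => rw [List.take_of_length_le (history_length f g s).le]
  | succ t h ih =>
    rw [history, List.take_append_of_le_length (by rw [history_length]; exact h), ih]

lemma mem_history (f : Policy N) (g : Fin N → ℕ → Bool) (t : ℕ) (e : Fin N → ℕ × Bool) :
    e ∈ history f g t ↔
      ∃ s < t, e = fun u => (f (history f g s) u, g u (f (history f g s) u)) := by
  induction t with
  | zero => simp [history]
  | succ t ih =>
    simp only [history, List.mem_append, ih, List.mem_singleton, Nat.lt_succ_iff_lt_or_eq]
    constructor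
    · rintro (⟨s, hs, rfl⟩ | rfl)
      · exact ⟨s, .inl hs, rfl⟩
      · exact ⟨t, .inr rfl, rfl⟩
    · rintro ⟨s, hs | rfl, rfl⟩
      · exact .inl ⟨s, hs, rfl⟩
      · exact .inr rfl

lemma exploitable_subset (p : Params) (draw : ℕ → ℕ) (h : History N) (u : Fin N) :
    exploitable p draw h u ⊆ repDraws p ∪ expDraws p := by
  intro k hk
  simp only [exploitable, Finset.mem_biUnion, Finset.mem_filter, itemCluster, Finset.mem_insert]
    at hk
  obtain ⟨j, ⟨hj, -⟩, rfl | ⟨hk, -⟩⟩ := hk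
  · exact Finset.mem_union_left _ hj
  · exact Finset.mem_union_right _ hk

/-- A bound on the draw numbers that are used within `T` time steps. -/
def drawBound (N : ℕ) (p : Params) (T : ℕ) : ℕ := p.Iusr + p.Irep + p.Iexp + T * N

lemma nextDraw_lt (p : Params) (draw : ℕ → ℕ) (σ : Equiv.Perm (Fin N)) (h : History N)
    (u : Fin N) {T : ℕ} (hT : h.length < T) : nextDraw p draw σ h u < drawBound N p T := by
  have hf : p.Iusr + p.Irep + p.Iexp + (h.length * N + u) < drawBound N p T := by
    have : (h.length + 1) * N ≤ T * N := Nat.mul_le_mul_right _ hT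
    have := u.2
    simp only [drawBound]
    nlinarith
  have hb : p.Iusr + p.Irep + p.Iexp ≤ drawBound N p T := by simp [drawBound]
  classical
  simp only [nextDraw]
  split_ifs with h1 h2 h3 h4 h5 h6
  · omega
  · omega
  · exact hf
  · omega
  · exact hf
  · have := exploitable_subset _ _ _ _ (Finset.filter_subset _ _ (Finset.min'_mem _ h6))
    simp only [repDraws, expDraws, Finset.mem_union, Finset.mem_Ico] at this
    omega
  · exact hf

/-- Ratings of draws beyond `drawBound` are never requested before time `T`, so the course up to
then is a function of finitely many item types. -/
lemma history_congr (p : Params) (σ : Equiv.Perm (Fin N)) {g g' : Fin N → ℕ → Bool} {T : ℕ}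
    (h : ∀ u, ∀ k < drawBound N p T, g u k = g' u k) {t : ℕ} (ht : t ≤ T) :
    history (policy p id σ) g t = history (policy p id σ) g' t := by
  induction t with
  | zero => rfl
  | succ t ih =>
    rw [history, history, ih (by omega)]
    congr 2
    funext u
    rw [h]
    exact nextDraw_lt _ _ _ _ _ (by rw [history_length]; omega)

lemma drawAt_congr (p : Params) (σ : Equiv.Perm (Fin N)) {g g' : Fin N → ℕ → Bool} {T : ℕ}
    (h : ∀ u, ∀ k < drawBound N p T, g u k = g' u k) (u : Fin N) {t : ℕ} (ht : t ≤ T) :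
    drawAt p σ g u t = drawAt p σ g' u t := by
  rw [drawAt, history_congr p σ h ht, drawAt]

lemma drawAt_lt (p : Params) (σ : Equiv.Perm (Fin N)) (g : Fin N → ℕ → Bool) (u : Fin N)
    {t T : ℕ} (ht : t < T) : drawAt p σ g u t < drawBound N p T :=
  nextDraw_lt _ _ _ _ _ (by rwa [history_length])

/-! ### The exploration schedule as a function of the user clusters -/

section Phases

variable (p : Params) (σ : Equiv.Perm (Fin N)) (g : Fin N → ℕ → Bool)

/-- The user clusters, in terms of the ratings of the draws. -/
def clus (u : Fin N) : Finset (Fin N) :=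
  if p.rU ≤ p.Iusr then Finset.univ.filter fun v => ∀ k < p.Iusr, g v k = g u k else {u}

/-- The duration of the phase in which the preferences are found. -/
def prefsTime : ℕ := Finset.univ.sup fun u : Fin N => p.Irep ⌈/⌉ (clus p g u).card

/-- The end of the exploration. -/
def exploreTime : ℕ := p.Iusr + prefsTime p g + itemClusteringTime N p

def clusRank (u : Fin N) : ℕ := ((clus p g u).filter fun v => v < u).card

/-- The draw numbers that are recommended during the exploration. -/
def exploreDraw (u : Fin N) (t : ℕ) : ℕ :=
  if t < p.Iusr then t
  else if t < p.Iusr + prefsTime p g then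
    if (t - p.Iusr) * (clus p g u).card + clusRank p g u < p.Irep then
      p.Iusr + ((t - p.Iusr) * (clus p g u).card + clusRank p g u)
    else p.Iusr + p.Irep + p.Iexp + (t * N + u)
  else
    if ((t - (p.Iusr + prefsTime p g)) * N + σ u) / p.rI < p.Iexp then
      p.Iusr + p.Irep + ((t - (p.Iusr + prefsTime p g)) * N + σ u) / p.rI
    else p.Iusr + p.Irep + p.Iexp + (t * N + u)

local notation "hist" => history (policy p id σ) g

lemma rated_iff (t : ℕ) (u : Fin N) (k : ℕ) :
    Rated (hist t) u k ↔ ∃ s < t, drawAt p σ g u s = k := by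
  simp only [Rated, mem_history, drawAt]
  constructor
  · rintro ⟨_, ⟨s, hs, rfl⟩, h⟩
    exact ⟨s, hs, h⟩
  · rintro ⟨s, hs, h⟩
    exact ⟨_, ⟨s, hs, rfl⟩, h⟩

lemma liked_iff (t : ℕ) (u : Fin N) (k : ℕ) :
    Liked (hist t) u k ↔ Rated (hist t) u k ∧ g u k = true := by
  simp only [Liked, Rated, mem_history, policy, id]
  constructor
  · rintro ⟨_, ⟨s, hs, rfl⟩, h⟩
    simp only [Prod.mk.injEq] at h
    refine ⟨⟨_, ⟨s, hs, rfl⟩, h.1⟩, ?_⟩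
    rw [← h.2, h.1]
  · rintro ⟨⟨_, ⟨s, hs, rfl⟩, h⟩, h2⟩
    simp only at h
    refine ⟨_, ⟨s, hs, rfl⟩, ?_⟩
    simp only [h, h2]

lemma drawAt_of_lt_usr (u : Fin N) {t : ℕ} (ht : t < p.Iusr) : drawAt p σ g u t = t := by
  simp [drawAt, nextDraw, history_length, ht]

/-- From time `Iusr` on every user has rated every clustering draw, so "liked" and "rated `+1`"
coincide on them and the clusters no longer change. -/
lemma cluster_eq (u : Fin N) {t : ℕ} (ht : p.Iusr ≤ t) :
    cluster p id (hist t) u = clus p g u := by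
  have : ∀ v, ∀ k < p.Iusr, Liked (hist t) v k ↔ g v k = true := fun v k hk => by
    rw [liked_iff, rated_iff]
    exact and_iff_right ⟨k, by omega, drawAt_of_lt_usr p σ g v hk⟩
  simp only [cluster, clus, id]
  congr 1
  ext v
  simp only [Finset.mem_filter, Finset.mem_univ, true_and]
  refine forall₂_congr fun k hk => ?_
  rw [this v k hk, this u k hk, ← Bool.eq_iff_iff]

lemma findPrefsTime_eq {t : ℕ} (ht : p.Iusr ≤ t) :
    findPrefsTime p id (hist t) = prefsTime p g := by
  simp only [findPrefsTime, prefsTime, cluster_eq p σ g _ ht]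

/-- During exploration the ratings enter only through the clusters. The sign symmetry behind
`avg_explore` rests on this. -/
lemma drawAt_of_lt_explore (u : Fin N) {t : ℕ} (ht : t < exploreTime p g) :
    drawAt p σ g u t = exploreDraw p σ g u t := by
  rcases lt_or_ge t p.Iusr with h | h
  · rw [drawAt_of_lt_usr p σ g u h, exploreDraw, if_pos h]
  · have hr : clusterRank p id (hist t) u = clusRank p g u := by
      rw [clusterRank, cluster_eq p σ g _ h, clusRank]
    simp only [drawAt, nextDraw, history_length, findPrefsTime_eq p σ g h, hr,
      cluster_eq p σ g _ h, exploreDraw]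
    rw [if_neg (not_lt.2 h), if_neg (not_lt.2 h)]
    have : t < p.Iusr + prefsTime p g + itemClusteringTime N p := ht
    split_ifs <;> rfl

/-- The draw numbers that are exploited for user `u`. -/
noncomputable abbrev pool (u : Fin N) : Finset ℕ := exploitable p id (hist (exploreTime p g)) u

open Classical in
lemma drawAt_exploit (u : Fin N) {t : ℕ} (ht : exploreTime p g ≤ t)
    (hk : ∃ k ∈ pool p σ g u, ¬ Rated (hist t) u k) :
    drawAt p σ g u t ∈ pool p σ g u ∧ ¬ Rated (hist t) u (drawAt p σ g u t) ∧
      ∀ k ∈ pool p σ g u, ¬ Rated (hist t) u k → drawAt p σ g u t ≤ k := by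
  have h1 : p.Iusr ≤ t := by simp only [exploreTime] at ht; omega
  have h2 : ¬ t < p.Iusr + prefsTime p g := by simp only [exploreTime] at ht; omega
  have h3 : ¬ t < p.Iusr + prefsTime p g + itemClusteringTime N p := not_lt.2 ht
  have hne : ((pool p σ g u).filter fun k => ¬ Rated (hist t) u k).Nonempty := by
    obtain ⟨k, hk, hr⟩ := hk
    exact ⟨k, Finset.mem_filter.2 ⟨hk, hr⟩⟩
  have e : drawAt p σ g u t =
      ((pool p σ g u).filter fun k => ¬ Rated (hist t) u k).min' hne := by
    simp only [drawAt, nextDraw, history_length, findPrefsTime_eq p σ g h1, id]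
    rw [if_neg (not_lt.2 h1), if_neg h2, if_neg h3, dif_pos]
    · congr 1
      rw [← exploreTime, history_take _ _ ht]
    · rw [← exploreTime, history_take _ _ ht]
      exact hne
  have hm := Finset.min'_mem _ hne
  rw [← e, Finset.mem_filter] at hm
  refine ⟨hm.1, hm.2, fun k hk hr => ?_⟩
  rw [e]
  exact Finset.min'_le _ _ (Finset.mem_filter.2 ⟨hk, hr⟩)

end Phases

end Course


/-! ### Who rates what, and which items can be missed in exploitation -/

section Exploitation

variable {N : ℕ} (p : Params) (σ : Equiv.Perm (Fin N)) (g : Fin N → ℕ → Bool)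

local notation "hist" => history (policy p id σ) g

lemma mem_clus_self (u : Fin N) : u ∈ clus p g u := by
  simp only [clus]
  split_ifs <;> simp

lemma clus_eq_of_mem {u v : Fin N} (h : v ∈ clus p g u) : clus p g v = clus p g u := by
  simp only [clus] at h ⊢
  split_ifs with hr
  · rw [if_pos hr, Finset.mem_filter] at h
    ext w
    simp only [Finset.mem_filter, Finset.mem_univ, true_and]
    exact forall₂_congr fun k hk => by rw [h.2 k hk]
  · rw [if_neg hr, Finset.mem_singleton] at h
    rw [h]

lemma clus_card_pos (u : Fin N) : 0 < (clus p g u).card :=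
  Finset.card_pos.2 ⟨u, mem_clus_self p g u⟩

/-- The user of the cluster of `u` that gets the `k`-th representative. -/
def rater (u : Fin N) (k : ℕ) : Fin N :=
  (clus p g u).orderEmbOfFin rfl ⟨k % (clus p g u).card, Nat.mod_lt _ (clus_card_pos p g u)⟩

lemma rater_mem (u : Fin N) (k : ℕ) : rater p g u k ∈ clus p g u :=
  Finset.orderEmbOfFin_mem _ _ _

lemma clusRank_eq {u v : Fin N} (h : v ∈ clus p g u) :
    ∃ hi : clusRank p g v < (clus p g u).card,
      (clus p g u).orderEmbOfFin rfl ⟨clusRank p g v, hi⟩ = v := by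
  have hv : v ∈ Set.range ((clus p g u).orderEmbOfFin rfl) := by
    rw [Finset.range_orderEmbOfFin]; exact h
  obtain ⟨i, rfl⟩ := hv
  have : clusRank p g ((clus p g u).orderEmbOfFin rfl i) = i := by
    rw [clusRank, clus_eq_of_mem p g h]
    have : (clus p g u).filter (fun w => w < (clus p g u).orderEmbOfFin rfl i) =
        (Finset.Iio i).image ((clus p g u).orderEmbOfFin rfl) := by
      ext w
      simp only [Finset.mem_filter, Finset.mem_image, Finset.mem_Iio]
      constructor
      · rintro ⟨hw, hlt⟩
        have hw : w ∈ Set.range ((clus p g u).orderEmbOfFin rfl) := by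
          rw [Finset.range_orderEmbOfFin]; exact hw
        obtain ⟨j, rfl⟩ := hw
        exact ⟨j, by simpa using hlt, rfl⟩
      · rintro ⟨j, hj, rfl⟩
        exact ⟨Finset.orderEmbOfFin_mem _ _ _, by simpa using hj⟩
    rw [this, Finset.card_image_of_injective _ ((clus p g u).orderEmbOfFin rfl).injective]
    simp
  refine ⟨by rw [this]; exact i.2, ?_⟩
  congr 1
  ext
  exact this

lemma ceilDiv_le_prefsTime (u : Fin N) : p.Irep ⌈/⌉ (clus p g u).card ≤ prefsTime p g :=
  Finset.le_sup (f := fun u => p.Irep ⌈/⌉ (clus p g u).card) (Finset.mem_univ u)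

lemma exploreDraw_eq_rep {u : Fin N} {t k : ℕ} (hk : k < p.Irep) :
    exploreDraw p σ g u t = p.Iusr + k ↔ p.Iusr ≤ t ∧ t < p.Iusr + prefsTime p g ∧
      (t - p.Iusr) * (clus p g u).card + clusRank p g u = k := by
  simp only [exploreDraw]
  have := Nat.zero_le (((t - (p.Iusr + prefsTime p g)) * N + (σ u : ℕ)) / p.rI)
  generalize ((t - (p.Iusr + prefsTime p g)) * N + (σ u : ℕ)) / p.rI = z at *
  split_ifs <;> omega

/-- Handing out in cyclic order gives each representative to exactly one user of each cluster, the
one whose rank is the residue of `k`; later phases of the exploration use larger draw numbers. No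
purity is needed. -/
lemma rated_rep_iff {u v : Fin N} (hv : v ∈ clus p g u) {k : ℕ} (hk : k < p.Irep) :
    Rated (hist (exploreTime p g)) v (p.Iusr + k) ↔ v = rater p g u k := by
  obtain ⟨hi, he⟩ := clusRank_eq p g hv
  rw [rated_iff]
  have hc := clus_eq_of_mem p g hv
  constructor
  · rintro ⟨t, ht, h⟩
    rw [drawAt_of_lt_explore _ _ _ _ ht, exploreDraw_eq_rep _ _ _ hk, hc] at h
    obtain ⟨-, -, h⟩ := h
    have : k % (clus p g u).card = clusRank p g v := by
      rw [← h, mul_comm, Nat.mul_add_mod, Nat.mod_eq_of_lt hi]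
    rw [← he, rater]
    congr 2
    exact this.symm
  · intro h
    have h1 : clusRank p g v = k % (clus p g u).card := by
      have := he.trans h
      rw [rater] at this
      simpa using this
    have hpos := clus_card_pos p g u
    have h2 : k / (clus p g u).card < prefsTime p g := by
      refine lt_of_lt_of_le ?_ (ceilDiv_le_prefsTime p g u)
      rw [Nat.div_lt_iff_lt_mul hpos, mul_comm]
      exact lt_of_lt_of_le hk (le_smul_ceilDiv hpos)
    have h3 := Nat.zero_le (k / (clus p g u).card)
    refine ⟨p.Iusr + k / (clus p g u).card, ?_, ?_⟩
    · simp only [exploreTime]; omega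
    · rw [drawAt_of_lt_explore _ _ _ _ (by simp only [exploreTime]; omega),
        exploreDraw_eq_rep _ _ _ hk, hc, h1]
      refine ⟨by omega, by omega, ?_⟩
      rw [Nat.add_sub_cancel_left]
      exact Nat.div_add_mod' _ _

lemma clusterLikes_rep_iff (u : Fin N) {k : ℕ} (hk : k < p.Irep) :
    ClusterLikes p id (hist (exploreTime p g)) u (p.Iusr + k) ↔
      g (rater p g u k) (p.Iusr + k) = true := by
  have hI : p.Iusr ≤ exploreTime p g := by simp only [exploreTime]; omega
  simp only [ClusterLikes, cluster_eq p σ g u hI, liked_iff]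
  constructor
  · rintro ⟨v, hv, ⟨h1, h2⟩, -⟩
    rw [rated_rep_iff p σ g hv hk] at h1
    rwa [← h1]
  · intro h
    refine ⟨_, rater_mem p g u k, ⟨(rated_rep_iff p σ g (rater_mem p g u k) hk).2 rfl, h⟩, ?_⟩
    intro v hv h'
    rw [(rated_rep_iff p σ g hv hk).1 h']

/-- The users that the `k`-th item to be clustered is assigned to. -/
def block [NeZero N] (r : ℕ) (k : ℕ) : Finset (Fin N) :=
  (Finset.range r).image fun a => σ.symm (Fin.ofNat N (k * r + a))

lemma block_card [NeZero N] {r : ℕ} (hr : r ≤ N) (k : ℕ) : (block σ r k).card = r := by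
  rw [block, Finset.card_image_of_injOn, Finset.card_range]
  intro a ha b hb h
  have h := congrArg Fin.val (σ.symm.injective h)
  simp only [Fin.ofNat] at h
  simp only [Finset.coe_range, Set.mem_Iio] at ha hb
  have := Nat.ModEq.add_left_cancel' _ h
  rwa [Nat.ModEq, Nat.mod_eq_of_lt (by omega), Nat.mod_eq_of_lt (by omega)] at this

lemma rated_of_mem_block [NeZero N] {v : Fin N} {k : ℕ} (hk : k < p.Iexp)
    (hv : v ∈ block σ p.rI k) :
    Rated (hist (exploreTime p g)) v (p.Iusr + p.Irep + k) := by
  obtain ⟨a, ha, rfl⟩ := Finset.mem_image.1 hv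
  rw [Finset.mem_range] at ha
  have hN : 0 < N := Nat.pos_of_ne_zero (NeZero.ne N)
  -- `P` is a position in the repeated list of users: it is served in step `P / N` of item
  -- clustering, by the user at place `P % N`.
  set P := k * p.rI + a with hP
  have h1 : P < p.Iexp * p.rI := by nlinarith
  have h2 : P / N < itemClusteringTime N p := by
    rw [Nat.div_lt_iff_lt_mul hN, mul_comm]
    exact lt_of_lt_of_le h1 (le_smul_ceilDiv hN)
  have ht : p.Iusr + prefsTime p g + P / N < exploreTime p g := by
    simp only [exploreTime]; omega
  rw [rated_iff]
  refine ⟨_, ht, ?_⟩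
  rw [drawAt_of_lt_explore _ _ _ _ ht, exploreDraw, if_neg (by rw [not_lt, add_assoc]; exact Nat.le_add_right _ _),
    if_neg (by rw [not_lt]; exact Nat.le_add_right _ _), Equiv.apply_symm_apply]
  have h3 : ((p.Iusr + prefsTime p g + P / N - (p.Iusr + prefsTime p g)) * N +
      ((Fin.ofNat N P : Fin N) : ℕ)) / p.rI = k := by
    rw [Nat.add_sub_cancel_left]
    have : P / N * N + ((Fin.ofNat N P : Fin N) : ℕ) = P := by
      simp only [Fin.ofNat]
      exact Nat.div_add_mod' _ _
    rw [this, hP, mul_comm k, Nat.mul_add_div (by omega), Nat.div_eq_of_lt ha, add_zero]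
  rw [h3, if_pos hk]

lemma mem_pool_iff (u : Fin N) (i : ℕ) : i ∈ pool p σ g u ↔
    ∃ j ∈ repDraws p, ClusterLikes p id (hist (exploreTime p g)) u j ∧
      (i = j ∨ i ∈ expDraws p ∧ ∀ v, Rated (hist (exploreTime p g)) v i →
        (ClusterLikes p id (hist (exploreTime p g)) v i ↔
          ClusterLikes p id (hist (exploreTime p g)) v j)) := by
  simp only [pool, exploitable, itemCluster, Finset.mem_biUnion, Finset.mem_filter,
    Finset.mem_insert, id, and_assoc]

/-- All users of a cluster have the same taste. -/
def PureClusters : Prop := ∀ u, ∀ v ∈ clus p g u, ∀ k, g v k = g u k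

/-- Items that may be exploited for `u` although `u` dislikes them. -/
noncomputable def confused [NeZero N] (u : Fin N) : Finset ℕ := by
  classical exact (expDraws p).filter fun i => ∃ j ∈ repDraws p, g u i ≠ g u j ∧
    ∀ v ∈ block σ p.rI (i - (p.Iusr + p.Irep)), g v i = g v j

section Pure

variable {p g}

lemma clusterLikes_iff_of_pure (hp : PureClusters p g) (u : Fin N) (k : ℕ) :
    ClusterLikes p id (hist (exploreTime p g)) u k ↔
      (∃ v ∈ clus p g u, Rated (hist (exploreTime p g)) v k) ∧ g u k = true := by
  classical
  have hI : p.Iusr ≤ exploreTime p g := by simp only [exploreTime]; omega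
  simp only [ClusterLikes, cluster_eq p σ g u hI, liked_iff]
  constructor
  · rintro ⟨v, hv, ⟨h1, h2⟩, -⟩
    exact ⟨⟨v, hv, h1⟩, by rw [← hp u v hv, h2]⟩
  · rintro ⟨⟨v, hv, h⟩, h2⟩
    have hne : ((clus p g u).filter fun v => Rated (hist (exploreTime p g)) v k).Nonempty :=
      ⟨v, Finset.mem_filter.2 ⟨hv, h⟩⟩
    have hm := Finset.min'_mem _ hne
    rw [Finset.mem_filter] at hm
    exact ⟨_, hm.1, ⟨hm.2, by rw [hp u _ hm.1, h2]⟩, fun v' hv' hr =>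
      Finset.min'_le _ _ (Finset.mem_filter.2 ⟨hv', hr⟩)⟩

lemma clusterLikes_rep_iff_of_pure (hp : PureClusters p g) (u : Fin N) {j : ℕ} (hj : j ∈ repDraws p) :
    ClusterLikes p id (hist (exploreTime p g)) u j ↔ g u j = true := by
  rw [repDraws, Finset.mem_Ico] at hj
  obtain ⟨k, rfl⟩ := Nat.exists_eq_add_of_le hj.1
  rw [clusterLikes_rep_iff p σ g u (by omega), hp u _ (rater_mem p g u k)]

lemma rep_mem_pool (hp : PureClusters p g) {u : Fin N} {j : ℕ} (hj : j ∈ repDraws p) (hu : g u j = true) :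
    j ∈ pool p σ g u := by
  rw [mem_pool_iff]
  exact ⟨j, hj, (clusterLikes_rep_iff_of_pure σ hp u hj).2 hu, .inl rfl⟩

lemma exp_mem_pool (hp : PureClusters p g) {u : Fin N} {i j : ℕ} (hi : i ∈ expDraws p) (hj : j ∈ repDraws p)
    (hu : g u j = true) (hij : ∀ v, g v i = g v j) : i ∈ pool p σ g u := by
  rw [mem_pool_iff]
  refine ⟨j, hj, (clusterLikes_rep_iff_of_pure σ hp u hj).2 hu, .inr ⟨hi, fun v hv => ?_⟩⟩
  rw [clusterLikes_rep_iff_of_pure σ hp v hj, clusterLikes_iff_of_pure σ hp v, hij v]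
  exact and_iff_right ⟨v, mem_clus_self p g v, hv⟩

/-- A disliked item can enter the pool only through a representative `j` that `u` likes, so `i` and
`j` differ for `u`. With pure clusters every user of the block of `i` nevertheless rates them alike,
because the recorded preferences are its own. -/
lemma mem_confused_of_mem_pool [NeZero N] (hp : PureClusters p g) {u : Fin N} {i : ℕ} (hi : i ∈ pool p σ g u)
    (hu : g u i = false) : i ∈ confused p σ g u := by
  classical
  rw [mem_pool_iff] at hi
  obtain ⟨j, hj, hl, h⟩ := hi
  rw [clusterLikes_rep_iff_of_pure σ hp u hj] at hl
  rcases h with rfl | ⟨hi, h⟩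
  · rw [hl] at hu; cases hu
  · rw [confused, Finset.mem_filter]
    refine ⟨hi, j, hj, by rw [hl, hu]; simp, fun v hv => ?_⟩
    have hi' := hi
    rw [expDraws, Finset.mem_Ico] at hi'
    obtain ⟨k, rfl⟩ := Nat.exists_eq_add_of_le hi'.1
    rw [Nat.add_sub_cancel_left] at hv
    have hr := rated_of_mem_block p σ g (by omega) hv
    have := h v hr
    rw [clusterLikes_rep_iff_of_pure σ hp v hj, clusterLikes_iff_of_pure σ hp v,
      and_iff_right ⟨v, mem_clus_self p g v, hr⟩] at this
    exact Bool.eq_iff_iff.2 this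

end Pure

/-- Pigeonhole: a user rates one item per step, so after `t` steps at most `t` items of `E` are used
up. -/
lemma exists_unrated {u : Fin N} {t : ℕ} {E : Finset ℕ} (hE : t < E.card) :
    ∃ k ∈ E, ¬ Rated (hist t) u k := by
  by_contra! h
  have : E ⊆ (Finset.range t).image fun s => drawAt p σ g u s := by
    intro k hk
    obtain ⟨s, hs, e⟩ := (rated_iff p σ g t u k).1 (h k hk)
    exact Finset.mem_image.2 ⟨s, Finset.mem_range.2 hs, e⟩
  have := (Finset.card_le_card this).trans Finset.card_image_le
  rw [Finset.card_range] at this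
  omega

/-- The time steps before `T` at which `u` is exploited unsuccessfully. -/
noncomputable def misses (u : Fin N) (T : ℕ) : Finset ℕ :=
  (Finset.Ico (exploreTime p g) T).filter fun t => g u (drawAt p σ g u t) = false

lemma misses_card_le (u : Fin N) (T : ℕ) : (misses p σ g u T).card ≤ T - exploreTime p g :=
  (Finset.card_filter_le _ _).trans (by simp)

/-- As the item missed at each of these steps was unrated before, no item is missed twice, and `t ↦
drawAt` is injective on the misses. -/
lemma misses_card_le_of_mapsTo (u : Fin N) (T : ℕ) (E : Finset ℕ)
    (h : ∀ t ∈ misses p σ g u T, drawAt p σ g u t ∈ E ∧ ¬ Rated (hist t) u (drawAt p σ g u t)) :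
    (misses p σ g u T).card ≤ E.card := by
  refine Finset.card_le_card_of_injOn (fun t => drawAt p σ g u t) (fun t ht => (h t ht).1) ?_
  have key : ∀ s t, s < t → t ∈ misses p σ g u T → drawAt p σ g u s ≠ drawAt p σ g u t :=
    fun s t hst ht e => (h t ht).2 ((rated_iff p σ g t u _).2 ⟨s, hst, e⟩)
  intro s hs t ht e
  rcases lt_trichotomy s t with hst | hst | hst
  · exact absurd e (key s t hst ht)
  · exact hst
  · exact absurd e.symm (key t s hst hs)

lemma misses_card_le_confused [NeZero N] (hp : PureClusters p g) {u : Fin N} {T : ℕ}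
    (hT : T ≤ (pool p σ g u).card) :
    (misses p σ g u T).card ≤ (confused p σ g u).card := by
  refine misses_card_le_of_mapsTo p σ g u T _ fun t ht => ?_
  rw [misses, Finset.mem_filter, Finset.mem_Ico] at ht
  obtain ⟨h1, h2, -⟩ := drawAt_exploit p σ g u ht.1.1
    (exists_unrated p σ g (lt_of_lt_of_le ht.1.2 hT))
  exact ⟨mem_confused_of_mem_pool σ hp h1 ht.2, h2⟩

/-- The representatives that other users of the cluster have rated. -/
def candidates (u : Fin N) : Finset ℕ :=
  (Finset.range p.Irep).filter fun k => rater p g u k ≠ u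

/-- Those among them that were liked. -/
def likedCandidates (u : Fin N) : Finset ℕ :=
  (candidates p g u).filter fun k => g (rater p g u k) (p.Iusr + k) = true

/-- As long as there are enough representatives that other users of the cluster like, the first
ones of them are exploited. -/
lemma misses_card_le_likedCandidates {u : Fin N} {T : ℕ}
    (hT : T - exploreTime p g ≤ (likedCandidates p g u).card) :
    (misses p σ g u T).card ≤ ((likedCandidates p g u).filter fun k =>
      ((likedCandidates p g u).filter (· < k)).card < T - exploreTime p g ∧
        g u (p.Iusr + k) = false).card := by
  set G := likedCandidates p g u with hG
  set t₂ := exploreTime p g with ht₂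
  rw [← Finset.card_image_of_injective (G.filter _) (add_right_injective p.Iusr)]
  refine misses_card_le_of_mapsTo p σ g u T _ fun t ht => ?_
  rw [misses, Finset.mem_filter, Finset.mem_Ico, ← ht₂] at ht
  obtain ⟨⟨ht1, ht2⟩, hu⟩ := ht
  have hGm : ∀ k ∈ G, k < p.Irep ∧ rater p g u k ≠ u ∧
      g (rater p g u k) (p.Iusr + k) = true := fun k hk => by
    simpa [hG, likedCandidates, candidates, and_assoc] using hk
  have hunr : ∀ k ∈ G, Rated (hist t) u (p.Iusr + k) →
      ∃ s ∈ Finset.Ico t₂ t, drawAt p σ g u s = p.Iusr + k := by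
    intro k hk hr
    obtain ⟨s, hs, e⟩ := (rated_iff p σ g t u _).1 hr
    refine ⟨s, Finset.mem_Ico.2 ⟨?_, hs⟩, e⟩
    by_contra! hlt
    have := (rated_rep_iff p σ g (mem_clus_self p g u) (hGm k hk).1).1
      ((rated_iff p σ g _ u _).2 ⟨s, hlt, e⟩)
    exact (hGm k hk).2.1 this.symm
  have hcount : ∀ E ⊆ G, (∀ k ∈ E, Rated (hist t) u (p.Iusr + k)) → E.card ≤ t - t₂ := by
    intro E hE h
    have : E.image (p.Iusr + ·) ⊆ (Finset.Ico t₂ t).image fun s => drawAt p σ g u s := by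
      intro i hi
      obtain ⟨k, hk, rfl⟩ := Finset.mem_image.1 hi
      obtain ⟨s, hs, e⟩ := hunr k (hE hk) (h k hk)
      exact Finset.mem_image.2 ⟨s, hs, e⟩
    have := (Finset.card_le_card this).trans Finset.card_image_le
    rwa [Finset.card_image_of_injective _ (add_right_injective p.Iusr), Nat.card_Ico] at this
  have hpool : ∀ k ∈ G, p.Iusr + k ∈ pool p σ g u := by
    intro k hk
    rw [mem_pool_iff]
    obtain ⟨h1, h2, h3⟩ := hGm k hk
    exact ⟨p.Iusr + k, by simp [repDraws, h1],
      (clusterLikes_rep_iff p σ g u h1).2 h3, .inl rfl⟩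
  obtain ⟨k₁, hk₁, hr₁⟩ : ∃ k ∈ G, ¬ Rated (hist t) u (p.Iusr + k) := by
    by_contra! h
    have := hcount G subset_rfl h
    omega
  obtain ⟨h1, h2, h3⟩ := drawAt_exploit p σ g u ht1 ⟨_, hpool k₁ hk₁, hr₁⟩
  refine ⟨?_, h2⟩
  -- Representatives precede the items to be clustered in the order of drawing. As the
  -- representative `k₁` is still available, the chosen item must be a representative too.
  have hle := h3 _ (hpool k₁ hk₁) hr₁
  obtain ⟨k₀, hk₀, hl, e⟩ : ∃ k₀ < p.Irep, ClusterLikes p id (hist t₂) u (p.Iusr + k₀) ∧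
      drawAt p σ g u t = p.Iusr + k₀ := by
    rw [mem_pool_iff] at h1
    obtain ⟨j, hj, hl, rfl | ⟨hd, -⟩⟩ := h1
    · have hj' := hj
      rw [repDraws, Finset.mem_Ico] at hj'
      obtain ⟨k₀, hk₀⟩ := Nat.exists_eq_add_of_le hj'.1
      exact ⟨k₀, by omega, by rw [← hk₀]; exact hl, hk₀⟩
    · rw [expDraws, Finset.mem_Ico] at hd
      have := (hGm k₁ hk₁).1
      omega
  rw [e] at h2 hu h3 ⊢
  -- A representative rated by `u` itself was already used up in exploration.
  have hcand : rater p g u k₀ ≠ u := by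
    intro h
    have := (rated_rep_iff p σ g (mem_clus_self p g u) hk₀).2 h.symm
    obtain ⟨s, hs, e'⟩ := (rated_iff p σ g _ u _).1 this
    exact h2 ((rated_iff p σ g t u _).2 ⟨s, lt_of_lt_of_le hs ht1, e'⟩)
  have hk₀G : k₀ ∈ G := by
    simp only [hG, likedCandidates, candidates, Finset.mem_filter, Finset.mem_range]
    exact ⟨⟨hk₀, hcand⟩, (clusterLikes_rep_iff p σ g u hk₀).1 hl⟩
  refine Finset.mem_image.2 ⟨k₀, Finset.mem_filter.2 ⟨hk₀G, ?_, hu⟩, rfl⟩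
  -- All liked candidates before `k₀` have been rated, each in its own exploitation step before `t`,
  -- so there are at most `t - t₂` of them.
  have := hcount (G.filter (· < k₀)) (Finset.filter_subset _ _) fun k hk => by
    rw [Finset.mem_filter] at hk
    by_contra hr
    have := h3 _ (hpool k hk.1) hr
    omega
  omega

end Exploitation


/-! ### The regret as a finite average -/

/-- The latent variables, restricted to the types of the first `K` draws. -/
abbrev Sample (N qU qI K : ℕ) : Type :=
  (Fin N → Fin qU) × (Fin K → Fin qI) × (Fin qU × Fin qI → Bool)

section Sample

variable {N qU qI K : ℕ}

/-- The rating that the user gives to the draw. -/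
def Sample.rate [NeZero K] (ω : Sample N qU qI K) (u : Fin N) (k : ℕ) : Bool :=
  ω.2.2 (ω.1 u, ω.2.1 (Fin.ofNat K k))

lemma avg_sample (f : Sample N qU qI K → ℝ) :
    𝔼 ω, f ω = 𝔼 τ, 𝔼 c, 𝔼 ξ, f (τ, c, ξ) := by
  rw [← avg_prod (fun τ (z : (Fin K → Fin qI) × (Fin qU × Fin qI → Bool)) => f (τ, z))
    |>.trans (Finset.expect_congr rfl fun τ _ =>
      avg_prod (fun c (ξ : Fin qU × Fin qI → Bool) => f (τ, c, ξ)))]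

lemma regret_eq_avg_sum [NeZero N] [NeZero qU] [NeZero qI] (p : Params) {draw : ℕ → ℕ}
    (hd : Function.Injective draw) (T : ℕ) [NeZero (drawBound N p T)] :
    regret qU qI (policy (N := N) p draw) T = 𝔼 σ : Equiv.Perm (Fin N),
      𝔼 ω : Sample N qU qI (drawBound N p T), ∑ t ∈ Finset.range T, (1 / (N : ℝ)) *
        ∑ u, if ω.rate u (drawAt p σ ω.rate u t) = false then (1 : ℝ) else 0 := by
  rw [regret]
  refine Finset.expect_congr rfl fun σ _ => ?_
  rw [avg_sample, ← integral_prefsLaw (fun k : Fin (drawBound N p T) => draw k)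
    (fun a b h => Fin.ext (hd h)) (fun τ c ξ => ∑ t ∈ Finset.range T, (1 / (N : ℝ)) *
        ∑ u, if Sample.rate (τ, c, ξ) u (drawAt p σ (Sample.rate (τ, c, ξ)) u t) = false
          then (1 : ℝ) else 0)]
  congr 1
  funext x
  refine Finset.sum_congr rfl fun t ht => ?_
  rw [Finset.mem_range] at ht
  congr 1
  refine Finset.sum_congr rfl fun u _ => ?_
  set ω : Sample N qU qI (drawBound N p T) :=
    (x.1, (fun k : Fin (drawBound N p T) => x.2.1 (draw k)), x.2.2) with hω
  have h : ∀ v, ∀ k < drawBound N p T, x.rating v (draw k) = ω.rate v k := by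
    intro v k hk
    simp only [Prefs.rating, hω, Sample.rate, Fin.ofNat, Nat.mod_eq_of_lt hk]
  rw [action_policy p hd]
  rw [drawAt_congr p σ (g := fun u k => x.rating u (draw k)) (g' := ω.rate) h u ht.le,
    h u _ (drawAt_lt p σ _ u ht)]

/-- Exchanging likes and dislikes. -/
def flipAll : Sample N qU qI K ≃ Sample N qU qI K :=
  Equiv.prodCongr (Equiv.refl _) (Equiv.prodCongr (Equiv.refl _)
    (Equiv.arrowCongr (Equiv.refl _) Equiv.boolNot))

lemma rate_flipAll [NeZero K] (ω : Sample N qU qI K) (u : Fin N) (k : ℕ) :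
    (flipAll ω).rate u k = !(ω.rate u k) := rfl

/-- Clusters are defined by agreement, which survives a change of all signs. -/
lemma clus_flipAll [NeZero K] (p : Params) (ω : Sample N qU qI K) (u : Fin N) :
    clus p (flipAll ω).rate u = clus p ω.rate u := by
  simp only [clus, rate_flipAll, Bool.not_inj_iff]

lemma prefsTime_flipAll [NeZero K] (p : Params) (ω : Sample N qU qI K) :
    prefsTime p (flipAll ω).rate = prefsTime p ω.rate := by
  simp only [prefsTime, clus_flipAll]

lemma exploreTime_flipAll [NeZero K] (p : Params) (ω : Sample N qU qI K) :
    exploreTime p (flipAll ω).rate = exploreTime p ω.rate := by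
  simp only [exploreTime, prefsTime_flipAll]

lemma exploreDraw_flipAll [NeZero K] (p : Params) (σ : Equiv.Perm (Fin N))
    (ω : Sample N qU qI K) (u : Fin N) (t : ℕ) :
    exploreDraw p σ (flipAll ω).rate u t = exploreDraw p σ ω.rate u t := by
  have : clusRank p (flipAll ω).rate u = clusRank p ω.rate u := by
    rw [clusRank, clus_flipAll, clusRank]
  simp only [exploreDraw, prefsTime_flipAll, clus_flipAll, this]

/-- The exploration recommends disliked items half of the time. -/
lemma avg_explore [NeZero K] (p : Params) (σ : Equiv.Perm (Fin N)) (u : Fin N) (T : ℕ) :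
    𝔼 ω : Sample N qU qI K, (((Finset.range (min (exploreTime p ω.rate) T)).filter fun t =>
      ω.rate u (drawAt p σ ω.rate u t) = false).card : ℝ) =
    𝔼 ω : Sample N qU qI K, ((min (exploreTime p ω.rate) T : ℕ) : ℝ) / 2 := by
  have e : ∀ ω : Sample N qU qI K, ((Finset.range (min (exploreTime p ω.rate) T)).filter fun t =>
      ω.rate u (drawAt p σ ω.rate u t) = false) =
      (Finset.range (min (exploreTime p ω.rate) T)).filter fun t =>
        ω.rate u (exploreDraw p σ ω.rate u t) = false := fun ω => by
    refine Finset.filter_congr fun t ht => ?_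
    rw [Finset.mem_range, lt_min_iff] at ht
    rw [drawAt_of_lt_explore _ _ _ _ ht.1]
  simp_rw [e]
  have h1 := Fintype.expect_equiv (flipAll (N := N) (qU := qU) (qI := qI) (K := K))
    (fun ω => (((Finset.range (min (exploreTime p ω.rate) T)).filter fun t =>
        ω.rate u (exploreDraw p σ ω.rate u t) = true).card : ℝ))
    (fun ω => (((Finset.range (min (exploreTime p ω.rate) T)).filter fun t =>
        ω.rate u (exploreDraw p σ ω.rate u t) = false).card : ℝ)) fun ω => by
      simp only [exploreTime_flipAll, exploreDraw_flipAll, rate_flipAll, Bool.not_eq_false']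
  have h2 : ∀ ω : Sample N qU qI K, ((min (exploreTime p ω.rate) T : ℕ) : ℝ) =
      (((Finset.range (min (exploreTime p ω.rate) T)).filter fun t =>
        ω.rate u (exploreDraw p σ ω.rate u t) = true).card : ℝ) +
      (((Finset.range (min (exploreTime p ω.rate) T)).filter fun t =>
        ω.rate u (exploreDraw p σ ω.rate u t) = false).card : ℝ) := fun ω => by
    rw [← Nat.cast_add]
    have := Finset.card_filter_add_card_filter_not
      (s := Finset.range (min (exploreTime p ω.rate) T))
      (fun t => ω.rate u (exploreDraw p σ ω.rate u t) = true)
    simp only [Bool.not_eq_true, Finset.card_range] at this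
    rw [this]
  simp_rw [h2, add_div, Finset.expect_add_distrib, ← Finset.expect_div, h1]
  ring

/-- The exploration part is an exact one half per step, by `avg_explore`, and not merely bounded;
this is what makes the bound `T / 2` accessible. -/
lemma regret_eq_avg [NeZero N] [NeZero qU] [NeZero qI] (p : Params) {draw : ℕ → ℕ}
    (hd : Function.Injective draw) (T : ℕ) [NeZero (drawBound N p T)] :
    regret qU qI (policy (N := N) p draw) T = 𝔼 σ : Equiv.Perm (Fin N),
      𝔼 ω : Sample N qU qI (drawBound N p T), (((min (exploreTime p ω.rate) T : ℕ) : ℝ) / 2 +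
        (1 / (N : ℝ)) * ∑ u, ((misses p σ ω.rate u T).card : ℝ)) := by
  rw [regret_eq_avg_sum p hd]
  refine Finset.expect_congr rfl fun σ _ => ?_
  have e : ∀ ω : Sample N qU qI (drawBound N p T), ∑ t ∈ Finset.range T, (1 / (N : ℝ)) *
      ∑ u, (if ω.rate u (drawAt p σ ω.rate u t) = false then (1 : ℝ) else 0) =
      (1 / (N : ℝ)) * ∑ u, ((((Finset.range (min (exploreTime p ω.rate) T)).filter fun t =>
        ω.rate u (drawAt p σ ω.rate u t) = false).card : ℝ) +
        ((misses p σ ω.rate u T).card : ℝ)) := fun ω => by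
    rw [← Finset.mul_sum, Finset.sum_comm]
    congr 1
    refine Finset.sum_congr rfl fun u _ => ?_
    rw [Finset.sum_boole, ← Nat.cast_add, ← Finset.card_union_of_disjoint]
    · congr 2
      ext t
      simp only [misses, Finset.mem_filter, Finset.mem_range, Finset.mem_union, Finset.mem_Ico,
        lt_min_iff, ← or_and_right]
      refine and_congr_left fun _ => ?_
      omega
    · rw [Finset.disjoint_left]
      intro t h1 h2
      simp only [misses, Finset.mem_filter, Finset.mem_range, Finset.mem_Ico, lt_min_iff] at h1 h2
      omega
  simp_rw [e, Finset.sum_add_distrib, mul_add, Finset.expect_add_distrib]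
  congr 1
  simp_rw [← Finset.mul_expect, Finset.expect_sum_comm, avg_explore]
  rw [Finset.sum_const, Finset.card_univ, Fintype.card_fin, nsmul_eq_mul, ← mul_assoc,
    one_div, inv_mul_cancel₀ (by exact_mod_cast NeZero.ne N), one_mul]

end Sample


/-! ### Probabilities of the bad events -/

section Entries

variable {qU qI : ℕ}

/-- Flipping the coordinate `i` exchanges agreement and disagreement. -/
lemma avg_coord_eq {ι : Type*} [Fintype ι] [DecidableEq ι] {i j : ι} (h : i ≠ j) :
    𝔼 x : ι → Bool, (if x i = x j then (1 : ℝ) else 0) = 1 / 2 := by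
  have h1 := avg_pi_congr (fun x : ι → Bool => if x i = x j then (1 : ℝ) else 0)
    (Equiv.piCongrRight fun k => if k = i then Equiv.boolNot else Equiv.refl Bool)
  have h2 : ∀ x : ι → Bool, (if x i = x j then (1 : ℝ) else 0) +
      (if (Equiv.piCongrRight fun k => if k = i then Equiv.boolNot else Equiv.refl Bool) x i =
        (Equiv.piCongrRight fun k => if k = i then Equiv.boolNot else Equiv.refl Bool) x j
          then (1 : ℝ) else 0) = 1 := fun x => by
    have e1 : (Equiv.piCongrRight fun k => if k = i then Equiv.boolNot else Equiv.refl Bool) x i =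
        !(x i) := by simp
    have e2 : (Equiv.piCongrRight fun k => if k = i then Equiv.boolNot else Equiv.refl Bool) x j =
        x j := by simp [h.symm]
    rw [e1, e2]
    cases x i <;> cases x j <;> simp
  have h3 := Finset.expect_congr (s := (Finset.univ : Finset (ι → Bool))) rfl fun x _ => h2 x
  rw [Finset.expect_add_distrib, h1, Fintype.expect_const] at h3
  linarith

lemma avg_rows_agree {w w' : Fin qU} (h : w ≠ w') (R : Finset (Fin qI)) :
    𝔼 ξ : Fin qU × Fin qI → Bool, (if ∀ b ∈ R, ξ (w, b) = ξ (w', b) then (1 : ℝ) else 0) =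
      (1 / 2) ^ R.card := by
  have h1 := avg_columns (α := Fin qU) (β := Fin qI)
    (fun b x => if b ∈ R then (if x w = x w' then (1 : ℝ) else 0) else 1)
  have h2 : ∀ b : Fin qI, 𝔼 x : Fin qU → Bool,
      (if b ∈ R then (if x w = x w' then (1 : ℝ) else 0) else 1) =
      if b ∈ R then 1 / 2 else 1 := fun b => by
    split_ifs
    · exact avg_coord_eq h
    · simp
  simp_rw [h2, Finset.prod_ite_mem, Finset.univ_inter, Finset.prod_const] at h1
  rw [← h1]
  refine Finset.expect_congr rfl fun ξ _ => ?_
  rw [Finset.prod_boole]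
  split_ifs <;> rfl

lemma avg_columns_agree {b b' : Fin qI} (h : b ≠ b') (R : Finset (Fin qU)) :
    𝔼 ξ : Fin qU × Fin qI → Bool, (if ∀ a ∈ R, ξ (a, b) = ξ (a, b') then (1 : ℝ) else 0) =
      (1 / 2) ^ R.card := by
  have h1 := avg_rows (α := Fin qU) (β := Fin qI)
    (fun a x => if a ∈ R then (if x b = x b' then (1 : ℝ) else 0) else 1)
  have h2 : ∀ a : Fin qU, 𝔼 x : Fin qI → Bool,
      (if a ∈ R then (if x b = x b' then (1 : ℝ) else 0) else 1) =
      if a ∈ R then 1 / 2 else 1 := fun b => by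
    split_ifs
    · exact avg_coord_eq h
    · simp
  simp_rw [h2, Finset.prod_ite_mem, Finset.univ_inter, Finset.prod_const] at h1
  rw [← h1]
  refine Finset.expect_congr rfl fun ξ _ => ?_
  rw [Finset.prod_boole]
  split_ifs <;> rfl

/-- Only one entry per column is read, at the row `f b`, so the factors are independent, with mean
`(1 + 1 / 2) / 2 = 3 / 4`. Choosing `f` freely allows a different rater for each item type. -/
lemma avg_pow_liked (f : Fin qI → Fin qU) (R : Finset (Fin qI)) :
    𝔼 ξ : Fin qU × Fin qI → Bool, (1 / 2 : ℝ) ^ (R.filter fun b => ξ (f b, b) = true).card =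
      (3 / 4) ^ R.card := by
  have h1 := avg_columns (α := Fin qU) (β := Fin qI)
    (fun b x => if b ∈ R then (if x (f b) = true then (1 / 2 : ℝ) else 1) else 1)
  have h2 : ∀ b : Fin qI, 𝔼 x : Fin qU → Bool,
      (if b ∈ R then (if x (f b) = true then (1 / 2 : ℝ) else 1) else 1) =
      if b ∈ R then 3 / 4 else 1 := fun b => by
    split_ifs
    · rw [avg_coord (f b) fun y : Bool => if y = true then (1 / 2 : ℝ) else 1,
        Fintype.expect_eq_sum_div_card]
      norm_num
    · simp
  simp_rw [h2, Finset.prod_ite_mem, Finset.univ_inter, Finset.prod_const] at h1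
  rw [← h1]
  refine Finset.expect_congr rfl fun ξ _ => ?_
  rw [Finset.prod_ite, Finset.prod_const, Finset.prod_const_one, mul_one]

/-- A lower tail bound for the number of hits of a set. -/
lemma avg_few_hits_le {ι α : Type*} [Fintype ι] [DecidableEq ι] [Fintype α] [Nonempty α]
    [DecidableEq α] (I : Finset ι) (A : Finset α) {T : ℕ}
    (hA : 2 * (T : ℝ) * Fintype.card α ≤ A.card * I.card) :
    𝔼 x : ι → α, (if (I.filter fun i => x i ∈ A).card < T then (1 : ℝ) else 0) ≤
      (2 / Real.exp 1) ^ T := by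
  have hq : (0 : ℝ) < Fintype.card α := by exact_mod_cast Fintype.card_pos
  -- Exponential Markov inequality: fewer than `T` hits make `2 ^ (T - hits)` at least `1`. The mean
  -- number of hits is at least `2 * T`, so the product has mean at most `exp (-T)`.
  have h1 : ∀ x : ι → α, (if (I.filter fun i => x i ∈ A).card < T then (1 : ℝ) else 0) ≤
      2 ^ T * ∏ i, (if i ∈ I then (if x i ∈ A then 1 / 2 else 1) else 1) := fun x => by
    rw [Finset.prod_ite_mem, Finset.univ_inter, Finset.prod_ite, Finset.prod_const,
      Finset.prod_const_one, mul_one]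
    split_ifs with h
    · obtain ⟨d, rfl⟩ := Nat.exists_eq_add_of_le h.le
      rw [pow_add, mul_assoc, mul_comm (2 ^ d : ℝ), ← mul_assoc, ← mul_pow]
      norm_num
      exact one_le_pow₀ (by norm_num)
    · positivity
  refine (avg_mono h1).trans ?_
  rw [← Finset.mul_expect]
  rw [avg_pi_prod (fun i a => if i ∈ I then (if a ∈ A then (1 / 2 : ℝ) else 1) else 1)]
  have h2 : ∀ i, 𝔼 a : α, (if i ∈ I then (if a ∈ A then (1 / 2 : ℝ) else 1) else 1) =
      if i ∈ I then 1 - (A.card : ℝ) / Fintype.card α / 2 else 1 := fun i => by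
    split_ifs
    · have e : ∀ a, (if a ∈ A then (1 / 2 : ℝ) else 1) =
          1 - (if a ∈ A then (1 : ℝ) else 0) / 2 := fun a => by split_ifs <;> norm_num
      simp_rw [e]
      rw [Finset.expect_sub_distrib, ← Finset.expect_div, avg_indicator, Fintype.expect_const]
    · simp
  simp_rw [h2, Finset.prod_ite_mem, Finset.univ_inter, Finset.prod_const]
  rw [div_pow, ← Real.exp_nat_mul, mul_one, div_eq_mul_inv (2 ^ T : ℝ), ← Real.exp_neg]
  refine mul_le_mul_of_nonneg_left ?_ (by positivity)
  set r : ℝ := (A.card : ℝ) / Fintype.card α / 2 with hr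
  have hr1 : r ≤ 1 := by
    have : (A.card : ℝ) / Fintype.card α ≤ 1 := by
      rw [div_le_one hq]; exact_mod_cast A.card_le_univ
    have : (0 : ℝ) ≤ (A.card : ℝ) / Fintype.card α := by positivity
    linarith
  calc (1 - r) ^ I.card ≤ Real.exp (-r) ^ I.card := by
        refine pow_le_pow_left₀ (by linarith) ?_ _
        have := Real.add_one_le_exp (-r)
        linarith
    _ = Real.exp (-(I.card * r)) := by rw [← Real.exp_nat_mul]; congr 1; ring
    _ ≤ _ := by
      refine Real.exp_le_exp.2 ?_
      have : (T : ℝ) ≤ I.card * r := by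
        rw [hr, div_div, mul_div_assoc', le_div_iff₀ (by positivity)]
        linarith
      linarith

end Entries

/-- The base of the bounds for coincidences of rows and of columns. -/
noncomputable def coinBase : ℝ := 1 / 2 + (1 - 1 / 2) * Real.exp (-1)

lemma coinBase_pos : 0 < coinBase := by unfold coinBase; positivity

lemma coinBase_le : coinBase ≤ 0.68395 := by
  have := Real.exp_one_gt_d9
  have h : Real.exp (-1) ≤ 1 / 2.7182818 := by
    rw [Real.exp_neg, ← one_div]
    exact one_div_le_one_div_of_le (by norm_num) (by linarith)
  unfold coinBase
  norm_num at h ⊢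
  linarith

/-- The case `z = 1 / 2`, `b = 1`, `s = |I| / q` of the exponential bound; the size restriction is
what makes `s ≤ 1`. -/
lemma avg_half_pow_card_image_le {ι α : Type*} [Fintype ι] [DecidableEq ι] [Fintype α] [Nonempty α]
    [DecidableEq α] (I : Finset ι) (h : I.card ≤ Fintype.card α) :
    𝔼 x : ι → α, (1 / 2 : ℝ) ^ (I.image x).card ≤ coinBase ^ I.card := by
  have hq : (0 : ℝ) < Fintype.card α := by exact_mod_cast Fintype.card_pos
  have h1 := avg_pow_card_image_le_exp (ι := ι) (α := α) I Finset.univ (z := 1 / 2) (b := 1)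
    (s := I.card / Fintype.card α) (by norm_num) (by norm_num) (by positivity)
    (by rw [div_le_one hq]; exact_mod_cast h)
    (by rw [one_mul, div_mul_cancel₀ _ hq.ne'])
  rw [Finset.card_univ, div_mul_cancel₀ _ hq.ne', Real.rpow_natCast] at h1
  simpa only [Finset.inter_univ, coinBase] using h1

/-! ### Impure clusters, confused items and rare user types -/

section Events

variable {N qU qI K : ℕ}

/-- The indices of a set of draws. -/
def idx (K : ℕ) [NeZero K] (s : Finset ℕ) : Finset (Fin K) := s.image (Fin.ofNat K)

lemma ofNat_injOn [NeZero K] {a b : ℕ} (ha : a < K) (hb : b < K)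
    (h : Fin.ofNat K a = Fin.ofNat K b) : a = b := by
  have h := congrArg Fin.val h
  simpa [Fin.ofNat, Nat.mod_eq_of_lt ha, Nat.mod_eq_of_lt hb] using h

lemma idx_card [NeZero K] {s : Finset ℕ} (h : ∀ k ∈ s, k < K) : (idx K s).card = s.card :=
  Finset.card_image_of_injOn fun _ ha _ hb e => ofNat_injOn (h _ ha) (h _ hb) e

lemma pureClusters_of_types [NeZero K] {p : Params} {ω : Sample N qU qI K}
    (h : ∀ u, ∀ v ∈ clus p ω.rate u, ω.1 v = ω.1 u) : PureClusters p ω.rate :=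
  fun u v hv k => by simp only [Sample.rate, h u v hv]

open Classical in
-- A union bound over pairs of user types, not of users, which is why the factor is `qU ^ 2`. Given
-- the item types, two distinct rows agree with probability `1 / 2` per distinct clustering type. If
-- there are fewer than `rU` clustering items, then clusters are singletons and nothing can go
-- wrong.
lemma avg_not_pure_le [NeZero K] [NeZero qI] (p : Params) (hK : p.Iusr ≤ K) (hI : p.Iusr ≤ qI) :
    𝔼 ω : Sample N qU qI K, (if PureClusters p ω.rate then (0 : ℝ) else 1) ≤
      (qU : ℝ) ^ 2 * coinBase ^ p.Iusr := by
  have hcard : (idx K (Finset.range p.Iusr)).card = p.Iusr := by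
    rw [idx_card fun k hk => (Finset.mem_range.1 hk).trans_le hK, Finset.card_range]
  have h1 : ∀ ω : Sample N qU qI K, (if PureClusters p ω.rate then (0 : ℝ) else 1) ≤
      ∑ w, ∑ w', if w = w' then 0 else
        if ∀ b ∈ (idx K (Finset.range p.Iusr)).image ω.2.1, ω.2.2 (w, b) = ω.2.2 (w', b)
          then (1 : ℝ) else 0 := fun ω => by
    have hnn : ∀ w w', (0 : ℝ) ≤ if w = w' then 0 else
        if ∀ b ∈ (idx K (Finset.range p.Iusr)).image ω.2.1, ω.2.2 (w, b) = ω.2.2 (w', b)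
          then (1 : ℝ) else 0 := fun w w' => by split_ifs <;> norm_num
    split_ifs with hp
    · exact Finset.sum_nonneg fun w _ => Finset.sum_nonneg fun w' _ => hnn w w'
    · have : ¬ ∀ u, ∀ v ∈ clus p ω.rate u, ω.1 v = ω.1 u := fun h => hp (pureClusters_of_types h)
      push Not at this
      obtain ⟨u, v, hv, hne⟩ := this
      refine le_trans ?_ (Finset.single_le_sum (fun w _ => Finset.sum_nonneg fun w' _ => hnn w w')
        (Finset.mem_univ (ω.1 v)))
      refine le_trans ?_ (Finset.single_le_sum (fun w' _ => hnn _ w') (Finset.mem_univ (ω.1 u)))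
      rw [if_neg hne, if_pos]
      intro b hb
      obtain ⟨i, hi, rfl⟩ := Finset.mem_image.1 hb
      obtain ⟨k, hk, rfl⟩ := Finset.mem_image.1 hi
      have hu : v ≠ u := fun h => hne (by rw [h])
      simp only [clus] at hv
      split_ifs at hv with hr
      · exact (Finset.mem_filter.1 hv).2 k (Finset.mem_range.1 hk)
      · exact absurd (Finset.mem_singleton.1 hv) hu
  refine (avg_mono h1).trans ?_
  rw [Finset.expect_sum_comm]
  simp_rw [Finset.expect_sum_comm]
  have h2 : ∀ w w' : Fin qU, 𝔼 ω : Sample N qU qI K, (if w = w' then 0 else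
        if ∀ b ∈ (idx K (Finset.range p.Iusr)).image ω.2.1, ω.2.2 (w, b) = ω.2.2 (w', b)
          then (1 : ℝ) else 0) ≤ coinBase ^ p.Iusr := fun w w' => by
    split_ifs with h
    · simp [coinBase_pos.le]
    · rw [avg_sample]
      have : Nonempty (Fin N → Fin qU) := ⟨fun _ => w⟩
      refine avg_le_const fun τ => ?_
      simp only [avg_rows_agree h]
      have := avg_half_pow_card_image_le (α := Fin qI) (idx K (Finset.range p.Iusr))
        (by rw [hcard]; simpa using hI)
      rwa [hcard] at this
  refine (Finset.sum_le_sum fun w _ => Finset.sum_le_sum fun w' _ => h2 w w').trans (le_of_eq ?_)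
  simp
  ring

/-- A union bound over pairs of an item and a representative of another type: their columns must
agree on all types of the users in the block. For any fixed permutation a block consists of `rI`
distinct users, whose types are independent. -/
lemma avg_confused_le [NeZero N] [NeZero K] [NeZero qU] [NeZero qI] (p : Params)
    (σ : Equiv.Perm (Fin N)) (u : Fin N) (hN : p.rI ≤ N) (hU : p.rI ≤ qU) :
    𝔼 ω : Sample N qU qI K, ((confused p σ ω.rate u).card : ℝ) ≤
      p.Iexp * p.Irep * coinBase ^ p.rI := by
  classical
  have h1 : ∀ ω : Sample N qU qI K, ((confused p σ ω.rate u).card : ℝ) ≤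
      ∑ i ∈ expDraws p, ∑ j ∈ repDraws p,
        if ω.2.1 (Fin.ofNat K i) = ω.2.1 (Fin.ofNat K j) then 0 else
        if ∀ a ∈ (block σ p.rI (i - (p.Iusr + p.Irep))).image ω.1,
          ω.2.2 (a, ω.2.1 (Fin.ofNat K i)) = ω.2.2 (a, ω.2.1 (Fin.ofNat K j))
          then (1 : ℝ) else 0 := fun ω => by
    rw [confused, Finset.card_filter, Nat.cast_sum]
    refine Finset.sum_le_sum fun i _ => ?_
    have hnn : ∀ j, (0 : ℝ) ≤ if ω.2.1 (Fin.ofNat K i) = ω.2.1 (Fin.ofNat K j) then 0 else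
        if ∀ a ∈ (block σ p.rI (i - (p.Iusr + p.Irep))).image ω.1,
          ω.2.2 (a, ω.2.1 (Fin.ofNat K i)) = ω.2.2 (a, ω.2.1 (Fin.ofNat K j))
          then (1 : ℝ) else 0 := fun j => by split_ifs <;> norm_num
    split_ifs with h
    · obtain ⟨j, hj, hne, h⟩ := h
      refine le_trans ?_ (Finset.single_le_sum (fun j _ => hnn j) hj)
      rw [if_neg, if_pos]
      · simp
      · intro a ha
        obtain ⟨v, hv, rfl⟩ := Finset.mem_image.1 ha
        exact h v hv
      · intro e
        exact hne (by simp only [Sample.rate, e])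
    · rw [Nat.cast_zero]
      exact Finset.sum_nonneg fun j _ => hnn j
  refine (avg_mono h1).trans ?_
  rw [Finset.expect_sum_comm]
  simp_rw [Finset.expect_sum_comm]
  have h2 : ∀ i j : ℕ, 𝔼 ω : Sample N qU qI K,
      (if ω.2.1 (Fin.ofNat K i) = ω.2.1 (Fin.ofNat K j) then 0 else
        if ∀ a ∈ (block σ p.rI (i - (p.Iusr + p.Irep))).image ω.1,
          ω.2.2 (a, ω.2.1 (Fin.ofNat K i)) = ω.2.2 (a, ω.2.1 (Fin.ofNat K j))
          then (1 : ℝ) else 0) ≤ coinBase ^ p.rI := fun i j => by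
    rw [avg_sample, Finset.expect_comm]
    refine avg_le_const fun c => ?_
    simp only
    by_cases h : c (Fin.ofNat K i) = c (Fin.ofNat K j)
    · simp only [if_pos h, Finset.expect_const_zero]
      exact pow_nonneg coinBase_pos.le _
    · simp only [if_neg h, avg_columns_agree h]
      have hb := block_card σ hN (i - (p.Iusr + p.Irep))
      have := avg_half_pow_card_image_le (α := Fin qU) (block σ p.rI (i - (p.Iusr + p.Irep)))
        (by rw [hb]; simpa using hU)
      rwa [hb] at this
  refine (Finset.sum_le_sum fun i _ => Finset.sum_le_sum fun j _ => h2 i j).trans (le_of_eq ?_)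
  simp [expDraws, repDraws]
  ring

/-- All user types are about as frequent as expected. -/
def LargeTypes (τ : Fin N → Fin qU) : Prop :=
  ∀ w, (N : ℝ) / (2 * qU) ≤ (Finset.univ.filter fun u => τ u = w).card

open Classical in
-- For each type, the exponential moment of its frequency at base `1 / 2` gives a Chernoff bound at
-- half of the mean; then sum over the types. The threshold need not be an integer, hence the real
-- exponent.
lemma avg_not_largeTypes_le [NeZero K] [NeZero qU] [NeZero qI] :
    𝔼 ω : Sample N qU qI K, (if LargeTypes ω.1 then (0 : ℝ) else 1) ≤
      qU * (2 / Real.exp 1) ^ ((N : ℝ) / (2 * qU)) := by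
  have hq : (0 : ℝ) < qU := by exact_mod_cast Nat.pos_of_ne_zero (NeZero.ne qU)
  set x : ℝ := (N : ℝ) / (2 * qU) with hx
  have hx0 : 0 ≤ x := by positivity
  rw [avg_sample]
  have h1 : ∀ τ : Fin N → Fin qU, (if LargeTypes τ then (0 : ℝ) else 1) ≤
      ∑ w, 2 ^ x * ∏ u, (if τ u = w then (1 / 2 : ℝ) else 1) := fun τ => by
    have hnn : ∀ w, (0 : ℝ) ≤ 2 ^ x * ∏ u, (if τ u = w then (1 / 2 : ℝ) else 1) := fun w =>
      mul_nonneg (by positivity) (Finset.prod_nonneg fun u _ => by split_ifs <;> norm_num)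
    split_ifs with h
    · exact Finset.sum_nonneg fun w _ => hnn w
    · simp only [LargeTypes, not_forall, not_le] at h
      obtain ⟨w, hw⟩ := h
      refine le_trans ?_ (Finset.single_le_sum (fun w _ => hnn w) (Finset.mem_univ w))
      rw [Finset.prod_ite, Finset.prod_const, Finset.prod_const_one, mul_one, ← Real.rpow_natCast,
        one_div, Real.inv_rpow (by norm_num), ← Real.rpow_neg (by norm_num),
        ← Real.rpow_add (by norm_num)]
      exact Real.one_le_rpow (by norm_num) (by linarith)
  refine (avg_mono fun τ => avg_le_const fun c => avg_le_const fun ξ => h1 τ).trans ?_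
  rw [Finset.expect_sum_comm]
  simp_rw [← Finset.mul_expect]
  have h2 : ∀ w : Fin qU, 𝔼 τ : Fin N → Fin qU, ∏ u, (if τ u = w then (1 / 2 : ℝ) else 1) =
      (1 - 1 / (2 * qU)) ^ N := fun w => by
    rw [avg_pi_prod (fun (_ : Fin N) (a : Fin qU) => if a = w then (1 / 2 : ℝ) else 1)]
    rw [Finset.prod_const, Finset.card_univ, Fintype.card_fin]
    congr 1
    have : ∀ a : Fin qU, (if a = w then (1 / 2 : ℝ) else 1) =
        1 - (if a ∈ ({w} : Finset (Fin qU)) then (1 : ℝ) else 0) / 2 := fun a => by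
      by_cases h : a = w <;> simp [h]
      norm_num
    simp_rw [this]
    rw [Finset.expect_sub_distrib, ← Finset.expect_div, avg_indicator]
    simp
    ring
  simp_rw [h2]
  rw [Finset.sum_const, Finset.card_univ, Fintype.card_fin, nsmul_eq_mul]
  refine mul_le_mul_of_nonneg_left ?_ hq.le
  rw [Real.div_rpow (by norm_num) (Real.exp_pos _).le, ← Real.exp_mul,
    div_eq_mul_inv (2 ^ x), ← Real.exp_neg]
  refine mul_le_mul_of_nonneg_left ?_ (by positivity)
  have hq1 : (1 : ℝ) ≤ qU := by exact_mod_cast Nat.pos_of_ne_zero (NeZero.ne qU)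
  calc (1 - 1 / (2 * (qU : ℝ))) ^ N ≤ Real.exp (-(1 / (2 * qU))) ^ N := by
        refine pow_le_pow_left₀ ?_ ?_ _
        · rw [sub_nonneg, div_le_one (by positivity)]; linarith
        · have := Real.add_one_le_exp (-(1 / (2 * (qU : ℝ))))
          linarith
    _ = Real.exp (-(1 * x)) := by
        rw [← Real.exp_nat_mul, hx]; congr 1; ring

end Events


/-! ### Lower bounds for the exploitation pools -/

section Pools

variable {N qU qI K : ℕ}

lemma val_mem_of_mem_idx [NeZero K] {s : Finset ℕ} (h : ∀ k ∈ s, k < K) {i : Fin K}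
    (hi : i ∈ idx K s) : (i : ℕ) ∈ s := by
  obtain ⟨k, hk, rfl⟩ := Finset.mem_image.1 hi
  simpa [Fin.ofNat, Nat.mod_eq_of_lt (h k hk)] using hk

lemma ofNat_val_eq [NeZero K] (i : Fin K) : Fin.ofNat K i = i :=
  Fin.ext (Nat.mod_eq_of_lt i.2)

/-- An item with the type of a liked representative agrees with it for every user, so with pure
clusters no rater can reject it. Its presence in the pool is thus decided by types alone. -/
lemma card_le_pool_of_exp [NeZero K] {p : Params} (σ : Equiv.Perm (Fin N)) {ω : Sample N qU qI K}
    (hp : PureClusters p ω.rate) (hK : p.Iusr + p.Irep + p.Iexp ≤ K) (u : Fin N) :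
    ((idx K (expDraws p)).filter fun i => ω.2.1 i ∈ ((idx K (repDraws p)).image ω.2.1).filter
      fun b => ω.2.2 (ω.1 u, b) = true).card ≤ (pool p σ ω.rate u).card := by
  rw [← Finset.card_image_of_injective (Finset.filter _ _) Fin.val_injective]
  refine Finset.card_le_card fun k hk => ?_
  obtain ⟨i, hi, rfl⟩ := Finset.mem_image.1 hk
  simp only [Finset.mem_filter, Finset.mem_image] at hi
  obtain ⟨hi, ⟨j, hj, hij⟩, hl⟩ := hi
  have hi' := val_mem_of_mem_idx (fun k hk => by
    simp only [expDraws, Finset.mem_Ico] at hk; omega) hi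
  have hj' := val_mem_of_mem_idx (fun k hk => by
    simp only [repDraws, Finset.mem_Ico] at hk; omega) hj
  refine exp_mem_pool σ hp hi' hj' ?_ fun v => ?_
  · simp only [Sample.rate, ofNat_val_eq, hij, hl]
  · simp only [Sample.rate, ofNat_val_eq, hij]

lemma card_le_pool_of_rep [NeZero K] {p : Params} (σ : Equiv.Perm (Fin N)) {ω : Sample N qU qI K}
    (hp : PureClusters p ω.rate) (hK : p.Iusr + p.Irep + p.Iexp ≤ K) (u : Fin N) :
    ((idx K (repDraws p)).filter fun i => ω.2.1 i ∈ Finset.univ.filter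
      fun b => ω.2.2 (ω.1 u, b) = true).card ≤ (pool p σ ω.rate u).card := by
  rw [← Finset.card_image_of_injective (Finset.filter _ _) Fin.val_injective]
  refine Finset.card_le_card fun k hk => ?_
  obtain ⟨i, hi, rfl⟩ := Finset.mem_image.1 hk
  simp only [Finset.mem_filter, Finset.mem_univ, true_and] at hi
  have hi' := val_mem_of_mem_idx (fun k hk => by
    simp only [repDraws, Finset.mem_Ico] at hk; omega) hi.1
  refine rep_mem_pool σ hp hi' ?_
  simp only [Sample.rate, ofNat_val_eq, hi.2]

/-- Markov's inequality in pointwise form, ready to be averaged. -/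
lemma indicator_card_lt_le (n : ℕ) (x : ℝ) :
    (if (n : ℝ) < x then (1 : ℝ) else 0) ≤ 2 ^ x * (1 / 2) ^ n := by
  split_ifs with h
  · rw [← Real.rpow_natCast, one_div, Real.inv_rpow (by norm_num), ← Real.rpow_neg (by norm_num),
        ← Real.rpow_add (by norm_num)]
    exact Real.one_le_rpow (by norm_num) (by linarith)
  · positivity

lemma exp_neg_three_le : Real.exp (-3) ≤ 0.0498 := by
  have h := Real.exp_one_gt_d9
  have e : Real.exp (-3) = (Real.exp 1 ^ 3)⁻¹ := by
    rw [← Real.exp_nat_mul, ← Real.exp_neg]; norm_num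
  rw [e]
  refine inv_le_of_inv_le₀ (by norm_num) ?_
  calc (0.0498 : ℝ)⁻¹ ≤ 2.7182818 ^ 3 := by norm_num
    _ ≤ _ := pow_le_pow_left₀ (by norm_num) (by linarith) 3

open Classical in
/-- The pools of items that similar users like are rarely too small. -/
lemma avg_short_pool_le [NeZero K] [NeZero qU] [NeZero qI] (p : Params) (σ : Equiv.Perm (Fin N))
    (u : Fin N) (T : ℕ) {l : ℝ} (hl : 0 < l) (hlq : l ≤ qI)
    (hK : p.Iusr + p.Irep + p.Iexp ≤ K) (hrep : 3 * l ≤ p.Irep)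
    (hexp : 16 * qI * T ≤ l * p.Iexp) :
    𝔼 ω : Sample N qU qI K,
      (if PureClusters p ω.rate ∧ (pool p σ ω.rate u).card < T then (1 : ℝ) else 0) ≤
      2 ^ (-(l / 4)) + (2 / Real.exp 1) ^ T := by
  have hq : (0 : ℝ) < qI := hl.trans_le hlq
  let A : Fin qU → (Fin K → Fin qI) → (Fin qU × Fin qI → Bool) → Finset (Fin qI) :=
    fun a c ξ => ((idx K (repDraws p)).image c).filter fun b => ξ (a, b) = true
  have hcr : (idx K (repDraws p)).card = p.Irep := by
    rw [idx_card fun k hk => by simp only [repDraws, Finset.mem_Ico] at hk; omega]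
    simp [repDraws]
  have hce : (idx K (expDraws p)).card = p.Iexp := by
    rw [idx_card fun k hk => by simp only [expDraws, Finset.mem_Ico] at hk; omega]
    simp [expDraws]
  have h1 : ∀ ω : Sample N qU qI K,
      (if PureClusters p ω.rate ∧ (pool p σ ω.rate u).card < T then (1 : ℝ) else 0) ≤
      if ((idx K (expDraws p)).filter fun i => ω.2.1 i ∈ A (ω.1 u) ω.2.1 ω.2.2).card < T
        then 1 else 0 := fun ω => by
    split_ifs with h h' h'
    · exact le_rfl
    · exact absurd ((card_le_pool_of_exp σ h.1 hK u).trans_lt h.2) h'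
    · exact zero_le_one
    · exact le_rfl
  refine (avg_mono h1).trans ?_
  rw [avg_sample]
  refine avg_le_const fun τ => ?_
  simp only
  set a := τ u
  have h2 : ∀ ξ, 𝔼 c : Fin K → Fin qI,
      (if ((idx K (expDraws p)).filter fun i => c i ∈ A a c ξ).card < T then (1 : ℝ) else 0) ≤
      𝔼 c : Fin K → Fin qI, ((if ((A a c ξ).card : ℝ) < l / 8 then (1 : ℝ) else 0) +
        (2 / Real.exp 1) ^ T) := fun ξ => by
    -- The types of the representatives are fixed and all others resampled: the set of liked types
    -- is then a constant, and the items to be clustered are independent trials.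
    rw [avg_piecewise (idx K (repDraws p))]
    refine avg_mono fun c => ?_
    have e : ∀ c' : Fin K → Fin qI,
        ((idx K (expDraws p)).filter fun i => (idx K (repDraws p)).piecewise c c' i ∈
          A a ((idx K (repDraws p)).piecewise c c') ξ) =
        (idx K (expDraws p)).filter fun i => c' i ∈ A a c ξ := fun c' => by
      have hA : A a ((idx K (repDraws p)).piecewise c c') ξ = A a c ξ := by
        simp only [A]
        congr 1
        exact Finset.image_congr fun i hi => by simp [Finset.mem_coe.1 hi]
      rw [hA]
      refine Finset.filter_congr fun i hi => ?_
      rw [Finset.piecewise_eq_of_notMem]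
      intro hi'
      have h1 := val_mem_of_mem_idx (fun k hk => by
        simp only [expDraws, Finset.mem_Ico] at hk; omega) hi
      have h2 := val_mem_of_mem_idx (fun k hk => by
        simp only [repDraws, Finset.mem_Ico] at hk; omega) hi'
      simp only [expDraws, repDraws, Finset.mem_Ico] at h1 h2
      omega
    simp_rw [e]
    by_cases h : ((A a c ξ).card : ℝ) < l / 8
    · rw [if_pos h]
      refine le_trans (avg_le_const (b := 1) fun c' => by split_ifs <;> norm_num) ?_
      have : (0 : ℝ) ≤ (2 / Real.exp 1) ^ T := by positivity
      linarith
    · rw [if_neg h, zero_add]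
      refine avg_few_hits_le _ _ ?_
      rw [hce, Fintype.card_fin]
      have : l / 8 * p.Iexp ≤ (A a c ξ).card * p.Iexp := by
        push Not at h
        gcongr
      linarith
  rw [Finset.expect_comm]
  refine (avg_mono h2).trans ?_
  simp_rw [Finset.expect_add_distrib, Fintype.expect_const]
  refine add_le_add_left ?_ _
  refine (avg_mono fun ξ => avg_mono fun c => indicator_card_lt_le _ _).trans ?_
  rw [Finset.expect_comm]
  simp_rw [← Finset.mul_expect]
  simp only [A, avg_pow_liked (fun _ : Fin qI => a)]
  -- The value `b = 3` matches `3 * l ≤ Irep`. The resulting base satisfies `z ^ 8 ≤ 1 / 8`, so `z ^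
  -- l ≤ 2 ^ (-3 * l / 8)`, which leaves `2 ^ (-l / 4)` after the loss `2 ^ (l / 8)`.
  have h3 := avg_pow_card_image_le_exp (α := Fin qI) (idx K (repDraws p)) Finset.univ (z := 3 / 4)
    (b := 3) (s := l / qI) (by norm_num) (by norm_num) (by positivity)
    (by rw [div_le_one hq]; exact hlq)
    (by rw [hcr, Fintype.card_fin, mul_assoc, div_mul_cancel₀ _ hq.ne']; exact hrep)
  simp only [Finset.inter_univ, Finset.card_univ, Fintype.card_fin] at h3
  rw [div_mul_cancel₀ _ hq.ne'] at h3
  refine (mul_le_mul_of_nonneg_left h3 (by positivity)).trans ?_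
  set z : ℝ := 3 / 4 + (1 - 3 / 4) * Real.exp (-3) with hz
  have hz0 : 0 ≤ z := by positivity
  have hz1 : z ≤ 0.76245 := by rw [hz]; linarith [exp_neg_three_le]
  have hz2 : 8 * z ^ 8 ≤ 1 := by
    have := pow_le_pow_left₀ hz0 hz1 8
    norm_num at this ⊢
    linarith
  have h4 : z ^ l ≤ 2 ^ (-(l / 8) + -(l / 4)) := by
    have : z ^ l = (z ^ 8) ^ (l / 8) := by
      rw [← Real.rpow_natCast, ← Real.rpow_mul hz0]; congr 1; norm_num; ring
    rw [this]
    have h5 : z ^ 8 ≤ 2 ^ (-3 : ℝ) := by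
      rw [Real.rpow_neg (by norm_num)]; norm_num; linarith
    refine (Real.rpow_le_rpow (by positivity) h5 (by positivity)).trans (le_of_eq ?_)
    rw [← Real.rpow_mul (by norm_num)]
    congr 1; ring
  refine (mul_le_mul_of_nonneg_left h4 (by positivity)).trans (le_of_eq ?_)
  rw [← Real.rpow_add (by norm_num)]
  congr 1; ring

open Classical in
/-- The pools of representatives that similar users like are rarely too small. -/
lemma avg_short_pool_rep_le [NeZero K] [NeZero qU] [NeZero qI] (p : Params)
    (σ : Equiv.Perm (Fin N)) (u : Fin N) (T : ℕ) (hK : p.Iusr + p.Irep + p.Iexp ≤ K)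
    (hrep : p.Irep = 6 * T) :
    𝔼 ω : Sample N qU qI K,
      (if PureClusters p ω.rate ∧ (pool p σ ω.rate u).card < T then (1 : ℝ) else 0) ≤
      2 ^ (-((qI : ℝ) / 20)) + (2 / Real.exp 1) ^ T := by
  let A : Fin qU → (Fin qU × Fin qI → Bool) → Finset (Fin qI) :=
    fun a ξ => Finset.univ.filter fun b => ξ (a, b) = true
  have hcr : (idx K (repDraws p)).card = 6 * T := by
    rw [idx_card fun k hk => by simp only [repDraws, Finset.mem_Ico] at hk; omega]
    simp [repDraws, hrep]
  have h1 : ∀ ω : Sample N qU qI K,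
      (if PureClusters p ω.rate ∧ (pool p σ ω.rate u).card < T then (1 : ℝ) else 0) ≤
      if ((idx K (repDraws p)).filter fun i => ω.2.1 i ∈ A (ω.1 u) ω.2.2).card < T
        then 1 else 0 := fun ω => by
    split_ifs with h h' h'
    · exact le_rfl
    · exact absurd ((card_le_pool_of_rep σ h.1 hK u).trans_lt h.2) h'
    · exact zero_le_one
    · exact le_rfl
  refine (avg_mono h1).trans ?_
  rw [avg_sample]
  refine avg_le_const fun τ => ?_
  simp only
  set a := τ u
  have h2 : ∀ ξ, 𝔼 c : Fin K → Fin qI,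
      (if ((idx K (repDraws p)).filter fun i => c i ∈ A a ξ).card < T then (1 : ℝ) else 0) ≤
      (if ((A a ξ).card : ℝ) < (qI : ℝ) / 3 then (1 : ℝ) else 0) + (2 / Real.exp 1) ^ T :=
    fun ξ => by
    by_cases h : ((A a ξ).card : ℝ) < (qI : ℝ) / 3
    · rw [if_pos h]
      refine le_trans (avg_le_const (b := 1) fun c' => by split_ifs <;> norm_num) ?_
      have : (0 : ℝ) ≤ (2 / Real.exp 1) ^ T := by positivity
      linarith
    · rw [if_neg h, zero_add]
      refine avg_few_hits_le _ _ ?_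
      rw [hcr, Fintype.card_fin]
      push Not at h
      push_cast
      have : (qI : ℝ) / 3 * (6 * T) ≤ (A a ξ).card * (6 * T) := by gcongr
      linarith
  rw [Finset.expect_comm]
  refine (avg_mono h2).trans ?_
  simp_rw [Finset.expect_add_distrib, Fintype.expect_const]
  refine add_le_add_left ?_ _
  refine (avg_mono fun ξ => indicator_card_lt_le _ _).trans ?_
  rw [← Finset.mul_expect]
  simp only [A, avg_pow_liked (fun _ : Fin qI => a), Finset.card_univ, Fintype.card_fin]
  have h5 : (3 / 4 : ℝ) ^ qI ≤ 2 ^ (-((qI : ℝ) / 3) + -((qI : ℝ) / 20)) := by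
    -- The exponent `60` makes `60 * (1 / 3 + 1 / 20) = 23` an integer.
    have : (3 / 4 : ℝ) ^ qI = ((3 / 4 : ℝ) ^ 60) ^ ((qI : ℝ) / 60) := by
      rw [← Real.rpow_natCast, ← Real.rpow_natCast, ← Real.rpow_mul (by norm_num)]
      congr 1; norm_num; ring
    rw [this]
    have h5 : (3 / 4 : ℝ) ^ 60 ≤ 2 ^ (-23 : ℝ) := by
      rw [Real.rpow_neg (by norm_num)]; norm_num
    refine (Real.rpow_le_rpow (by positivity) h5 (by positivity)).trans (le_of_eq ?_)
    rw [← Real.rpow_mul (by norm_num)]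
    congr 1; ring
  refine (mul_le_mul_of_nonneg_left h5 (by positivity)).trans (le_of_eq ?_)
  rw [← Real.rpow_add (by norm_num)]
  congr 1; ring

end Pools


/-! ### Assembling the error events; duration of the phases -/

section Union

variable {N qU qI K : ℕ}

/-- Unsuccessful exploitation needs an impure cluster, a small pool, or a confused item. -/
lemma avg_misses_le [NeZero N] [NeZero K] [NeZero qU] [NeZero qI] (p : Params)
    (σ : Equiv.Perm (Fin N)) (u : Fin N) {T tmin : ℕ}
    (htmin : ∀ ω : Sample N qU qI K, tmin ≤ exploreTime p ω.rate) {e₁ e₂ W : ℝ}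
    (h₁ : 𝔼 ω : Sample N qU qI K, (open Classical in
      if PureClusters p ω.rate then (0 : ℝ) else 1) ≤ e₁)
    (h₂ : 𝔼 ω : Sample N qU qI K, (open Classical in
      if PureClusters p ω.rate ∧ (pool p σ ω.rate u).card < T then (1 : ℝ) else 0) ≤ e₂)
    (hW : 𝔼 ω : Sample N qU qI K, ((confused p σ ω.rate u).card : ℝ) ≤ W) :
    𝔼 ω : Sample N qU qI K, ((misses p σ ω.rate u T).card : ℝ) ≤
        ((T - tmin : ℕ) : ℝ) * (e₁ + e₂) + W ∧
      𝔼 ω : Sample N qU qI K, ((misses p σ ω.rate u T).card : ℝ) ≤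
        ((T - tmin : ℕ) : ℝ) * (e₁ + e₂ + W) := by
  classical
  set D : ℝ := ((T - tmin : ℕ) : ℝ) with hD
  have key : ∀ ω : Sample N qU qI K, ∀ x : ℝ, ((misses p σ ω.rate u T).card ≤ D →
      ((misses p σ ω.rate u T).card : ℝ) ≤ (confused p σ ω.rate u).card →
      ((misses p σ ω.rate u T).card : ℝ) ≤ x) → 0 ≤ x →
      ((misses p σ ω.rate u T).card : ℝ) ≤ D * ((if PureClusters p ω.rate then (0 : ℝ) else 1) +
        (if PureClusters p ω.rate ∧ (pool p σ ω.rate u).card < T then (1 : ℝ) else 0)) + x := by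
    intro ω x hx hx0
    have hle : ((misses p σ ω.rate u T).card : ℝ) ≤ D := by
      have h1 := misses_card_le p σ ω.rate u T
      have h2 := htmin ω
      rw [hD]
      exact_mod_cast h1.trans (by omega)
    by_cases hp : PureClusters p ω.rate
    · by_cases hs : (pool p σ ω.rate u).card < T
      · simp only [hp, hs, if_true, true_and]; linarith
      · have := misses_card_le_confused p σ ω.rate hp (not_lt.1 hs)
        simp only [hp, hs, if_true, and_false, if_false]
        have := hx hle (by exact_mod_cast this)
        linarith
    · simp only [hp, if_false, false_and]; linarith
  have hD0 : 0 ≤ D := Nat.cast_nonneg _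
  constructor
  · refine (avg_mono fun ω => key ω (confused p σ ω.rate u).card (fun _ h => h)
      (Nat.cast_nonneg _)).trans ?_
    rw [Finset.expect_add_distrib, ← Finset.mul_expect, Finset.expect_add_distrib]
    gcongr
  · refine (avg_mono fun ω => key ω (D * (confused p σ ω.rate u).card) (fun h h' => ?_)
      (by positivity)).trans ?_
    -- A single confused item is charged with all `D` remaining steps. This version is of use when
    -- little time is left, as every term then scales with `D`.
    · rcases Nat.eq_zero_or_pos (confused p σ ω.rate u).card with h0 | h0
      · rw [h0] at h' ⊢; simpa using h'
      · refine h.trans (le_mul_of_one_le_right hD0 (by exact_mod_cast h0))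
    rw [Finset.expect_add_distrib, ← Finset.mul_expect, Finset.expect_add_distrib,
      ← Finset.mul_expect, mul_add D (e₁ + e₂)]
    gcongr

lemma regret_le_of_misses [NeZero N] [NeZero qU] [NeZero qI] (p : Params) {draw : ℕ → ℕ}
    (hd : Function.Injective draw) (T : ℕ) [NeZero (drawBound N p T)] {x y : ℝ}
    (hx : 𝔼 ω : Sample N qU qI (drawBound N p T),
      ((min (exploreTime p ω.rate) T : ℕ) : ℝ) / 2 ≤ x)
    (hy : ∀ σ u, 𝔼 ω : Sample N qU qI (drawBound N p T),
      ((misses p σ ω.rate u T).card : ℝ) ≤ y) :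
    regret qU qI (policy (N := N) p draw) T ≤ x + y := by
  rw [regret_eq_avg p hd]
  refine avg_le_const fun σ => ?_
  rw [Finset.expect_add_distrib, ← Finset.mul_expect, Finset.expect_sum_comm]
  refine add_le_add hx ?_
  rw [one_div, inv_mul_le_iff₀ (by exact_mod_cast Nat.pos_of_ne_zero (NeZero.ne N))]
  refine (Finset.sum_le_sum fun u _ => hy σ u).trans (le_of_eq ?_)
  simp

lemma avg_min_le_const [NeZero K] [NeZero qU] [NeZero qI] (p : Params) (T : ℕ) :
    𝔼 ω : Sample N qU qI K, ((min (exploreTime p ω.rate) T : ℕ) : ℝ) / 2 ≤ (T : ℝ) / 2 :=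
  avg_le_const fun ω => by
    gcongr
    exact min_le_right _ _

/-- If the exploration does not end in time, then half of the recommendations are disliked. -/
lemma regret_le_half_of_le [NeZero N] [NeZero qU] [NeZero qI] (p : Params) {draw : ℕ → ℕ}
    (hd : Function.Injective draw) (T : ℕ) [NeZero (drawBound N p T)]
    (h : ∀ ω : Sample N qU qI (drawBound N p T), T ≤ exploreTime p ω.rate) :
    regret qU qI (policy (N := N) p draw) T ≤ (T : ℝ) / 2 := by
  have := regret_le_of_misses (N := N) (qU := qU) (qI := qI) p hd T (avg_min_le_const p T)
      (y := 0) fun σ u => by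
    refine avg_le_const fun ω => ?_
    have h1 := misses_card_le p σ ω.rate u T
    have h2 := h ω
    exact_mod_cast h1.trans (by omega)
  simpa using this

open Classical in
-- The failure of `LargeTypes` costs at most the time beyond `tmax`. The second form keeps this
-- factor `T - tmax`, which is needed when `T` barely exceeds `tmax`.
lemma avg_min_le [NeZero K] [NeZero qU] [NeZero qI] (p : Params) (T : ℕ) {tmax e : ℝ}
    (ht0 : 0 ≤ tmax)
    (ht : ∀ ω : Sample N qU qI K, LargeTypes ω.1 → (exploreTime p ω.rate : ℝ) ≤ tmax)
    (he : 𝔼 ω : Sample N qU qI K, (if LargeTypes ω.1 then (0 : ℝ) else 1) ≤ e) :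
    𝔼 ω : Sample N qU qI K, ((min (exploreTime p ω.rate) T : ℕ) : ℝ) / 2 ≤
        tmax / 2 + T * e / 2 ∧
      (tmax ≤ T → 𝔼 ω : Sample N qU qI K, ((min (exploreTime p ω.rate) T : ℕ) : ℝ) / 2 ≤
        tmax / 2 + (T - tmax) * e / 2) := by
  have key : ∀ b : ℝ, 0 ≤ b → (T : ℝ) ≤ tmax + b →
      𝔼 ω : Sample N qU qI K, ((min (exploreTime p ω.rate) T : ℕ) : ℝ) / 2 ≤
        tmax / 2 + b * e / 2 := by
    intro b hb hT
    have h1 : ∀ ω : Sample N qU qI K, ((min (exploreTime p ω.rate) T : ℕ) : ℝ) / 2 ≤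
        tmax / 2 + b * (if LargeTypes ω.1 then (0 : ℝ) else 1) / 2 := fun ω => by
      split_ifs with h
      · have := ht ω h
        have : ((min (exploreTime p ω.rate) T : ℕ) : ℝ) ≤ exploreTime p ω.rate := by
          exact_mod_cast min_le_left _ _
        linarith
      · have : ((min (exploreTime p ω.rate) T : ℕ) : ℝ) ≤ T := by
          exact_mod_cast min_le_right _ _
        linarith
    refine (avg_mono h1).trans ?_
    rw [Finset.expect_add_distrib, Fintype.expect_const, ← Finset.expect_div,
      ← Finset.mul_expect]
    gcongr
  exact ⟨key T (Nat.cast_nonneg _) (by linarith), fun h => key _ (by linarith) (by linarith)⟩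

lemma ceilDiv_le_div_add_one (a b : ℕ) : ((a ⌈/⌉ b : ℕ) : ℝ) ≤ a / b + 1 := by
  rcases Nat.eq_zero_or_pos b with rfl | hb
  · simp
  · have hb' : (0 : ℝ) < b := by exact_mod_cast hb
    rw [Nat.ceilDiv_eq_add_pred_div]
    refine Nat.cast_div_le.trans ?_
    rw [div_le_iff₀ hb', add_mul, div_mul_cancel₀ _ hb'.ne', one_mul]
    have : a + b - 1 ≤ a + b := Nat.sub_le _ _
    exact_mod_cast this

lemma card_type_le_clus [NeZero K] {p : Params} (hp : p.rU ≤ p.Iusr) (ω : Sample N qU qI K)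
    (u : Fin N) : (Finset.univ.filter fun v => ω.1 v = ω.1 u).card ≤ (clus p ω.rate u).card := by
  refine Finset.card_le_card fun v hv => ?_
  simp only [Finset.mem_filter, Finset.mem_univ, true_and] at hv
  rw [clus, if_pos hp]
  rw [Finset.mem_filter]
  exact ⟨Finset.mem_univ _, fun k _ => by simp only [Sample.rate, hv]⟩

lemma prefsTime_le [NeZero N] [NeZero K] [NeZero qU] {p : Params} (hp : p.rU ≤ p.Iusr)
    {ω : Sample N qU qI K} (hω : LargeTypes ω.1) :
    (prefsTime p ω.rate : ℝ) ≤ 2 * qU * p.Irep / N + 1 := by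
  have hN : (0 : ℝ) < N := by exact_mod_cast Nat.pos_of_ne_zero (NeZero.ne N)
  have hq : (0 : ℝ) < qU := by exact_mod_cast Nat.pos_of_ne_zero (NeZero.ne qU)
  have : Nonempty (Fin N) := ⟨0⟩
  obtain ⟨u, -, hu⟩ := Finset.exists_mem_eq_sup Finset.univ Finset.univ_nonempty
    fun u : Fin N => p.Irep ⌈/⌉ (clus p ω.rate u).card
  rw [prefsTime, hu]
  refine (ceilDiv_le_div_add_one _ _).trans ?_
  have h1 : (N : ℝ) / (2 * qU) ≤ (clus p ω.rate u).card :=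
    (hω (ω.1 u)).trans (by exact_mod_cast card_type_le_clus hp ω u)
  have h2 : (0 : ℝ) < N / (2 * qU) := by positivity
  have h3 : (p.Irep : ℝ) / (clus p ω.rate u).card ≤ p.Irep / (N / (2 * qU)) := by gcongr
  refine add_le_add_left (h3.trans (le_of_eq ?_)) _
  field_simp

/-- With few representatives each cluster finishes in one step. Unlike `prefsTime_le` this loses no
fraction of a step, as is needed for the bound `T / 2` just above `T = rU + 1`. -/
lemma prefsTime_le_one [NeZero N] [NeZero K] [NeZero qU] {p : Params} (hp : p.rU ≤ p.Iusr)
    {ω : Sample N qU qI K} (hω : LargeTypes ω.1) (h : (p.Irep : ℝ) * (2 * qU) ≤ N) :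
    prefsTime p ω.rate ≤ 1 := by
  have hq : (0 : ℝ) < qU := by exact_mod_cast Nat.pos_of_ne_zero (NeZero.ne qU)
  refine Finset.sup_le fun u _ => ?_
  rw [ceilDiv_le_iff_le_smul (clus_card_pos _ _ _), smul_eq_mul, mul_one]
  have h1 : (N : ℝ) / (2 * qU) ≤ (clus p ω.rate u).card :=
    (hω (ω.1 u)).trans (by exact_mod_cast card_type_le_clus hp ω u)
  have h2 : (p.Irep : ℝ) ≤ N / (2 * qU) := by rwa [le_div_iff₀ (by positivity)]
  exact_mod_cast h2.trans h1

lemma one_le_prefsTime [NeZero N] (p : Params) (g : Fin N → ℕ → Bool) (h : 1 ≤ p.Irep) :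
    1 ≤ prefsTime p g := by
  refine le_trans ?_ (ceilDiv_le_prefsTime p g 0)
  rw [Nat.one_le_iff_ne_zero]
  intro h0
  have := le_smul_ceilDiv (b := p.Irep) (clus_card_pos p g 0)
  rw [h0] at this
  simp at this
  omega

lemma prefsTime_of_singletons [NeZero N] (p : Params) (g : Fin N → ℕ → Bool)
    (h : ¬ p.rU ≤ p.Iusr) : prefsTime p g = p.Irep := by
  have : ∀ u, p.Irep ⌈/⌉ (clus p g u).card = p.Irep := fun u => by
    rw [clus, if_neg h, Finset.card_singleton, ceilDiv_one]
  simp only [prefsTime, this]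
  exact Finset.sup_const ⟨0, Finset.mem_univ _⟩ _

lemma pureClusters_of_singletons (p : Params) (g : Fin N → ℕ → Bool)
    (h : ¬ p.rU ≤ p.Iusr) : PureClusters p g := by
  intro u v hv k
  rw [clus, if_neg h, Finset.mem_singleton] at hv
  rw [hv]

lemma itemClusteringTime_le (p : Params) :
    (itemClusteringTime N p : ℝ) ≤ p.Iexp * p.rI / N + 1 := by
  have := ceilDiv_le_div_add_one (p.Iexp * p.rI) N
  rwa [Nat.cast_mul] at this

lemma itemClusteringTime_of_exp_eq_zero (p : Params) (h : p.Iexp = 0) :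
    itemClusteringTime N p = 0 := by
  rw [itemClusteringTime, h, zero_mul, zero_ceilDiv]

end Union


/-! ### Exploited representatives are at least as good as fresh items -/

section Exchange

variable {N : ℕ}

/-- A rating as a sign. -/
def sgn (b : Bool) : ℝ := if b then 1 else -1

/-- The indicator of a like. -/
def ind (b : Bool) : ℝ := if b then 1 else 0

lemma swap_apply_swap_apply {α : Type*} [DecidableEq α] (a b x : α) :
    Equiv.swap a b (Equiv.swap a b x) = x := by
  rw [← Equiv.Perm.mul_apply, Equiv.swap_mul_self, Equiv.Perm.one_apply]

lemma clus_congr {p : Params} {g g' : Fin N → ℕ → Bool}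
    (h : ∀ v, ∀ k < p.Iusr, g v k = g' v k) : clus p g = clus p g' := by
  funext u
  simp only [clus]
  split_ifs
  · ext v
    simp only [Finset.mem_filter, Finset.mem_univ, true_and]
    exact forall₂_congr fun k hk => by rw [h v k hk, h u k hk]
  · rfl

lemma prefsTime_congr {p : Params} {g g' : Fin N → ℕ → Bool} (h : clus p g = clus p g') :
    prefsTime p g = prefsTime p g' := by simp only [prefsTime, h]

lemma exploreTime_congr {p : Params} {g g' : Fin N → ℕ → Bool} (h : clus p g = clus p g') :
    exploreTime p g = exploreTime p g' := by simp only [exploreTime, prefsTime_congr h]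

lemma rater_congr_clus {p : Params} {g g' : Fin N → ℕ → Bool} (h : clus p g = clus p g')
    (u : Fin N) (k : ℕ) : rater p g u k = rater p g' u k := by
  have : ∀ (s s' : Finset (Fin N)) (_ : s = s') (h1 : 0 < s.card) (h2 : 0 < s'.card),
      s.orderEmbOfFin rfl ⟨k % s.card, Nat.mod_lt _ h1⟩ =
        s'.orderEmbOfFin rfl ⟨k % s'.card, Nat.mod_lt _ h2⟩ := by
    rintro s _ rfl _ _
    rfl
  exact this _ _ (by rw [h]) (clus_card_pos p g u) (clus_card_pos p g' u)

lemma candidates_congr {p : Params} {g g' : Fin N → ℕ → Bool} (h : clus p g = clus p g')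
    (u : Fin N) : candidates p g u = candidates p g' u := by
  simp only [candidates, rater_congr_clus h]

/-- The `k`-th representative is among the next items to be exploited, provided that it is liked. -/
def Eligible (p : Params) (g : Fin N → ℕ → Bool) (u : Fin N) (T k : ℕ) : Prop :=
  k ∈ candidates p g u ∧ ((likedCandidates p g u).filter (· < k)).card < T - exploreTime p g

instance (p : Params) (g : Fin N → ℕ → Bool) (u : Fin N) (T k : ℕ) :
    Decidable (Eligible p g u T k) := by
  unfold Eligible; infer_instance

/-- Whether `k` is reached depends only on the clusters and on the recorded ratings of earlier
representatives. So the type of `k` itself remains free to be exchanged. -/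
lemma eligible_congr {p : Params} {g g' : Fin N → ℕ → Bool} (h : clus p g = clus p g')
    {u : Fin N} {T k : ℕ} (h' : ∀ j < k, j < p.Irep →
      g (rater p g u j) (p.Iusr + j) = g' (rater p g u j) (p.Iusr + j)) :
    Eligible p g u T k ↔ Eligible p g' u T k := by
  have : (likedCandidates p g u).filter (· < k) = (likedCandidates p g' u).filter (· < k) := by
    ext j
    simp only [likedCandidates, Finset.mem_filter, candidates_congr h]
    refine and_congr_left fun hj => and_congr_right fun hc => ?_
    have hc : j < p.Irep := by
      simp only [candidates, Finset.mem_filter, Finset.mem_range] at hc; exact hc.1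
    rw [h' j hj hc, rater_congr_clus h]
  simp only [Eligible, candidates_congr h, exploreTime_congr h, this]

variable {qU qI K : ℕ} [NeZero K]

/-- The gain of the `k`-th representative over the fresh item `f`. -/
noncomputable def gain (p : Params) (u : Fin N) (T k f : ℕ) (ω : Sample N qU qI K) : ℝ :=
  (if Eligible p ω.rate u T k then 1 else 0) *
    (ind (ω.rate (rater p ω.rate u k) (p.Iusr + k)) - ind (ω.rate (rater p ω.rate u k) f)) *
    (sgn (ω.rate u (p.Iusr + k)) - sgn (ω.rate u f))

/-- Swapping the types of the draws `k` and `f` preserves the law, the clusters and eligibility.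
Averaging the expression with its swapped version turns it into a product of two differences. -/
lemma avg_selected_eq (p : Params) (u : Fin N) (T : ℕ) {k f : ℕ} (hk : k < p.Irep)
    (hf : p.Iusr + p.Irep ≤ f) (hfK : f < K) :
    𝔼 ω : Sample N qU qI K, (if Eligible p ω.rate u T k then (1 : ℝ) else 0) *
      ind (ω.rate (rater p ω.rate u k) (p.Iusr + k)) *
        (sgn (ω.rate u (p.Iusr + k)) - sgn (ω.rate u f)) =
    (𝔼 ω : Sample N qU qI K, gain p u T k f ω) / 2 := by
  let e : Sample N qU qI K ≃ Sample N qU qI K :=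
    Equiv.prodCongr (Equiv.refl _) (Equiv.prodCongr
      (Equiv.arrowCongr (Equiv.swap (Fin.ofNat K (p.Iusr + k)) (Fin.ofNat K f)) (Equiv.refl _))
      (Equiv.refl _))
  have e1 : ∀ (ω : Sample N qU qI K) v, (e ω).rate v (p.Iusr + k) = ω.rate v f := fun ω v => by
    simp [e, Sample.rate, Equiv.arrowCongr]
  have e2 : ∀ (ω : Sample N qU qI K) v, (e ω).rate v f = ω.rate v (p.Iusr + k) := fun ω v => by
    simp [e, Sample.rate, Equiv.arrowCongr]
  have e3 : ∀ (ω : Sample N qU qI K) v, ∀ j < p.Iusr + k, (e ω).rate v j = ω.rate v j :=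
    fun ω v j hj => by
    have h1 : Fin.ofNat K j ≠ Fin.ofNat K (p.Iusr + k) := fun h => by
      have := ofNat_injOn (by omega) (by omega) h; omega
    have h2 : Fin.ofNat K j ≠ Fin.ofNat K f := fun h => by
      have := ofNat_injOn (by omega) (by omega) h; omega
    simp only [e, Sample.rate, Equiv.arrowCongr, Equiv.prodCongr_apply, Prod.map, Equiv.coe_fn_mk,
      Equiv.refl_apply, Function.comp, Equiv.symm_swap, Equiv.swap_apply_of_ne_of_ne h1 h2]
  have hc : ∀ ω : Sample N qU qI K, clus p (e ω).rate = clus p ω.rate := fun ω =>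
    clus_congr fun v j hj => e3 ω v j (by omega)
  have hE : ∀ ω : Sample N qU qI K, Eligible p (e ω).rate u T k ↔ Eligible p ω.rate u T k :=
    fun ω => eligible_congr (hc ω) fun j hj _ => e3 ω _ _ (by omega)
  set F : Sample N qU qI K → ℝ := fun ω => (if Eligible p ω.rate u T k then (1 : ℝ) else 0) *
      ind (ω.rate (rater p ω.rate u k) (p.Iusr + k)) *
        (sgn (ω.rate u (p.Iusr + k)) - sgn (ω.rate u f)) with hF
  have h1 : 𝔼 ω, F (e ω) = 𝔼 ω, F ω := Fintype.expect_equiv e _ _ fun _ => rfl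
  have h2 : ∀ ω, gain p u T k f ω = F ω + F (e ω) := fun ω => by
    simp only [hF, gain, hE, e1, e2, rater_congr_clus (hc ω)]
    ring
  simp_rw [h2]
  rw [Finset.expect_add_distrib, h1]
  change 𝔼 ω, F ω = _
  ring

/-- The types of the user-clustering items. -/
def usrTypes (p : Params) (ω : Sample N qU qI K) : Finset (Fin qI) :=
  (idx K (Finset.range p.Iusr)).image ω.2.1

lemma mem_usrTypes {p : Params} {ω : Sample N qU qI K} {b : Fin qI} :
    b ∈ usrTypes p ω ↔ ∃ j < p.Iusr, ω.2.1 (Fin.ofNat K j) = b := by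
  simp [usrTypes, idx]

lemma agree_of_mem_usrTypes {p : Params} (hp : p.rU ≤ p.Iusr) {ω : Sample N qU qI K}
    {u v : Fin N} (hv : v ∈ clus p ω.rate u) {b : Fin qI} (hb : b ∈ usrTypes p ω) :
    ω.2.2 (ω.1 v, b) = ω.2.2 (ω.1 u, b) := by
  obtain ⟨j, hj, rfl⟩ := mem_usrTypes.1 hb
  rw [clus, if_pos hp, Finset.mem_filter] at hv
  exact hv.2 j hj

/-- The samples for which the gain need not be nonnegative. -/
def Undecided (p : Params) (u : Fin N) (k f : ℕ) (ω : Sample N qU qI K) : Prop :=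
  ω.1 (rater p ω.rate u k) ≠ ω.1 u ∧ ω.2.1 (Fin.ofNat K (p.Iusr + k)) ∉ usrTypes p ω ∧
    ω.2.1 (Fin.ofNat K f) ∉ usrTypes p ω

/-- If `u` and the rater agree on one of the two items, then the two differences never have opposite
signs. They agree if they have the same type, or if one of the items has a type seen in user
clustering. -/
lemma gain_nonneg {p : Params} (hp : p.rU ≤ p.Iusr) (u : Fin N) (T k f : ℕ)
    {ω : Sample N qU qI K} (h : ¬ Undecided p u k f ω) : 0 ≤ gain p u T k f ω := by
  rw [gain, mul_assoc]
  refine mul_nonneg (by split_ifs <;> norm_num) ?_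
  have hr := rater_mem p ω.rate u k
  have key : ω.rate (rater p ω.rate u k) (p.Iusr + k) = ω.rate u (p.Iusr + k) ∨
      ω.rate (rater p ω.rate u k) f = ω.rate u f := by
    simp only [Undecided, not_and_or, not_not] at h
    rcases h with h | h | h
    · left; simp only [Sample.rate, h]
    · left; exact agree_of_mem_usrTypes hp hr h
    · right; exact agree_of_mem_usrTypes hp hr h
  rcases key with h | h <;> rw [h] <;>
  cases ω.rate u (p.Iusr + k) <;> cases ω.rate u f <;>
  cases ω.rate (rater p ω.rate u k) (p.Iusr + k) <;> cases ω.rate (rater p ω.rate u k) f <;>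
  norm_num [ind, sgn]

open Classical in
/-- Exchange of two entries in the row of `u`, together with the types of the items that users of
the type of `u` get. -/
noncomputable def exchange (p : Params) (u : Fin N) (k f : ℕ) (ω : Sample N qU qI K) :
    Sample N qU qI K :=
  if Undecided p u k f ω then
    (ω.1, fun i => if ∃ j < p.Irep, j ≠ k ∧ i = Fin.ofNat K (p.Iusr + j) ∧
        ω.1 (rater p ω.rate u j) = ω.1 u then
      Equiv.swap (ω.2.1 (Fin.ofNat K (p.Iusr + k))) (ω.2.1 (Fin.ofNat K f)) (ω.2.1 i)
      else ω.2.1 i,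
    fun z => if z.1 = ω.1 u then
      ω.2.2 (z.1, Equiv.swap (ω.2.1 (Fin.ofNat K (p.Iusr + k))) (ω.2.1 (Fin.ofNat K f)) z.2)
      else ω.2.2 z)
  else ω

section

variable {p : Params} {u : Fin N} {k f : ℕ} {ω : Sample N qU qI K}

lemma exchange_fst (hω : Undecided p u k f ω) : (exchange p u k f ω).1 = ω.1 := by
  rw [exchange, if_pos hω]

lemma exchange_types (hω : Undecided p u k f ω) {i : Fin K}
    (h : ∀ j < p.Irep, j ≠ k → i ≠ Fin.ofNat K (p.Iusr + j)) :
    (exchange p u k f ω).2.1 i = ω.2.1 i := by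
  rw [exchange, if_pos hω]
  simp only
  rw [if_neg]
  rintro ⟨j, h1, h2, h3, -⟩
  exact h j h1 h2 h3

lemma exchange_type_usr (hk : k < p.Irep) (hf : p.Iusr + p.Irep ≤ f) (hfK : f < K)
    (hω : Undecided p u k f ω) {j : ℕ} (hj : j < p.Iusr) :
    (exchange p u k f ω).2.1 (Fin.ofNat K j) = ω.2.1 (Fin.ofNat K j) :=
  exchange_types hω fun i hi _ h => by
    have := ofNat_injOn (by omega) (by omega) h
    omega

lemma exchange_type_rep (hk : k < p.Irep) (hf : p.Iusr + p.Irep ≤ f) (hfK : f < K)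
    (hω : Undecided p u k f ω) :
    (exchange p u k f ω).2.1 (Fin.ofNat K (p.Iusr + k)) = ω.2.1 (Fin.ofNat K (p.Iusr + k)) :=
  exchange_types hω fun i hi hne h => by
    have := ofNat_injOn (by omega) (by omega) h
    omega

lemma exchange_type_fresh (hf : p.Iusr + p.Irep ≤ f) (hfK : f < K)
    (hω : Undecided p u k f ω) :
    (exchange p u k f ω).2.1 (Fin.ofNat K f) = ω.2.1 (Fin.ofNat K f) :=
  exchange_types hω fun i hi hne h => by
    have := ofNat_injOn (by omega) (by omega) h
    omega

lemma exchange_entry_of_ne (hω : Undecided p u k f ω) {a : Fin qU} (ha : a ≠ ω.1 u) (b : Fin qI) :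
    (exchange p u k f ω).2.2 (a, b) = ω.2.2 (a, b) := by
  rw [exchange, if_pos hω]
  simp only [if_neg ha]

lemma exchange_entry (hω : Undecided p u k f ω) (b : Fin qI) :
    (exchange p u k f ω).2.2 (ω.1 u, b) = ω.2.2 (ω.1 u,
      Equiv.swap (ω.2.1 (Fin.ofNat K (p.Iusr + k))) (ω.2.1 (Fin.ofNat K f)) b) := by
  rw [exchange, if_pos hω]
  simp only [if_true]

lemma exchange_usrTypes (hk : k < p.Irep) (hf : p.Iusr + p.Irep ≤ f) (hfK : f < K)
    (hω : Undecided p u k f ω) : usrTypes p (exchange p u k f ω) = usrTypes p ω := by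
  ext b
  simp only [mem_usrTypes]
  refine exists_congr fun j => and_congr_right fun hj => ?_
  rw [exchange_type_usr hk hf hfK hω hj]

/-- The swapped columns belong to no clustering item, and the types of the clustering items stay as
they are. -/
lemma exchange_clus (hk : k < p.Irep) (hf : p.Iusr + p.Irep ≤ f) (hfK : f < K)
    (hω : Undecided p u k f ω) : clus p (exchange p u k f ω).rate = clus p ω.rate := by
  refine clus_congr fun v j hj => ?_
  simp only [Sample.rate]
  rw [exchange_type_usr hk hf hfK hω hj, exchange_fst hω]
  have hm : ω.2.1 (Fin.ofNat K j) ∈ usrTypes p ω := mem_usrTypes.2 ⟨j, hj, rfl⟩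
  by_cases h : ω.1 v = ω.1 u
  · rw [h, exchange_entry hω, Equiv.swap_apply_of_ne_of_ne]
    · rintro h; rw [h] at hm; exact hω.2.1 hm
    · rintro h; rw [h] at hm; exact hω.2.2 hm
  · rw [exchange_entry_of_ne hω h]

lemma exchange_undecided (hk : k < p.Irep) (hf : p.Iusr + p.Irep ≤ f) (hfK : f < K)
    (hω : Undecided p u k f ω) : Undecided p u k f (exchange p u k f ω) := by
  rw [Undecided, exchange_usrTypes hk hf hfK hω, exchange_type_rep hk hf hfK hω,
    exchange_type_fresh hf hfK hω, rater_congr_clus (exchange_clus hk hf hfK hω), exchange_fst hω]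
  exact hω

lemma exchange_exchange (hk : k < p.Irep) (hf : p.Iusr + p.Irep ≤ f) (hfK : f < K) :
    Function.Involutive (exchange p u k f : Sample N qU qI K → Sample N qU qI K) := by
  intro ω
  by_cases hω : Undecided p u k f ω
  · have h2 := exchange_undecided hk hf hfK hω
    have hr := rater_congr_clus (exchange_clus hk hf hfK hω) u
    conv_lhs => rw [exchange, if_pos h2]
    simp only [hr, exchange_fst hω, exchange_type_rep hk hf hfK hω, exchange_type_fresh hf hfK hω]
    refine Prod.ext rfl (Prod.ext ?_ ?_)
    · funext i
      simp only [exchange, if_pos hω]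
      split_ifs
      · exact swap_apply_swap_apply _ _ _
      · rfl
    · funext z
      by_cases h : z.1 = ω.1 u
      · simp only [exchange, if_pos hω, h, if_true, swap_apply_swap_apply]
        rw [← h]
      · simp only [exchange, if_pos hω, h, if_false]
  · rw [exchange, if_neg]
    · rw [exchange, if_neg hω]
    · rwa [exchange, if_neg hω]

/-- The ratings of `k` and `f` by `u` trade places, while the rater has another type and keeps its
own. Earlier representatives rated by users of the type of `u` had their types swapped along with
the entries, so their recorded ratings, and with them eligibility, are unchanged. -/
lemma gain_exchange (hk : k < p.Irep) (hf : p.Iusr + p.Irep ≤ f) (hfK : f < K)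
    (hω : Undecided p u k f ω) (T : ℕ) :
    gain p u T k f (exchange p u k f ω) = -gain p u T k f ω := by
  classical
  have hc := exchange_clus hk hf hfK hω
  have hr := rater_congr_clus hc u
  have hE : Eligible p (exchange p u k f ω).rate u T k ↔ Eligible p ω.rate u T k := by
    refine eligible_congr hc fun j hj hj' => ?_
    simp only [Sample.rate, hr]
    rw [exchange_fst hω]
    by_cases h : ω.1 (rater p ω.rate u j) = ω.1 u
    · rw [h, exchange_entry hω]
      have : (exchange p u k f ω).2.1 (Fin.ofNat K (p.Iusr + j)) =
          Equiv.swap (ω.2.1 (Fin.ofNat K (p.Iusr + k))) (ω.2.1 (Fin.ofNat K f))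
            (ω.2.1 (Fin.ofNat K (p.Iusr + j))) := by
        rw [exchange, if_pos hω]
        simp only
        rw [if_pos ⟨j, hj', hj.ne, rfl, h⟩]
      rw [this, swap_apply_swap_apply]
    · rw [exchange_entry_of_ne hω h]
      rw [exchange, if_pos hω]
      simp only
      rw [if_neg]
      rintro ⟨i, hi, -, hij, ha⟩
      have := ofNat_injOn (by omega) (by omega) hij
      rw [show i = j by omega] at ha
      exact h ha
  have h1 : (exchange p u k f ω).rate (rater p ω.rate u k) (p.Iusr + k) =
      ω.rate (rater p ω.rate u k) (p.Iusr + k) := by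
    simp only [Sample.rate]
    rw [exchange_fst hω, exchange_entry_of_ne hω hω.1, exchange_type_rep hk hf hfK hω]
  have h2 : (exchange p u k f ω).rate (rater p ω.rate u k) f =
      ω.rate (rater p ω.rate u k) f := by
    simp only [Sample.rate]
    rw [exchange_fst hω, exchange_entry_of_ne hω hω.1, exchange_type_fresh hf hfK hω]
  have h3 : (exchange p u k f ω).rate u (p.Iusr + k) = ω.rate u f := by
    simp only [Sample.rate]
    rw [exchange_fst hω, exchange_entry hω, exchange_type_rep hk hf hfK hω, Equiv.swap_apply_left]
  have h4 : (exchange p u k f ω).rate u f = ω.rate u (p.Iusr + k) := by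
    simp only [Sample.rate]
    rw [exchange_fst hω, exchange_entry hω, exchange_type_fresh hf hfK hω, Equiv.swap_apply_right]
  simp only [gain, hE, hr, h1, h2, h3, h4]
  ring

open Classical in
/-- On average, the gain is at least its part on any set of decided samples. -/
lemma avg_gain_ge (hp : p.rU ≤ p.Iusr) (hk : k < p.Irep) (hf : p.Iusr + p.Irep ≤ f) (hfK : f < K)
    (u : Fin N) (T : ℕ) {P : Sample N qU qI K → ℝ}
    (hP : ∀ ω, Undecided p u k f ω → P ω ≤ 0)
    (hP' : ∀ ω, P ω ≤ gain p u T k f ω ∨ P ω ≤ 0) :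
    𝔼 ω, P ω ≤ 𝔼 ω : Sample N qU qI K, gain p u T k f ω := by
  set B : Sample N qU qI K → ℝ := fun ω => if Undecided p u k f ω then gain p u T k f ω else 0
    with hB
  -- The undecided samples cancel in pairs under the involution `exchange`.
  have h0 : 𝔼 ω, B ω = 0 := by
    have h1 : 𝔼 ω, B (exchange p u k f ω) = 𝔼 ω, B ω :=
      Fintype.expect_equiv (exchange_exchange hk hf hfK).toPerm _ _ fun _ => rfl
    have h2 : ∀ ω, B (exchange p u k f ω) = -B ω := fun ω => by
      simp only [hB]
      by_cases hω : Undecided p u k f ω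
      · rw [if_pos (exchange_undecided hk hf hfK hω), if_pos hω, gain_exchange hk hf hfK hω]
      · have : exchange p u k f ω = ω := by rw [exchange, if_neg hω]
        rw [this, if_neg hω, neg_zero]
    simp_rw [h2] at h1
    rw [Finset.expect_neg_distrib] at h1
    linarith
  rw [← add_zero (𝔼 ω, P ω), ← h0, ← Finset.expect_add_distrib]
  refine avg_mono fun ω => ?_
  simp only [hB]
  by_cases hω : Undecided p u k f ω
  · rw [if_pos hω]; linarith [hP ω hω]
  · rw [if_neg hω, add_zero]
    rcases hP' ω with h | h
    · exact h
    · exact h.trans (gain_nonneg hp u T k f hω)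

end

end Exchange


/-! ### Short exploitation of the representatives -/

section Window

variable {N qU qI K : ℕ}

/-- Only the representatives handed to `u` itself are lost, at most one per step; the quotient of
`k` by the cluster size tells the step. -/
lemma card_candidates (p : Params) (g : Fin N → ℕ → Bool) (u : Fin N) :
    p.Irep ≤ (candidates p g u).card + prefsTime p g := by
  have h := Finset.card_filter_add_card_filter_not (s := Finset.range p.Irep)
    fun k => rater p g u k ≠ u
  rw [Finset.card_range] at h
  have h2 : ((Finset.range p.Irep).filter fun k => ¬ rater p g u k ≠ u).card ≤
      (Finset.range (prefsTime p g)).card := by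
    have hc := clus_card_pos p g u
    refine Finset.card_le_card_of_injOn (· / (clus p g u).card) (fun k hk => ?_) ?_
    · simp only [Finset.coe_filter, Finset.mem_range, Set.mem_ofPred_eq] at hk
      rw [Finset.mem_coe, Finset.mem_range]
      refine lt_of_lt_of_le ?_ (ceilDiv_le_prefsTime p g u)
      rw [Nat.div_lt_iff_lt_mul hc, mul_comm]
      exact hk.1.trans_le (le_smul_ceilDiv hc)
    · intro k hk k' hk' e
      simp only [Finset.coe_filter, Finset.mem_range, Set.mem_ofPred_eq, not_not] at hk hk'
      have h1 := hk.2.trans hk'.2.symm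
      simp only [rater, EmbeddingLike.apply_eq_iff_eq, Fin.mk.injEq] at h1
      rw [← Nat.div_add_mod k (clus p g u).card, h1, show k / (clus p g u).card = _ from e,
        Nat.div_add_mod]
  rw [Finset.card_range] at h2
  rw [candidates]
  omega

/-- The rank among the liked candidates is injective and lies below the remaining time. -/
lemma card_eligible_le (p : Params) (g : Fin N → ℕ → Bool) (u : Fin N) (T : ℕ) :
    ((likedCandidates p g u).filter fun k =>
      ((likedCandidates p g u).filter (· < k)).card < T - exploreTime p g).card ≤
      T - exploreTime p g := by
  set G := likedCandidates p g u
  conv_rhs => rw [← Finset.card_range (T - exploreTime p g)]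
  refine Finset.card_le_card_of_injOn (fun k => (G.filter (· < k)).card) (fun k hk => ?_) ?_
  · simp only [Finset.coe_filter, Set.mem_ofPred_eq] at hk
    simpa using hk.2
  · have key : ∀ k ∈ G, ∀ k', k < k' → (G.filter (· < k)).card < (G.filter (· < k')).card := by
      intro k hk k' h
      refine Finset.card_lt_card (Finset.ssubset_iff_subset_ne.2 ⟨?_, fun e => ?_⟩)
      · intro a ha
        rw [Finset.mem_filter] at ha ⊢
        exact ⟨ha.1, ha.2.trans h⟩
      · have : k ∈ G.filter (· < k') := Finset.mem_filter.2 ⟨hk, h⟩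
        rw [← e] at this
        exact lt_irrefl _ (Finset.mem_filter.1 this).2
    intro k hk k' hk' e
    rw [Finset.coe_filter, Set.mem_ofPred_eq] at hk hk'
    rcases lt_trichotomy k k' with h | h | h
    · exact absurd e (key k hk.1 k' h).ne
    · exact h
    · exact absurd e (key k' hk'.1 k h).ne'

/-- The number of liked candidates is less than the time that is left. -/
def Exhausted (p : Params) (g : Fin N → ℕ → Bool) (u : Fin N) (T : ℕ) : Prop :=
  (likedCandidates p g u).card < T - exploreTime p g

instance (p : Params) (g : Fin N → ℕ → Bool) (u : Fin N) (T : ℕ) :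
    Decidable (Exhausted p g u T) := by
  unfold Exhausted; infer_instance

variable [NeZero K]

/-- An exploited item is a miss with weight `(1 - sgn) / 2`; adding and subtracting the sign of `f`
isolates the comparison with a fresh item. If the liked candidates are exhausted, the second term
alone covers every possible miss. -/
lemma misses_card_le_sum_eligible (p : Params) (σ : Equiv.Perm (Fin N)) (u : Fin N) (T f : ℕ)
    (ω : Sample N qU qI K) :
    ((misses p σ ω.rate u T).card : ℝ) ≤
      ((T - exploreTime p ω.rate : ℕ) : ℝ) * (1 - sgn (ω.rate u f)) / 2 +
      ((T - exploreTime p ω.rate : ℕ) : ℝ) * (if Exhausted p ω.rate u T then 1 else 0) -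
      (∑ k ∈ Finset.range p.Irep, (if Eligible p ω.rate u T k then (1 : ℝ) else 0) *
        ind (ω.rate (rater p ω.rate u k) (p.Iusr + k)) *
          (sgn (ω.rate u (p.Iusr + k)) - sgn (ω.rate u f))) / 2 := by
  set m := T - exploreTime p ω.rate with hm
  set G := likedCandidates p ω.rate u with hG
  set S := G.filter fun k => (G.filter (· < k)).card < m with hS
  have hsum : ∀ h : ℕ → ℝ, ∑ k ∈ Finset.range p.Irep,
      (if Eligible p ω.rate u T k then (1 : ℝ) else 0) *
        ind (ω.rate (rater p ω.rate u k) (p.Iusr + k)) * h k = ∑ k ∈ S, h k := by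
    intro h
    have e : S = (Finset.range p.Irep).filter fun k => Eligible p ω.rate u T k ∧
        ω.rate (rater p ω.rate u k) (p.Iusr + k) = true := by
      ext k
      simp only [hS, hG, likedCandidates, candidates, Eligible, Finset.mem_filter,
        Finset.mem_range, hm]
      tauto
    rw [e, Finset.sum_filter]
    refine Finset.sum_congr rfl fun k _ => ?_
    by_cases h1 : Eligible p ω.rate u T k <;>
      by_cases h2 : ω.rate (rater p ω.rate u k) (p.Iusr + k) = true <;> simp [h1, h2, ind]
  rw [hsum, Finset.sum_sub_distrib, Finset.sum_const, nsmul_eq_mul]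
  have hSm : (S.card : ℝ) ≤ m := by exact_mod_cast card_eligible_le p ω.rate u T
  have hs1 : 0 ≤ 1 - sgn (ω.rate u f) := by unfold sgn; split_ifs <;> norm_num
  have h1 : 0 ≤ ((m : ℝ) - S.card) * (1 - sgn (ω.rate u f)) := mul_nonneg (by linarith) hs1
  have h2 : ∑ k ∈ S, sgn (ω.rate u (p.Iusr + k)) =
      S.card - 2 * ((S.filter fun k => ω.rate u (p.Iusr + k) = false).card : ℝ) := by
    have e : ∀ k, sgn (ω.rate u (p.Iusr + k)) =
        1 - 2 * (if ω.rate u (p.Iusr + k) = false then (1 : ℝ) else 0) := fun k => by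
      cases ω.rate u (p.Iusr + k) <;> norm_num [sgn]
    simp_rw [e]
    rw [Finset.sum_sub_distrib, ← Finset.mul_sum, Finset.sum_boole]
    simp
  rw [h2]
  by_cases hex : Exhausted p ω.rate u T
  · have h3 : ((misses p σ ω.rate u T).card : ℝ) ≤ m := by
      exact_mod_cast misses_card_le p σ ω.rate u T
    have h4 : (0 : ℝ) ≤ ((S.filter fun k => ω.rate u (p.Iusr + k) = false).card : ℝ) :=
      Nat.cast_nonneg _
    rw [if_pos hex]
    nlinarith
  · have h3 := misses_card_le_likedCandidates p σ ω.rate (not_lt.1 hex)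
    have h4 : ((misses p σ ω.rate u T).card : ℝ) ≤
        ((S.filter fun k => ω.rate u (p.Iusr + k) = false).card : ℝ) := by
      rw [hS, Finset.filter_filter]
      exact_mod_cast h3
    rw [if_neg hex]
    nlinarith

lemma avg_mul_sgn_eq_zero (p : Params) (u : Fin N) (T f : ℕ) :
    𝔼 ω : Sample N qU qI K, ((T - exploreTime p ω.rate : ℕ) : ℝ) * sgn (ω.rate u f) = 0 := by
  have h := Fintype.expect_equiv (flipAll (N := N) (qU := qU) (qI := qI) (K := K))
    (fun ω => -(((T - exploreTime p ω.rate : ℕ) : ℝ) * sgn (ω.rate u f)))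
    (fun ω => ((T - exploreTime p ω.rate : ℕ) : ℝ) * sgn (ω.rate u f)) fun ω => by
      rw [exploreTime_flipAll, rate_flipAll]
      cases ω.rate u f <;> norm_num [sgn]
  rw [Finset.expect_neg_distrib] at h
  linarith

/-- Resampling all that does not affect the clusters. -/
def resample (p : Params) (ω : Sample N qU qI K) (c : Fin K → Fin qI)
    (ξ : Fin qU × Fin qI → Bool) : Sample N qU qI K :=
  (ω.1, (idx K (Finset.range p.Iusr)).piecewise ω.2.1 c,
    (Finset.univ.filter fun z : Fin qU × Fin qI => z.2 ∈ usrTypes p ω).piecewise ω.2.2 ξ)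

/-- Conditioning on what determines the clusters: the user types, the types of the clustering items,
and their columns. All other item types and entries are drawn anew. -/
lemma avg_resample [NeZero qI] (p : Params) (F : Sample N qU qI K → ℝ) :
    𝔼 ω, F ω = 𝔼 ω, 𝔼 c, 𝔼 ξ, F (resample p ω c ξ) := by
  rw [avg_sample, avg_sample]
  refine Finset.expect_congr rfl fun τ _ => ?_
  rw [avg_piecewise (idx K (Finset.range p.Iusr))]
  refine Finset.expect_congr rfl fun c _ => ?_
  conv_rhs => rw [Finset.expect_comm]
  refine Finset.expect_congr rfl fun c' _ => ?_
  rw [avg_piecewise (Finset.univ.filter fun z : Fin qU × Fin qI =>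
    z.2 ∈ (idx K (Finset.range p.Iusr)).image c)]
  rfl

variable {p : Params} {ω : Sample N qU qI K} {c : Fin K → Fin qI} {ξ : Fin qU × Fin qI → Bool}

lemma resample_type_usr {j : ℕ} (hj : j < p.Iusr) :
    (resample p ω c ξ).2.1 (Fin.ofNat K j) = ω.2.1 (Fin.ofNat K j) := by
  simp only [resample]
  rw [Finset.piecewise_eq_of_mem]
  exact Finset.mem_image_of_mem _ (Finset.mem_range.2 hj)

lemma resample_type {j : ℕ} (hj : p.Iusr ≤ j) (hK : j < K) :
    (resample p ω c ξ).2.1 (Fin.ofNat K j) = c (Fin.ofNat K j) := by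
  simp only [resample]
  rw [Finset.piecewise_eq_of_notMem]
  intro h
  obtain ⟨i, hi, e⟩ := Finset.mem_image.1 h
  rw [Finset.mem_range] at hi
  have := ofNat_injOn (by omega) hK e
  omega

lemma resample_entry_usr {a : Fin qU} {b : Fin qI} (hb : b ∈ usrTypes p ω) :
    (resample p ω c ξ).2.2 (a, b) = ω.2.2 (a, b) := by
  simp only [resample]
  rw [Finset.piecewise_eq_of_mem]
  simpa using hb

lemma resample_entry {a : Fin qU} {b : Fin qI} (hb : b ∉ usrTypes p ω) :
    (resample p ω c ξ).2.2 (a, b) = ξ (a, b) := by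
  simp only [resample]
  rw [Finset.piecewise_eq_of_notMem]
  simpa using hb

lemma rate_resample_usr (v : Fin N) {j : ℕ} (hj : j < p.Iusr) :
    (resample p ω c ξ).rate v j = ω.rate v j := by
  rw [Sample.rate, resample_type_usr hj, resample_entry_usr (mem_usrTypes.2 ⟨j, hj, rfl⟩)]
  rfl

lemma rate_resample (v : Fin N) {j : ℕ} (hj : p.Iusr ≤ j) (hK : j < K)
    (h : c (Fin.ofNat K j) ∉ usrTypes p ω) :
    (resample p ω c ξ).rate v j = ξ (ω.1 v, c (Fin.ofNat K j)) := by
  rw [Sample.rate, resample_type hj hK, resample_entry h]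
  rfl

lemma usrTypes_resample : usrTypes p (resample p ω c ξ) = usrTypes p ω := by
  ext b
  simp only [mem_usrTypes]
  exact exists_congr fun j => and_congr_right fun hj => by rw [resample_type_usr hj]

lemma clus_resample : clus p (resample p ω c ξ).rate = clus p ω.rate :=
  clus_congr fun v _ hj => rate_resample_usr v hj

lemma card_usrTypes_le : (usrTypes p ω).card ≤ p.Iusr :=
  Finset.card_image_le.trans (Finset.card_image_le.trans (by simp))

end Window


/-! ### The guaranteed gain outweighs the risk of exhausted candidates -/

section Window

variable {N qU qI K : ℕ} [NeZero K] {p : Params} {ω : Sample N qU qI K}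

/-- It is unlikely that few candidates are liked. -/
lemma avg_exhausted_resample_le [NeZero qI] (hK : p.Iusr + p.Irep ≤ K) (hI : p.Iusr ≤ qI)
    (u : Fin N) (T : ℕ) {n : ℕ} (hn : n ≤ qI) (hn' : n ≤ (candidates p ω.rate u).card) :
    𝔼 c : Fin K → Fin qI, 𝔼 ξ : Fin qU × Fin qI → Bool,
      (if Exhausted p (resample p ω c ξ).rate u T then (1 : ℝ) else 0) ≤
      2 ^ (T - exploreTime p ω.rate) *
        (3 / 4 + (1 - 3 / 4) * Real.exp (-1)) ^ ((n : ℝ) / qI * (qI - p.Iusr)) := by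
  classical
  set m := T - exploreTime p ω.rate with hm
  set I := idx K ((candidates p ω.rate u).image (p.Iusr + ·)) with hI'
  have hq : (0 : ℝ) < qI := by exact_mod_cast Nat.pos_of_ne_zero (NeZero.ne qI)
  have hcand : ∀ k ∈ candidates p ω.rate u, k < p.Irep := fun k hk => by
    rw [candidates, Finset.mem_filter, Finset.mem_range] at hk; exact hk.1
  have hIcard : I.card = (candidates p ω.rate u).card := by
    rw [hI', idx_card, Finset.card_image_of_injective _ (add_right_injective _)]
    intro k hk
    obtain ⟨j, hj, rfl⟩ := Finset.mem_image.1 hk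
    have := hcand j hj
    omega
  have hξ : ∀ c : Fin K → Fin qI, 𝔼 ξ : Fin qU × Fin qI → Bool,
      (if Exhausted p (resample p ω c ξ).rate u T then (1 : ℝ) else 0) ≤
      2 ^ m * (3 / 4) ^ (I.image c ∩ (usrTypes p ω)ᶜ).card := by
    intro c
    set R := I.image c ∩ (usrTypes p ω)ᶜ with hR
    -- One candidate is selected for each new type. The ratings involved then lie in distinct
    -- columns and are independent, whoever the raters are.
    have hex : ∀ b : Fin qI, ∃ k, b ∈ R → k ∈ candidates p ω.rate u ∧
        c (Fin.ofNat K (p.Iusr + k)) = b := by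
      intro b
      by_cases hb : b ∈ R
      · obtain ⟨i, hi, rfl⟩ := Finset.mem_image.1 (Finset.mem_inter.1 hb).1
        obtain ⟨j, hj, rfl⟩ := Finset.mem_image.1 hi
        obtain ⟨k, hk, rfl⟩ := Finset.mem_image.1 hj
        exact ⟨k, fun _ => ⟨hk, rfl⟩⟩
      · exact ⟨0, fun h => absurd h hb⟩
    choose κ hκ using hex
    rw [← avg_pow_liked (fun b => ω.1 (rater p ω.rate u (κ b))) R, Finset.mul_expect]
    refine avg_mono fun ξ => ?_
    set R' := R.filter fun b => ξ (ω.1 (rater p ω.rate u (κ b)), b) = true with hR'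
    have hcl : clus p (resample p ω c ξ).rate = clus p ω.rate := clus_resample
    have hle : R'.card ≤ (likedCandidates p (resample p ω c ξ).rate u).card := by
      refine Finset.card_le_card_of_injOn κ (fun b hb => ?_) fun b hb b' hb' e => ?_
      · obtain ⟨hb1, hb2⟩ := Finset.mem_filter.1 hb
        obtain ⟨h1, h2⟩ := hκ b hb1
        rw [Finset.mem_coe, likedCandidates, Finset.mem_filter, candidates_congr hcl,
          rater_congr_clus hcl]
        refine ⟨h1, ?_⟩
        have := hcand _ h1
        have hb3 := Finset.mem_compl.1 (Finset.mem_inter.1 hb1).2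
        rw [rate_resample _ (by omega) (by omega) (by rw [h2]; exact hb3), h2]
        exact hb2
      · rw [← (hκ b (Finset.mem_filter.1 hb).1).2, ← (hκ b' (Finset.mem_filter.1 hb').1).2, e]
    have h3 := indicator_card_lt_le (likedCandidates p (resample p ω c ξ).rate u).card m
    rw [Real.rpow_natCast] at h3
    simp only [Nat.cast_lt] at h3
    rw [if_congr (show Exhausted p (resample p ω c ξ).rate u T ↔ _ by
      rw [Exhausted, exploreTime_congr hcl]) rfl rfl]
    refine h3.trans ?_
    gcongr 2 ^ m * ?_
    exact pow_le_pow_of_le_one (by norm_num) (by norm_num) hle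
  refine (avg_mono hξ).trans ?_
  rw [← Finset.mul_expect]
  gcongr
  refine (avg_pow_card_image_le_exp (b := 1) (s := n / qI) I _ (by norm_num) (by norm_num)
    (by positivity) (by rw [div_le_one hq]; exact_mod_cast hn) ?_).trans ?_
  · rw [Fintype.card_fin, one_mul, div_mul_cancel₀ _ hq.ne', hIcard]
    exact_mod_cast hn'
  · have he : Real.exp (-1) ≤ 1 := Real.exp_le_one_iff.2 (by norm_num)
    refine Real.rpow_le_rpow_of_exponent_ge (by positivity) (by linarith) ?_
    gcongr
    rw [Finset.card_compl, Fintype.card_fin,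
      Nat.cast_sub ((card_usrTypes_le (p := p) (ω := ω)).trans hI)]
    gcongr
    exact card_usrTypes_le

/-- The probability that two entries of the matrix have a given value. -/
lemma avg_two_entries_ge {ι : Type*} [Fintype ι] [DecidableEq ι] (z z' : ι) (b : Bool) :
    1 / 4 ≤ 𝔼 ξ : ι → Bool, (if ξ z = b ∧ ξ z' = b then (1 : ℝ) else 0) := by
  have h := avg_avoid (α := Bool) {z, z'} {!b}
  have e : ∀ ξ : ι → Bool, (∀ i ∈ ({z, z'} : Finset ι), ξ i ∉ ({!b} : Finset Bool)) ↔
      ξ z = b ∧ ξ z' = b := fun ξ => by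
    simp
  simp_rw [e] at h
  rw [h]
  have h2 : ({z, z'} : Finset ι).card ≤ 2 := Finset.card_le_two
  have h3 := pow_le_pow_of_le_one (by norm_num : (0 : ℝ) ≤ 1 / 2) (by norm_num) h2
  norm_num at h3 ⊢
  exact h3

/-- A lower bound for the gain. -/
noncomputable def firstGain (p : Params) (u : Fin N) (T k f : ℕ) (ω : Sample N qU qI K) : ℝ :=
  if (k ∈ candidates p ω.rate u ∧ (∀ j < k, j ∉ candidates p ω.rate u) ∧
      exploreTime p ω.rate < T) ∧
    ω.2.1 (Fin.ofNat K (p.Iusr + k)) = ω.2.1 (Fin.ofNat K 0) ∧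
    ω.2.1 (Fin.ofNat K f) ∉ usrTypes p ω ∧
    ω.rate (rater p ω.rate u k) f = !(ω.rate u 0) ∧ ω.rate u f = !(ω.rate u 0) then 2 else 0

/-- If `k` has the type of the clustering item `0`, then the sample is decided, and `u` and its
rater agree on `k`. The first candidate is eligible whenever time is left, and if both users rate
`f` the opposite way, the gain is `2`. -/
lemma avg_firstGain_le (hp : p.rU ≤ p.Iusr) (h0 : 0 < p.Iusr) {k f : ℕ} (hk : k < p.Irep)
    (hf : p.Iusr + p.Irep ≤ f) (hfK : f < K) (u : Fin N) (T : ℕ) :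
    𝔼 ω : Sample N qU qI K, firstGain p u T k f ω ≤
      𝔼 ω : Sample N qU qI K, gain p u T k f ω := by
  have key : ∀ ω : Sample N qU qI K,
      ω.2.1 (Fin.ofNat K (p.Iusr + k)) = ω.2.1 (Fin.ofNat K 0) →
      ω.2.1 (Fin.ofNat K (p.Iusr + k)) ∈ usrTypes p ω := fun ω h =>
    mem_usrTypes.2 ⟨0, h0, h.symm⟩
  refine avg_gain_ge hp hk hf hfK u T (fun ω hω => ?_) fun ω => ?_
  · rw [firstGain, if_neg]
    rintro ⟨-, h, -⟩
    exact hω.2.1 (key ω h)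
  · by_cases h : (k ∈ candidates p ω.rate u ∧ (∀ j < k, j ∉ candidates p ω.rate u) ∧
      exploreTime p ω.rate < T) ∧
      ω.2.1 (Fin.ofNat K (p.Iusr + k)) = ω.2.1 (Fin.ofNat K 0) ∧
      ω.2.1 (Fin.ofNat K f) ∉ usrTypes p ω ∧
      ω.rate (rater p ω.rate u k) f = !(ω.rate u 0) ∧ ω.rate u f = !(ω.rate u 0)
    · left
      rw [firstGain, if_pos h]
      obtain ⟨⟨h1, h2, h3⟩, h4, h5, h6, h7⟩ := h
      have hE : Eligible p ω.rate u T k := by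
        refine ⟨h1, ?_⟩
        rw [Finset.filter_eq_empty_iff.2, Finset.card_empty]
        · omega
        · intro j hj hjk
          exact h2 j hjk (Finset.mem_filter.1 hj).1
      have e1 : ω.rate u (p.Iusr + k) = ω.rate u 0 := by simp only [Sample.rate, h4]
      have e2 : ω.rate (rater p ω.rate u k) (p.Iusr + k) = ω.rate u 0 := by
        rw [← e1]
        exact agree_of_mem_usrTypes hp (rater_mem p ω.rate u k) (key ω h4)
      rw [gain, if_pos hE, e1, e2, h6, h7]
      cases ω.rate u 0 <;> norm_num [ind, sgn]
    · right
      rw [firstGain, if_neg h]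

/-- The factors are `1 / qI` for the type of `k`, `1 - Iusr / qI` for a new type of `f`, at least `1
/ 4` for two prescribed entries (which coincide if both users have the same type), and the value
`2`. -/
lemma avg_firstGain_resample_ge [NeZero qI] (h0 : 0 < p.Iusr) {k f : ℕ} (hk : k < p.Irep)
    (hf : p.Iusr + p.Irep ≤ f) (hfK : f < K) (u : Fin N) (T : ℕ)
    (h : k ∈ candidates p ω.rate u ∧ (∀ j < k, j ∉ candidates p ω.rate u) ∧
      exploreTime p ω.rate < T) :
    (1 - (p.Iusr : ℝ) / qI) / (2 * qI) ≤
      𝔼 c : Fin K → Fin qI, 𝔼 ξ : Fin qU × Fin qI → Bool,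
        firstGain p u T k f (resample p ω c ξ) := by
  classical
  have hq : (0 : ℝ) < qI := by exact_mod_cast Nat.pos_of_ne_zero (NeZero.ne qI)
  set b₀ := ω.2.1 (Fin.ofNat K 0) with hb₀
  set i := Fin.ofNat K (p.Iusr + k) with hi
  set i' := Fin.ofNat K f with hi'
  have hne : i' ≠ i := fun e => by
    have := ofNat_injOn (by omega) (by omega) e
    omega
  have h1 : ∀ c : Fin K → Fin qI,
      (if c i ∈ ({b₀} : Finset (Fin qI)) then (1 : ℝ) else 0) *
        ((if c i' ∈ (usrTypes p ω)ᶜ then (1 : ℝ) else 0) * (1 / 2)) ≤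
      𝔼 ξ : Fin qU × Fin qI → Bool, firstGain p u T k f (resample p ω c ξ) := by
    intro c
    by_cases hc : c i = b₀ ∧ c i' ∉ usrTypes p ω
    · have h2 := avg_two_entries_ge (ω.1 (rater p ω.rate u k), c i') (ω.1 u, c i')
        (!(ω.rate u 0))
      have e : ∀ ξ : Fin qU × Fin qI → Bool, firstGain p u T k f (resample p ω c ξ) =
          2 * (if ξ (ω.1 (rater p ω.rate u k), c i') = (!(ω.rate u 0)) ∧
            ξ (ω.1 u, c i') = (!(ω.rate u 0)) then (1 : ℝ) else 0) := by
        intro ξ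
        have hcl : clus p (resample p ω c ξ).rate = clus p ω.rate := clus_resample
        rw [firstGain, candidates_congr hcl, exploreTime_congr hcl, rater_congr_clus hcl,
          usrTypes_resample, resample_type (by omega) (by omega), resample_type_usr h0,
          resample_type (by omega) hfK, rate_resample _ (by omega) hfK hc.2,
          rate_resample _ (by omega) hfK hc.2, rate_resample_usr _ h0]
        rw [if_congr (and_iff_right h) rfl rfl, if_congr (and_iff_right hc.1) rfl rfl,
          if_congr (and_iff_right hc.2) rfl rfl]
        split_ifs <;> norm_num
      simp_rw [e]
      rw [← Finset.mul_expect, if_pos (by simp [hc.1]), if_pos (by simp [hc.2])]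
      linarith
    · refine le_trans (le_of_eq ?_) (avg_nonneg fun ξ => ?_)
      · rw [not_and_or, not_not] at hc
        rcases hc with hc | hc <;> simp [hc]
      · rw [firstGain]; split_ifs <;> norm_num
  refine le_trans ?_ (avg_mono h1)
  rw [avg_piecewise {i}]
  have h2 : ∀ x y : Fin K → Fin qI, ({i} : Finset (Fin K)).piecewise x y i = x i := fun x y =>
    Finset.piecewise_eq_of_mem _ _ _ (Finset.mem_singleton_self i)
  have h3 : ∀ x y : Fin K → Fin qI, ({i} : Finset (Fin K)).piecewise x y i' = y i' := fun x y =>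
    Finset.piecewise_eq_of_notMem _ _ _ (by simpa using hne)
  simp_rw [h2, h3, ← Finset.mul_expect, ← Finset.expect_mul]
  rw [avg_coord i' (fun b => if b ∈ (usrTypes p ω)ᶜ then (1 : ℝ) else 0),
    avg_coord i (fun b => if b ∈ ({b₀} : Finset (Fin qI)) then (1 : ℝ) else 0),
    avg_indicator, avg_indicator, Finset.card_singleton, Finset.card_compl, Fintype.card_fin,
    Nat.cast_sub (by simpa using Finset.card_le_univ (usrTypes p ω))]
  have h4 : ((usrTypes p ω).card : ℝ) ≤ p.Iusr := by exact_mod_cast card_usrTypes_le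
  calc (1 - (p.Iusr : ℝ) / qI) / (2 * qI) = 1 / qI * ((qI - p.Iusr) / qI * (1 / 2)) := by
        field_simp
    _ ≤ _ := by
        push_cast
        gcongr

/-- If only representatives are exploited, then this is at least as good as exploration. -/
lemma regret_le_half_of_window [NeZero N] [NeZero qU] [NeZero qI] (p : Params) {draw : ℕ → ℕ}
    (hd : Function.Injective draw) {T n : ℕ} [NeZero (drawBound N p T)] (hT : 1 ≤ T)
    (hp : p.rU ≤ p.Iusr) (h0 : 0 < p.Iusr) (hI : p.Iusr ≤ qI) (hn : n ≤ qI)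
    (hn' : n + (T - p.Iusr) ≤ p.Irep)
    (hnum : ((T - p.Iusr : ℕ) : ℝ) * (2 ^ (T - p.Iusr) *
      (3 / 4 + (1 - 3 / 4) * Real.exp (-1)) ^ ((n : ℝ) / qI * (qI - p.Iusr))) ≤
      (1 - (p.Iusr : ℝ) / qI) / (8 * qI)) :
    regret qU qI (policy (N := N) p draw) T ≤ (T : ℝ) / 2 := by
  have hN : 1 ≤ T * N := Nat.mul_pos hT (Nat.pos_of_ne_zero (NeZero.ne N))
  set K := drawBound N p T with hK
  -- A fixed draw after all three sets of items; it serves only for comparison.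
  set f := p.Iusr + p.Irep + p.Iexp with hf
  have hfK : f < K := by rw [hK, drawBound]; omega
  have hexh : ∀ u, 𝔼 ω : Sample N qU qI K, ((T - exploreTime p ω.rate : ℕ) : ℝ) *
      (if Exhausted p ω.rate u T then 1 else 0) ≤
      (𝔼 ω : Sample N qU qI K, ∑ k ∈ Finset.range p.Irep, firstGain p u T k f ω) / 4 := by
    intro u
    rw [Finset.expect_div, avg_resample p, avg_resample p (fun ω => _ / _)]
    refine avg_mono fun ω => ?_
    have hfg : ∀ k (ω : Sample N qU qI K), 0 ≤ firstGain p u T k f ω := fun k ω => by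
      rw [firstGain]; split_ifs <;> norm_num
    have hm : ∀ c ξ, exploreTime p (resample p ω c ξ).rate = exploreTime p ω.rate := fun c ξ =>
      exploreTime_congr clus_resample
    simp_rw [hm, ← Finset.mul_expect]
    by_cases hlt : exploreTime p ω.rate < T
    · have hc := card_candidates p ω.rate u
      have hc' : n < (candidates p ω.rate u).card := by
        rw [exploreTime] at hlt; omega
      have hne : (candidates p ω.rate u).Nonempty := Finset.card_pos.1 (by omega)
      -- Given the clusters, the first candidate is determined, and its share of the gain alone pays
      -- for exhaustion.
      set k := (candidates p ω.rate u).min' hne with hk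
      have hkm : k ∈ candidates p ω.rate u := Finset.min'_mem _ _
      have hkr : k ∈ Finset.range p.Irep := (Finset.mem_filter.1 hkm).1
      have h1 := avg_firstGain_resample_ge (K := K) (ω := ω) h0 (Finset.mem_range.1 hkr)
        (Nat.le_add_right _ _) hfK u T
        ⟨hkm, fun j hj hjm => absurd (Finset.min'_le _ _ hjm) (not_le.2 hj), hlt⟩
      have h2 := avg_exhausted_resample_le (K := K) (p := p) (ω := ω)
        (by omega) hI u T hn hc'.le
      have h3 : T - exploreTime p ω.rate ≤ T - p.Iusr := by rw [exploreTime]; omega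
      have h4 : (0 : ℝ) ≤ (3 / 4 + (1 - 3 / 4) * Real.exp (-1)) ^
          ((n : ℝ) / qI * (qI - p.Iusr)) := by positivity
      calc _ ≤ ((T - p.Iusr : ℕ) : ℝ) * (2 ^ (T - p.Iusr) *
            (3 / 4 + (1 - 3 / 4) * Real.exp (-1)) ^ ((n : ℝ) / qI * (qI - p.Iusr))) := by
            gcongr
            refine h2.trans ?_
            gcongr
            norm_num
        _ ≤ (1 - (p.Iusr : ℝ) / qI) / (8 * qI) := hnum
        _ = (1 - (p.Iusr : ℝ) / qI) / (2 * qI) / 4 := by rw [div_div]; ring_nf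
        _ ≤ (𝔼 c : Fin K → Fin qI, 𝔼 ξ : Fin qU × Fin qI → Bool,
              firstGain p u T k f (resample p ω c ξ)) / 4 := by gcongr
        _ ≤ _ := by
            simp_rw [Finset.expect_div]
            refine avg_mono fun c => avg_mono fun ξ => ?_
            gcongr
            exact Finset.single_le_sum (f := fun k => firstGain p u T k f (resample p ω c ξ))
              (fun k _ => hfg k _) hkr
    · rw [Nat.sub_eq_zero_of_le (not_lt.1 hlt), Nat.cast_zero, zero_mul]
      exact avg_nonneg fun c => avg_nonneg fun ξ =>
        div_nonneg (Finset.sum_nonneg fun k _ => hfg k _) (by norm_num)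
  have hmiss : ∀ σ u, 𝔼 ω : Sample N qU qI K, ((misses p σ ω.rate u T).card : ℝ) ≤
      (𝔼 ω : Sample N qU qI K, ((T - exploreTime p ω.rate : ℕ) : ℝ)) / 2 := by
    intro σ u
    refine (avg_mono fun ω => misses_card_le_sum_eligible p σ u T f ω).trans ?_
    rw [Finset.expect_sub_distrib, Finset.expect_add_distrib, ← Finset.expect_div,
      ← Finset.expect_div, Finset.expect_sum_comm]
    simp_rw [mul_sub, mul_one]
    rw [Finset.expect_sub_distrib, avg_mul_sgn_eq_zero]
    have h1 := hexh u
    rw [Finset.expect_sum_comm] at h1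
    have h2 : ∑ k ∈ Finset.range p.Irep, (𝔼 ω : Sample N qU qI K, firstGain p u T k f ω) / 2 ≤
        ∑ k ∈ Finset.range p.Irep, 𝔼 ω : Sample N qU qI K,
          (if Eligible p ω.rate u T k then (1 : ℝ) else 0) *
          ind (ω.rate (rater p ω.rate u k) (p.Iusr + k)) *
          (sgn (ω.rate u (p.Iusr + k)) - sgn (ω.rate u f)) := by
      refine Finset.sum_le_sum fun k hk => ?_
      rw [avg_selected_eq p u T (Finset.mem_range.1 hk) (Nat.le_add_right _ _) hfK]
      exact div_le_div_of_nonneg_right (avg_firstGain_le hp h0 (Finset.mem_range.1 hk)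
        (Nat.le_add_right _ _) hfK u T) (by norm_num)
    rw [← Finset.sum_div] at h2
    simp_rw [mul_sub] at h2
    linarith
  refine (regret_le_of_misses p hd T le_rfl hmiss).trans (le_of_eq ?_)
  rw [Finset.expect_div, ← Finset.expect_add_distrib]
  have e : ∀ ω : Sample N qU qI K, ((min (exploreTime p ω.rate) T : ℕ) : ℝ) / 2 +
      ((T - exploreTime p ω.rate : ℕ) : ℝ) / 2 = (T : ℝ) / 2 := fun ω => by
    rw [← add_div, ← Nat.cast_add]
    congr 2
    omega
  simp_rw [e]
  exact Fintype.expect_const _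

end Window


/-! ### Numerical consequences of the assumptions -/

section Numerics

lemma two_div_exp_le : 2 / Real.exp 1 ≤ Real.exp (-(1 / 4)) := by
  have h := Real.quadratic_le_exp_of_nonneg (x := 3 / 4) (by norm_num)
  rw [div_le_iff₀ (Real.exp_pos _), ← Real.exp_add]
  norm_num at h ⊢
  linarith

lemma mul_two_div_exp_pow_le (T : ℕ) : (T : ℝ) * (2 / Real.exp 1) ^ T ≤ 4 := by
  have h1 : (2 / Real.exp 1) ^ T ≤ Real.exp (-(T / 4)) := by
    refine (pow_le_pow_left₀ (by positivity) two_div_exp_le T).trans (le_of_eq ?_)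
    rw [← Real.exp_nat_mul]
    congr 1
    ring
  have h2 := Real.add_one_le_exp ((T : ℝ) / 4)
  have h3 : Real.exp (-(T / 4)) * Real.exp (T / 4) = 1 := by rw [← Real.exp_add]; simp
  have h4 := Real.exp_pos (-((T : ℝ) / 4))
  nlinarith [mul_le_mul_of_nonneg_left h1 (Nat.cast_nonneg T : (0 : ℝ) ≤ T),
    mul_le_mul_of_nonneg_left h2 h4.le]

lemma sq_le_two_pow {x : ℝ} (hx : 0 < x) {k : ℕ} (h : 2 * Real.logb 2 x ≤ k) : x ^ 2 ≤ 2 ^ k := by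
  have h1 : Real.logb 2 (x ^ 2) ≤ k := by rwa [Real.logb_pow]
  rw [Real.logb_le_iff_le_rpow (by norm_num) (by positivity)] at h1
  rwa [Real.rpow_natCast] at h1

/-- The factor `2` in front of the logarithms in `rU` and `rI` is enough because `coinBase ^ 2 ≤ 1 /
2`. -/
lemma mul_coinBase_pow_le {x : ℝ} (hx : 0 < x) {k : ℕ} (h : 2 * Real.logb 2 x ≤ k) :
    x * coinBase ^ k ≤ 1 := by
  have h1 := sq_le_two_pow hx h
  have h2 : coinBase ^ 2 ≤ 1 / 2 := by nlinarith [coinBase_le, coinBase_pos]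
  have h3 := pow_le_pow_left₀ (by positivity) h2 k
  have h4 : (x * coinBase ^ k) ^ 2 ≤ 1 := by
    calc (x * coinBase ^ k) ^ 2 = x ^ 2 * (coinBase ^ 2) ^ k := by rw [mul_pow]; ring
      _ ≤ 2 ^ k * (1 / 2) ^ k := by gcongr
      _ = 1 := by rw [← mul_pow]; norm_num
  have := coinBase_pos
  exact le_of_sq_le_sq (by simpa using h4) one_pos.le

/-- The binary logarithm lies below its tangents. -/
lemma logb_le_tangent {x : ℝ} (k : ℕ) (hx : 2 ^ k ≤ x) :
    Real.logb 2 x ≤ k + 1.443 * (x / 2 ^ k - 1) := by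
  have hk : (0 : ℝ) < 2 ^ k := by positivity
  have hx0 : 0 < x := hk.trans_le hx
  have h1 : Real.log (x / 2 ^ k) ≤ x / 2 ^ k - 1 := Real.log_le_sub_one_of_pos (by positivity)
  have h0 : 0 ≤ x / 2 ^ k - 1 := by rw [sub_nonneg, one_le_div hk]; exact hx
  have h3 := Real.log_two_gt_d9
  have hl : 0 < Real.log 2 := by linarith
  rw [Real.log_div hx0.ne' hk.ne', Real.log_pow] at h1
  rw [Real.logb, div_le_iff₀ hl]
  nlinarith

/-- The assumptions on the size of the system. -/
structure Admissible (N qU qI : ℕ) : Prop where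
  lt_N : 100 < N
  qU_lt : 20 * (qU : ℝ) * Real.logb 2 qU ^ 2 < N
  le_qU : 100 * Real.logb 2 N ≤ qU
  le_qI : 100 * Real.logb 2 N ≤ qI

lemma le_logb_of_two_pow_le {x : ℝ} (k : ℕ) (h : 2 ^ k ≤ x) : (k : ℝ) ≤ Real.logb 2 x := by
  have : (0 : ℝ) < 2 ^ k := by positivity
  rw [Real.le_logb_iff_rpow_le (by norm_num) (by linarith), Real.rpow_natCast]
  exact h

namespace Admissible

variable {N qU qI : ℕ}

/-- The assumptions reinforce each other: a bound for `log N` bounds `qU`, hence `log qU`, hence `N`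
by the quadratic condition, hence again `log N`. A few rounds starting from `N > 100` give these
values. -/
lemma size (h : Admissible N qU qI) : (22 : ℝ) ≤ Real.logb 2 N ∧ (2200 : ℝ) ≤ qU ∧
    (11 : ℝ) ≤ Real.logb 2 qU ∧ 2420 * (qU : ℝ) ≤ N := by
  have h0 : (100 : ℝ) < N := by exact_mod_cast h.lt_N
  have h2 := h.le_qU
  have h3 := h.qU_lt
  have n1 : ((6 : ℕ) : ℝ) ≤ Real.logb 2 N := le_logb_of_two_pow_le 6 (by linarith)
  have a1 : ((9 : ℕ) : ℝ) ≤ Real.logb 2 qU := le_logb_of_two_pow_le 9 (by push_cast at *; linarith)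
  push_cast at n1 a1
  have n2 : ((19 : ℕ) : ℝ) ≤ Real.logb 2 N := le_logb_of_two_pow_le 19 (by nlinarith)
  push_cast at n2
  have a2 : ((10 : ℕ) : ℝ) ≤ Real.logb 2 qU := le_logb_of_two_pow_le 10 (by linarith)
  push_cast at a2
  have n3 : ((21 : ℕ) : ℝ) ≤ Real.logb 2 N := le_logb_of_two_pow_le 21 (by nlinarith)
  push_cast at n3
  have a3 : ((11 : ℕ) : ℝ) ≤ Real.logb 2 qU := le_logb_of_two_pow_le 11 (by linarith)
  push_cast at a3
  have n4 : ((22 : ℕ) : ℝ) ≤ Real.logb 2 N := le_logb_of_two_pow_le 22 (by nlinarith)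
  push_cast at n4
  have a4 : (121 : ℝ) ≤ Real.logb 2 qU ^ 2 := by nlinarith
  exact ⟨n4, by linarith, a3, by nlinarith⟩

lemma qI_ge (h : Admissible N qU qI) : (2200 : ℝ) ≤ qI := by
  linarith [h.size.1, h.le_qI]

lemma logb_qU_le (h : Admissible N qU qI) : Real.logb 2 qU + 11 ≤ Real.logb 2 N := by
  obtain ⟨h1, h2, h3, h4⟩ := h.size
  have e : Real.logb 2 ((2 : ℝ) ^ 11 * qU) = 11 + Real.logb 2 qU := by
    rw [Real.logb_mul (by norm_num) (by linarith), Real.logb_pow, Real.logb_self_eq_one (by norm_num)]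
    norm_num
  have := Real.logb_le_logb_of_le (b := 2) (by norm_num) (x := (2 : ℝ) ^ 11 * qU) (y := N)
    (by positivity) (by linarith)
  linarith

lemma logb_mul_sq (h : Admissible N qU qI) :
    Real.logb 2 (N * (qU : ℝ) ^ 2) = Real.logb 2 N + 2 * Real.logb 2 qU := by
  obtain ⟨h1, h2, h3, h4⟩ := h.size
  rw [Real.logb_mul (by linarith) (by positivity), Real.logb_pow]
  norm_num

lemma rU_bounds (h : Admissible N qU qI) :
    2 * (Real.logb 2 N + 2 * Real.logb 2 qU) ≤ rU N qU ∧
    (rU N qU : ℝ) ≤ 2 * (Real.logb 2 N + 2 * Real.logb 2 qU) + 1 := by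
  obtain ⟨h1, h2, h3, h4⟩ := h.size
  rw [rU, h.logb_mul_sq]
  exact ⟨Nat.le_ceil _, (Nat.ceil_lt_add_one (by linarith)).le⟩

lemma rU_ge (h : Admissible N qU qI) : (88 : ℝ) ≤ rU N qU := by
  linarith [h.size.1, h.size.2.2.1, h.rU_bounds.1]

lemma rU_le (h : Admissible N qU qI) : (rU N qU : ℝ) ≤ 6 * Real.logb 2 N - 43 := by
  linarith [h.logb_qU_le, h.rU_bounds.2]

lemma rU_le_qI (h : Admissible N qU qI) : (rU N qU : ℝ) ≤ 0.06 * qI := by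
  linarith [h.rU_le, h.le_qI]

/-- A user type has many more members than there are clustering items. With `M = N / qU`, `rU` is
bounded through `log M` and `log qU`; the latter is `O(√M)` by the quadratic condition and the
former by a tangent of the logarithm at `√M = 32`. -/
lemma rU_mul_qU_le (h : Admissible N qU qI) : 20 * (rU N qU : ℝ) * qU ≤ N := by
  obtain ⟨h1, h2, h3, h4⟩ := h.size
  have hU : (0 : ℝ) < qU := by linarith
  set M : ℝ := N / qU with hM
  have hMN : (N : ℝ) = M * qU := by rw [hM, div_mul_cancel₀ _ hU.ne']
  have hM1 : 2420 ≤ M := by rw [hM, le_div_iff₀ hU]; exact h4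
  have hM2 : 20 * Real.logb 2 qU ^ 2 ≤ M := by
    rw [hM, le_div_iff₀ hU]; linarith [h.qU_lt]
  set m := √M with hm
  have hmm : m ^ 2 = M := Real.sq_sqrt (by linarith)
  have hm1 : 49 ≤ m := Real.le_sqrt_of_sq_le (by linarith)
  have h5 := logb_le_tangent 5 (x := m) (by linarith)
  have h6 : Real.logb 2 N = 2 * Real.logb 2 m + Real.logb 2 qU := by
    rw [hMN, ← hmm, Real.logb_mul (by positivity) hU.ne', Real.logb_pow]
    norm_num
  have h7 : Real.logb 2 qU ≤ 0.2237 * m := by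
    refine le_of_sq_le_sq ?_ (by positivity)
    nlinarith
  have h8 := h.rU_bounds.2
  have h9 : 20 * (rU N qU : ℝ) ≤ M := by
    rw [h6] at h8
    norm_num at h5
    nlinarith
  rw [hMN]
  gcongr

lemma not_pure_le (h : Admissible N qU qI) : (qU : ℝ) ^ 2 * coinBase ^ rU N qU ≤ 1 / N := by
  obtain ⟨h1, h2, h3, h4⟩ := h.size
  have hN : (0 : ℝ) < N := by linarith
  have := mul_coinBase_pow_le (x := N * (qU : ℝ) ^ 2) (k := rU N qU) (by positivity)
    (by rw [h.logb_mul_sq]; exact h.rU_bounds.1)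
  rw [le_div_iff₀ hN]
  linarith

lemma mul_le_two_pow (h : Admissible N qU qI) : ((N : ℝ) * qU ^ 2) ^ 2 ≤ 2 ^ rU N qU := by
  obtain ⟨h1, h2, h3, h4⟩ := h.size
  have hN : (0 : ℝ) < N := by linarith
  exact sq_le_two_pow (by positivity) (by rw [h.logb_mul_sq]; exact h.rU_bounds.1)

/-- The exponent `N / (8 * qU)` dominates `rU`, so the exponential beats the power `(N * qU ^ 2) ^
2` that `rU` was chosen to beat. -/
lemma not_largeTypes_le (h : Admissible N qU qI) :
    (qU : ℝ) * (2 / Real.exp 1) ^ ((N : ℝ) / (2 * qU)) ≤ 1 / N := by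
  obtain ⟨h1, h2, h3, h4⟩ := h.size
  have hN : (0 : ℝ) < N := by linarith
  have hU : (0 : ℝ) < qU := by linarith
  have e1 : (2 / Real.exp 1) ^ ((N : ℝ) / (2 * qU)) ≤ Real.exp (-(N / (8 * qU))) := by
    refine (Real.rpow_le_rpow (by positivity) two_div_exp_le (by positivity)).trans (le_of_eq ?_)
    rw [← Real.exp_mul]
    congr 1
    field_simp
    norm_num
  have e2 : (rU N qU : ℝ) ≤ N / (8 * qU) := by
    rw [le_div_iff₀ (by positivity)]
    nlinarith [h.rU_mul_qU_le, h.rU_ge]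
  have e3 : (N * (qU : ℝ) ^ 2) ^ 2 ≤ Real.exp (N / (8 * qU)) := by
    refine h.mul_le_two_pow.trans (le_trans ?_ (Real.exp_le_exp.2 e2))
    rw [← mul_one ((rU N qU : ℕ) : ℝ), Real.exp_nat_mul]
    exact pow_le_pow_left₀ (by norm_num) (by linarith [Real.exp_one_gt_d9]) _
  have e4 : (N : ℝ) * qU ≤ (N * (qU : ℝ) ^ 2) ^ 2 := by
    have : (N : ℝ) * qU ≤ N * (qU : ℝ) ^ 2 := by
      gcongr
      exact le_self_pow₀ (by linarith) (by norm_num)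
    have h' : (1 : ℝ) ≤ N * (qU : ℝ) ^ 2 := by nlinarith
    nlinarith
  rw [le_div_iff₀ hN]
  calc (qU : ℝ) * (2 / Real.exp 1) ^ ((N : ℝ) / (2 * qU)) * N
      ≤ qU * Real.exp (-(N / (8 * qU))) * N := by gcongr
    _ = (N * qU) * Real.exp (-(N / (8 * qU))) := by ring
    _ ≤ Real.exp (N / (8 * qU)) * Real.exp (-(N / (8 * qU))) := by
        gcongr
        exact e4.trans e3
    _ = 1 := by rw [← Real.exp_add]; simp

lemma logb_mul_ge (h : Admissible N qU qI) : 33 ≤ Real.logb 2 (N * qI) := by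
  obtain ⟨h1, h2, h3, h4⟩ := h.size
  rw [Real.logb_mul (by linarith) (by linarith [h.qI_ge])]
  have : ((11 : ℕ) : ℝ) ≤ Real.logb 2 qI := le_logb_of_two_pow_le 11 (by linarith [h.qI_ge])
  push_cast at this
  linarith

lemma rI_bounds (h : Admissible N qU qI) :
    2 * Real.logb 2 (N * qI) ≤ rI N qI ∧ (rI N qI : ℝ) ≤ 2 * Real.logb 2 (N * qI) + 1 := by
  rw [rI]
  exact ⟨Nat.le_ceil _, (Nat.ceil_lt_add_one (by linarith [h.logb_mul_ge])).le⟩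

lemma rI_ge (h : Admissible N qU qI) : (66 : ℝ) ≤ rI N qI := by
  linarith [h.rI_bounds.1, h.logb_mul_ge]

lemma coinBase_pow_rI_le (h : Admissible N qU qI) : coinBase ^ rI N qI ≤ 1 / (N * qI) := by
  have hN : (0 : ℝ) < N := by linarith [h.size.2.1, h.size.2.2.2]
  have hI : (0 : ℝ) < qI := by linarith [h.qI_ge]
  rw [le_div_iff₀ (by positivity), mul_comm]
  exact mul_coinBase_pow_le (by positivity) h.rI_bounds.1

end Admissible

end Numerics


/-! ### The regret with clustering of the users -/

section Clustered

variable {N qU qI : ℕ}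

lemma Admissible.cast_pos (h : Admissible N qU qI) :
    (0 : ℝ) < N ∧ (0 : ℝ) < qU ∧ (0 : ℝ) < qI := by
  have := h.size
  exact ⟨by linarith, by linarith, by linarith [h.qI_ge]⟩

lemma Admissible.two_rpow_neg_le (h : Admissible N qU qI) {x : ℝ} (hx : Real.logb 2 N ≤ x) :
    (2 : ℝ) ^ (-x) ≤ 1 / N := by
  have hN := h.cast_pos.1
  rw [Real.logb_le_iff_le_rpow (by norm_num) hN] at hx
  rw [Real.rpow_neg (by norm_num), one_div]
  exact inv_anti₀ hN hx

/-- The regret if the users are clustered, in terms of the duration of the exploration. -/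
lemma Admissible.regret_clustered_le [NeZero N] [NeZero qU] [NeZero qI] (h : Admissible N qU qI)
    {p : Params} {draw : ℕ → ℕ} (hd : Function.Injective draw) {T : ℕ} [NeZero (drawBound N p T)]
    (hIusr : p.Iusr = rU N qU) {tmin : ℕ} {tmax e W : ℝ}
    (hmin : ∀ ω : Sample N qU qI (drawBound N p T), tmin ≤ exploreTime p ω.rate)
    (hmax : ∀ ω : Sample N qU qI (drawBound N p T), LargeTypes ω.1 →
      (exploreTime p ω.rate : ℝ) ≤ tmax) (ht0 : 0 ≤ tmax)
    (he : ∀ (σ : Equiv.Perm (Fin N)) u, 𝔼 ω : Sample N qU qI (drawBound N p T),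
      (open Classical in if PureClusters p ω.rate ∧ (pool p σ ω.rate u).card < T then (1 : ℝ)
        else 0) ≤ e)
    (hW : ∀ (σ : Equiv.Perm (Fin N)) u, 𝔼 ω : Sample N qU qI (drawBound N p T),
      ((confused p σ ω.rate u).card : ℝ) ≤ W) :
    regret qU qI (policy (N := N) p draw) T ≤
        tmax / 2 + T / N / 2 + ((T - tmin : ℕ) : ℝ) * (1 / N + e) + W ∧
      (tmax ≤ T → regret qU qI (policy (N := N) p draw) T ≤
        tmax / 2 + (T - tmax) / N / 2 + ((T - tmin : ℕ) : ℝ) * (1 / N + e) + W) := by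
  classical
  have h1 := avg_not_pure_le (N := N) (qU := qU) (qI := qI) (K := drawBound N p T) p
    (by rw [drawBound]; omega) (by
      rw [hIusr]
      have := h.rU_le_qI
      have : (rU N qU : ℝ) ≤ qI := by linarith [h.cast_pos.2.2]
      exact_mod_cast this)
  rw [hIusr] at h1
  have h2 := fun σ u => (avg_misses_le p σ u hmin (h1.trans h.not_pure_le) (he σ u) (hW σ u)).1
  have h3 := avg_min_le (K := drawBound N p T) p T ht0 hmax
    (avg_not_largeTypes_le.trans h.not_largeTypes_le)
  constructor
  · refine (regret_le_of_misses p hd T h3.1 h2).trans (le_of_eq ?_)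
    ring
  · intro ht
    refine (regret_le_of_misses p hd T (h3.2 ht) h2).trans (le_of_eq ?_)
    ring

/-- Without item clustering, the regret is at most the one of exploration, and `RU` up to a
factor. -/
lemma Admissible.regret_noItemClust_le [NeZero N] [NeZero qU] [NeZero qI]
    (h : Admissible N qU qI) {draw : ℕ → ℕ} (hd : Function.Injective draw) {T : ℕ} (hT : 1 ≤ T) :
    regret qU qI (policy (N := N) (paramsNoItemClust N qU qI T) draw) T ≤ T / 2 ∧
      regret qU qI (policy (N := N) (paramsNoItemClust N qU qI T) draw) T ≤
        10 * RU N qU T := by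
  obtain ⟨hN, hU, hI⟩ := h.cast_pos
  set p := paramsNoItemClust N qU qI T with hp
  have hIusr : p.Iusr = rU N qU := rfl
  have hIrep : p.Irep = 6 * T := rfl
  have hIexp : p.Iexp = 0 := rfl
  have hpU : p.rU ≤ p.Iusr := le_rfl
  set r := rU N qU with hr
  have hr88 := h.rU_ge
  have hrN := h.rU_mul_qU_le
  rw [← hr] at hr88 hrN
  have : NeZero (drawBound N p T) := ⟨by rw [drawBound]; omega⟩
  set K := drawBound N p T with hK
  have hT1 : (1 : ℝ) ≤ T := by exact_mod_cast hT
  have hex : ∀ ω : Sample N qU qI K, exploreTime p ω.rate = r + prefsTime p ω.rate := fun ω => by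
    rw [exploreTime, itemClusteringTime_of_exp_eq_zero p hIexp, hIusr, add_zero]
  have hmin : ∀ ω : Sample N qU qI K, r + 1 ≤ exploreTime p ω.rate := fun ω => by
    rw [hex]
    have := one_le_prefsTime p ω.rate (by omega)
    omega
  have hRU : RU N qU T = r + qU / N * T := rfl
  have hRUr : (r : ℝ) ≤ RU N qU T := by rw [hRU]; linarith [show (0 : ℝ) ≤ qU / N * T by positivity]
  -- The exploration takes at least `r + 1` steps.
  rcases le_or_gt T (r + 1) with hTr | hTr
  · have := regret_le_half_of_le (qU := qU) (qI := qI) p hd T fun ω => hTr.trans (hmin ω)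
    have hTr' : (T : ℝ) ≤ r + 1 := by exact_mod_cast hTr
    exact ⟨this, by linarith⟩
  have hTr' : (r : ℝ) + 2 ≤ T := by exact_mod_cast hTr
  have he : ∀ (σ : Equiv.Perm (Fin N)) u, 𝔼 ω : Sample N qU qI K,
      (open Classical in if PureClusters p ω.rate ∧ (pool p σ ω.rate u).card < T then (1 : ℝ)
        else 0) ≤ 1 / N + (2 / Real.exp 1) ^ T := fun σ u => by
    refine (avg_short_pool_rep_le p σ u T (by rw [hK, drawBound]; omega) hIrep).trans ?_
    gcongr
    exact h.two_rpow_neg_le (by linarith [h.le_qI, h.size.1])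
  have hW : ∀ (σ : Equiv.Perm (Fin N)) u, 𝔼 ω : Sample N qU qI K,
      ((confused p σ ω.rate u).card : ℝ) ≤ 0 := fun σ u => by
    refine avg_le_const fun ω => ?_
    have : confused p σ ω.rate u = ∅ := by
      rw [Finset.eq_empty_iff_forall_notMem]
      intro k hk
      simp [confused, expDraws, hIexp] at hk
    simp [this]
  set ε : ℝ := (2 / Real.exp 1) ^ T with hε
  have hε0 : 0 ≤ ε := by positivity
  have hTε : T * ε ≤ 4 := mul_two_div_exp_pow_le T
  have hε1 : ε ≤ 0.05 := by nlinarith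
  have hMN : 2420 * (2200 : ℝ) ≤ N := by linarith [h.size.2.1, h.size.2.2.2]
  have hN1 : 1 / (N : ℝ) ≤ 0.0001 := by
    rw [div_le_iff₀ hN]; linarith
  have hN0 : 0 < 1 / (N : ℝ) := by positivity
  have hsub : ((T - (r + 1) : ℕ) : ℝ) = T - (r + 1) := by
    rw [Nat.cast_sub hTr.le]; push_cast; rfl
  set y : ℝ := qU / N * T with hy
  have hy0 : 0 ≤ y := by positivity
  have hTN : (T : ℝ) / N ≤ y := by
    rw [hy, div_mul_eq_mul_div, div_le_div_iff_of_pos_right hN]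
    nlinarith [h.size.2.1]
  have hyT : y ≤ T / 2420 := by
    rw [hy, div_mul_eq_mul_div, div_le_iff₀ hN]
    nlinarith [h.size.2.2.2]
  have hDe : ((T - (r + 1) : ℕ) : ℝ) * (1 / N + (1 / N + ε)) ≤ 2 * (T / N) + 4 := by
    rw [hsub]
    have : ((T : ℝ) - (r + 1)) * (1 / N + (1 / N + ε)) ≤ T * (1 / N + (1 / N + ε)) := by
      gcongr
      linarith
    refine this.trans ?_
    rw [show (T : ℝ) * (1 / N + (1 / N + ε)) = 2 * (T / N) + T * ε by ring]
    linarith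
  -- Either large clusters find the preferences in a single step, so that exploration takes exactly
  -- `r + 1` steps, or `T` exceeds `5 / 3 * r` and the exploration time `0.62 * T` leaves room for
  -- all errors.
  rcases le_or_gt (12 * (T : ℝ) * qU) N with hc | hc
  · have h1 := (h.regret_clustered_le hd hIusr hmin (tmax := r + 1) (fun ω hω => by
      have := prefsTime_le_one hpU hω (by rw [hIrep]; push_cast; linarith)
      rw [hex]
      exact_mod_cast Nat.add_le_add_left this r) (by positivity) he hW).2 (by linarith)
    constructor
    · refine h1.trans ?_
      rw [hsub]
      have : (0 : ℝ) ≤ T - (r + 1) := by linarith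
      rw [show ((T : ℝ) - (r + 1)) / N / 2 = (T - (r + 1)) * (1 / N / 2) by ring]
      nlinarith
    · refine h1.trans ?_
      have : ((T : ℝ) - (r + 1)) / N / 2 ≤ T / N := by
        rw [div_div, div_le_div_iff₀ (by positivity) hN]; nlinarith
      rw [hRU]
      linarith
  · have hmax : ∀ ω : Sample N qU qI K, LargeTypes ω.1 →
        (exploreTime p ω.rate : ℝ) ≤ r + 12 * y + 1 := fun ω hω => by
      have := prefsTime_le hpU hω
      rw [hIrep] at this
      push_cast at this
      rw [hex, Nat.cast_add]
      have e : 2 * (qU : ℝ) * (6 * T) / N = 12 * y := by rw [hy]; ring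
      linarith
    have hrT : 20 * (r : ℝ) ≤ 12 * T := by
      have : 20 * (r : ℝ) * qU ≤ 12 * T * qU := by linarith
      exact le_of_mul_le_mul_right this hU
    have ht : (r : ℝ) + 12 * y + 1 ≤ 0.62 * T := by linarith
    have h1 := (h.regret_clustered_le hd hIusr hmin hmax (by positivity) he hW).1
    constructor
    · refine h1.trans ?_
      have : ((T - (r + 1) : ℕ) : ℝ) * (1 / N + (1 / N + ε)) ≤ T * (1 / N + (1 / N + ε)) := by
        rw [hsub]
        gcongr
        linarith
      rw [show (T : ℝ) / N / 2 = T * (1 / N / 2) by ring]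
      nlinarith
    · refine h1.trans ?_
      rw [hRU]
      linarith

end Clustered


/-! ### The regret with clustering of the items -/

section ItemClustering

variable {N qU qI : ℕ}

/-- The number of pairs of an item and a representative: `l` cancels in the main term, so the union
bound for confusion does not depend on it. -/
lemma mul_add_one_le {l q T : ℝ} (hl : 16 ≤ l) (hlq : 3 * l ≤ q) (hT : 1 ≤ T) :
    (16 * (q / l) * T + 1) * (3 * l + 1) ≤ 51 * (q * T) := by
  have hq : 0 ≤ q := by linarith
  have h1 : q / l * l = q := div_mul_cancel₀ _ (by linarith)
  have h2 : 16 * (q / l) ≤ q := by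
    have : 0 ≤ q / l := by positivity
    nlinarith
  have h3 : 16 * (q / l) * T ≤ q * T := by gcongr
  have h4 : q ≤ q * T := le_mul_of_one_le_right hq hT
  calc (16 * (q / l) * T + 1) * (3 * l + 1)
      = 48 * ((q / l * l) * T) + 16 * (q / l) * T + 3 * l + 1 := by ring
    _ ≤ 51 * (q * T) := by rw [h1]; linarith

lemma Admissible.confused_le (h : Admissible N qU qI) {a b T W : ℝ}
    (hab : a * b ≤ W * (qI * T)) (ha : 0 ≤ a) (hb : 0 ≤ b) {m k : ℕ} (hm : (m : ℝ) ≤ a)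
    (hk : (k : ℝ) ≤ b) : (m : ℝ) * k * coinBase ^ rI N qI ≤ W * (T / N) := by
  obtain ⟨hN, hU, hI⟩ := h.cast_pos
  calc (m : ℝ) * k * coinBase ^ rI N qI ≤ a * b * (1 / (N * qI)) := by
        have := coinBase_pos
        gcongr
        exact h.coinBase_pow_rI_le
    _ ≤ W * (qI * T) * (1 / (N * qI)) := by gcongr
    _ = W * (T / N) := by field_simp

/-- If `kItem` is small, then so are the block length and the time. -/
lemma Admissible.bounds_of_kItem_le (h : Admissible N qU qI) {T : ℝ} (hT : 2 ≤ T)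
    (hk : kItem N qI T ≤ rU N qU) : (rI N qI : ℝ) ≤ 0.07 * qU ∧ T / N ≤ 1 / 8192 := by
  obtain ⟨hN, hU, hI⟩ := h.cast_pos
  obtain ⟨hn, hU2, -, hMN⟩ := h.size
  have hT0 : 0 < T := by linarith
  have hs66 := h.rI_ge
  have hrn := h.rU_le
  set n := Real.logb 2 N with hn'
  set s := rI N qI with hs
  set X := √((qI : ℝ) * s / N * T) with hX
  have hX2 : X ^ 2 = qI * s / N * T := Real.sq_sqrt (by positivity)
  have hX0 : 0 ≤ X := Real.sqrt_nonneg _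
  have hle : kItem N qI T = 16 * Real.logb 2 T + 2 * X := rfl
  have hlog : ((1 : ℕ) : ℝ) ≤ Real.logb 2 T := le_logb_of_two_pow_le 1 (by simpa using hT)
  rw [Nat.cast_one] at hlog
  constructor
  -- `2 * X ≤ rU ≤ 6 * n` bounds `qI` by a multiple of `n ^ 2 * N`, hence `rI` by a multiple of `n =
  -- log N`, and `qU ≥ 100 * n` dominates it.
  · have h1 : (qI : ℝ) * (s * T) ≤ (6 * n) ^ 2 / 4 * N := by
      have : X ^ 2 ≤ (6 * n) ^ 2 / 4 := by linarith [pow_le_pow_left₀ hX0 (show X ≤ 3 * n by linarith) 2]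
      rw [hX2] at this
      calc (qI : ℝ) * (s * T) = qI * s / N * T * N := by field_simp
        _ ≤ _ := by gcongr
    have h2 : (qI : ℝ) ≤ (3 * n) ^ 2 * N := by
      have h3 : (1 : ℝ) ≤ s * T := one_le_mul_of_one_le_of_one_le (by linarith) (by linarith)
      linarith [le_mul_of_one_le_right hI.le h3]
    have h3 : Real.logb 2 qI ≤ n + 2 * Real.logb 2 (3 * n) := by
      refine (Real.logb_le_logb_of_le (by norm_num) hI h2).trans (le_of_eq ?_)
      rw [Real.logb_mul (by positivity) hN.ne', Real.logb_pow, hn']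
      push_cast
      ring
    have h4 := logb_le_tangent (x := 3 * n) 6 (by linarith)
    have h5 := h.rI_bounds.2
    rw [Real.logb_mul hN.ne' hI.ne'] at h5
    norm_num at h4
    linarith [h.le_qU]
  · have h1 : Real.logb 2 ((2 : ℝ) ^ 13 * T) ≤ Real.logb 2 N := by
      rw [Real.logb_mul (by norm_num) hT0.ne', Real.logb_pow, Real.logb_self_eq_one (by norm_num)]
      push_cast
      linarith
    rw [Real.logb_le_logb (by norm_num) (by positivity) hN] at h1
    rw [div_le_div_iff₀ hN (by norm_num)]
    linarith

/-- If every user is its own cluster, then the regret is at most the one of exploration, and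
`kItem` up to a factor. -/
lemma Admissible.regret_singletons_le [NeZero N] [NeZero qU] [NeZero qI]
    (h : Admissible N qU qI) {draw : ℕ → ℕ} (hd : Function.Injective draw) {T : ℕ} (hT : 2 ≤ T)
    (hk : kItem N qI T ≤ rU N qU) {p : Params} (hrU : p.rU = rU N qU) (hrI : p.rI = rI N qI)
    (hIusr : p.Iusr = 0) (hIrep : p.Irep = ⌈3 * kItem N qI T⌉₊)
    (hIexp : p.Iexp = ⌈16 * (qI / kItem N qI T) * T⌉₊) :
    regret qU qI (policy (N := N) p draw) T ≤ T / 2 ∧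
      regret qU qI (policy (N := N) p draw) T ≤ 4 * kItem N qI T := by
  obtain ⟨hN, hU, hI⟩ := h.cast_pos
  obtain ⟨hn, hU2, -, hMN⟩ := h.size
  have hT2 : (2 : ℝ) ≤ T := by exact_mod_cast hT
  have hT0 : (0 : ℝ) < T := by linarith
  have hs66 := h.rI_ge
  have hrn := h.rU_le
  have hrq := h.rU_le_qI
  set n := Real.logb 2 N with hn'
  set l := kItem N qI T with hl
  set s := rI N qI with hs
  set X := √((qI : ℝ) * s / N * T) with hX
  have hX2 : X ^ 2 = qI * s / N * T := Real.sq_sqrt (by positivity)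
  have hX0 : 0 ≤ X := Real.sqrt_nonneg _
  have hle : l = 16 * Real.logb 2 T + 2 * X := rfl
  have hlog : ((1 : ℕ) : ℝ) ≤ Real.logb 2 T := le_logb_of_two_pow_le 1 (by simpa using hT2)
  rw [Nat.cast_one] at hlog
  have hl16 : 16 ≤ l := by linarith
  have hlq : 3 * l ≤ qI := by linarith
  have hlpos : 0 < l := by linarith
  obtain ⟨hsU, hTN⟩ := h.bounds_of_kItem_le hT2 hk
  have hsU' : p.rI ≤ qU := by
    rw [hrI]
    have : (s : ℝ) ≤ qU := by linarith
    exact_mod_cast this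
  have hsN' : p.rI ≤ N := by
    refine hsU'.trans ?_
    have : (qU : ℝ) ≤ N := by linarith
    exact_mod_cast this
  have hsN : (s : ℝ) / N ≤ 0.0001 := by
    rw [div_le_iff₀ hN]; linarith
  have hIrep1 : 3 * l ≤ p.Irep := by rw [hIrep]; exact Nat.le_ceil _
  have hIrep2 : (p.Irep : ℝ) ≤ 3 * l + 1 := by
    rw [hIrep]; exact (Nat.ceil_lt_add_one (by positivity)).le
  have hIexp1 : 16 * (qI / l) * T ≤ p.Iexp := by rw [hIexp]; exact Nat.le_ceil _
  have hIexp2 : (p.Iexp : ℝ) ≤ 16 * (qI / l) * T + 1 := by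
    rw [hIexp]; exact (Nat.ceil_lt_add_one (by positivity)).le
  have hNpos : 0 < N := by exact_mod_cast hN
  have : NeZero (drawBound N p T) := ⟨by
    rw [drawBound]
    have : 0 < T * N := Nat.mul_pos (by omega) hNpos
    omega⟩
  set K := drawBound N p T with hK
  have hKle : p.Iusr + p.Irep + p.Iexp ≤ K := by rw [hK, drawBound]; omega
  have hsing : ¬ p.rU ≤ p.Iusr := by
    rw [hrU, hIusr]
    have : (0 : ℝ) < rU N qU := by linarith [h.rU_ge]
    have : 0 < rU N qU := by exact_mod_cast this
    omega
  set t := p.Irep + itemClusteringTime N p with ht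
  have hex : ∀ ω : Sample N qU qI K, exploreTime p ω.rate = t := fun ω => by
    rw [exploreTime, prefsTime_of_singletons p _ hsing, hIusr, zero_add]
  have htl : (t : ℝ) ≤ 7 * l + 2.0001 := by
    have h1 := itemClusteringTime_le (N := N) p
    rw [hrI] at h1
    -- Item clustering takes about `16 * X ^ 2 / l` steps. Since `2 * X ≤ l`, this is of the order
    -- of the time `3 * l` for the representatives: the square root in `kItem` balances the two.
    have h2 : (p.Iexp : ℝ) * s / N ≤ 4 * l + 0.0001 := by
      calc (p.Iexp : ℝ) * s / N ≤ (16 * (qI / l) * T + 1) * s / N := by gcongr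
        _ = 16 * X ^ 2 / l + s / N := by rw [hX2]; field_simp
        _ ≤ 4 * l + 0.0001 := by
          refine add_le_add ?_ hsN
          rw [div_le_iff₀ hlpos]
          linarith [pow_le_pow_left₀ (by positivity) (show 2 * X ≤ l by linarith) 2]
    rw [ht]
    push_cast
    linarith
  have he₁ : 𝔼 ω : Sample N qU qI K, (open Classical in
      if PureClusters p ω.rate then (0 : ℝ) else 1) ≤ 0 :=
    avg_le_const fun ω => by rw [if_pos (pureClusters_of_singletons p _ hsing)]
  set ε : ℝ := (2 / Real.exp 1) ^ T with hε
  have hTε : T * ε ≤ 4 := mul_two_div_exp_pow_le T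
  have he₂ : ∀ (σ : Equiv.Perm (Fin N)) u, 𝔼 ω : Sample N qU qI K, (open Classical in
      if PureClusters p ω.rate ∧ (pool p σ ω.rate u).card < T then (1 : ℝ) else 0) ≤
      2 ^ (-(l / 4)) + ε := fun σ u =>
    avg_short_pool_le p σ u T hlpos (by linarith) hKle hIrep1 (by
      calc 16 * (qI : ℝ) * T = l * (16 * (qI / l) * T) := by field_simp
        _ ≤ l * p.Iexp := by gcongr)
  have hW : ∀ (σ : Equiv.Perm (Fin N)) u, 𝔼 ω : Sample N qU qI K,
      ((confused p σ ω.rate u).card : ℝ) ≤ 0.01 := fun σ u => by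
    refine (avg_confused_le p σ u hsN' hsU').trans ?_
    rw [hrI]
    refine (h.confused_le (mul_add_one_le hl16 hlq (by linarith)) (by positivity) (by positivity)
      hIexp2 hIrep2).trans ?_
    linarith
  have hmiss := fun σ u => avg_misses_le p σ u (fun ω => (hex ω).ge) he₁ (he₂ σ u) (hW σ u)
  constructor
  · rcases le_or_gt T t with hTt | hTt
    · exact regret_le_half_of_le p hd T fun ω => hTt.trans (hex ω).ge
    · have hTt' : (t : ℝ) ≤ T := by exact_mod_cast hTt.le
      -- The representatives alone take `3 * l ≥ 48` steps. This makes the error terms per remaining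
      -- step add up to less than `1 / 2`.
      have hT48 : (48 : ℝ) ≤ T := by
        have : (p.Irep : ℝ) ≤ t := by
          rw [ht]
          exact_mod_cast Nat.le_add_right _ _
        linarith
      have hε1 : ε ≤ 0.1 := by
        have : 0 ≤ ε := by positivity
        linarith [mul_le_mul_of_nonneg_right hT48 this]
      have h2l : (2 : ℝ) ^ (-(l / 4)) ≤ 0.0625 := by
        calc (2 : ℝ) ^ (-(l / 4)) ≤ 2 ^ (-4 : ℝ) :=
              Real.rpow_le_rpow_of_exponent_le (by norm_num) (by linarith)
          _ = 0.0625 := by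
              rw [show (-4 : ℝ) = ((-4 : ℤ) : ℝ) by norm_num, Real.rpow_intCast]; norm_num
      refine (regret_le_of_misses p hd T (x := (t : ℝ) / 2) (avg_le_const fun ω => ?_)
        fun σ u => (hmiss σ u).2).trans ?_
      · rw [hex]
        gcongr
        exact min_le_left _ _
      · rw [Nat.cast_sub hTt.le]
        linarith [mul_le_mul_of_nonneg_left (show 0 + (2 ^ (-(l / 4)) + ε) + 0.01 ≤ 1 / 2 by linarith)
          (sub_nonneg.2 hTt')]
  -- The term `16 * log T` of `kItem` ensures `l / 4 ≥ log T`.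
  · have h2l : T * (2 : ℝ) ^ (-(l / 4)) ≤ 1 := by
      calc T * (2 : ℝ) ^ (-(l / 4)) ≤ T * 2 ^ (-Real.logb 2 T) := by
            gcongr
            · norm_num
            · linarith
        _ = 1 := by
            rw [Real.rpow_neg (by norm_num), Real.rpow_logb (by norm_num) (by norm_num) hT0]
            field_simp
    refine (regret_le_of_misses p hd T (x := (t : ℝ) / 2) (avg_le_const fun ω => ?_)
        fun σ u => (hmiss σ u).1).trans ?_
    · rw [hex]
      gcongr
      exact min_le_left _ _
    · have h3 : ((T - t : ℕ) : ℝ) ≤ T := by exact_mod_cast Nat.sub_le _ _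
      have h4 : ((T - t : ℕ) : ℝ) * (0 + (2 ^ (-(l / 4)) + ε)) ≤
          T * (2 ^ (-(l / 4)) + ε) := by
        rw [zero_add]
        gcongr
      rw [mul_add] at h4
      linarith

end ItemClustering


/-! ### Clustering both users and items: moderate and long horizons -/

section Hybrid

variable {N qU qI : ℕ}

/-- The duration of the exploration with clustering of the users. -/
lemma exploreTime_le_of_largeTypes [NeZero N] [NeZero qU] {K : ℕ} [NeZero K] {p : Params}
    (hp : p.rU ≤ p.Iusr) {ω : Sample N qU qI K} (hω : LargeTypes ω.1) {a b : ℝ}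
    (ha : (p.Irep : ℝ) ≤ a) (hb : (p.Iexp : ℝ) ≤ b) :
    (exploreTime p ω.rate : ℝ) ≤ p.Iusr + 2 * a * (qU / N) + b * p.rI / N + 2 := by
  have h1 := prefsTime_le hp hω
  have h2 := itemClusteringTime_le (N := N) p
  have h3 : 2 * (qU : ℝ) * p.Irep / N ≤ 2 * a * (qU / N) := by
    rw [show 2 * a * ((qU : ℝ) / N) = 2 * qU * a / N by ring]
    gcongr
  have h4 : (p.Iexp : ℝ) * p.rI / N ≤ b * p.rI / N := by gcongr
  rw [exploreTime]
  push_cast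
  linarith

lemma Admissible.window_numerics (h : Admissible N qU qI) {T : ℕ} (hr : 24 * rU N qU ≤ qI)
    (hT : 5 * T ≤ 6 * rU N qU) (hq : (qI : ℝ) * rI N qI ≤ qU * T) :
    ((T - rU N qU : ℕ) : ℝ) * (2 ^ (T - rU N qU) * (3 / 4 + (1 - 3 / 4) * Real.exp (-1)) ^
      (((22 * rU N qU : ℕ) : ℝ) / qI * (qI - rU N qU))) ≤
      (1 - (rU N qU : ℝ) / qI) / (8 * qI) := by
  obtain ⟨hN, hU, hI⟩ := h.cast_pos
  have hs := h.rI_ge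
  have hr88 := h.rU_ge
  have hsq := h.mul_le_two_pow
  set r := rU N qU with hr'
  have hrq : 24 * (r : ℝ) ≤ qI := by exact_mod_cast hr
  have hTr : 5 * (T : ℝ) ≤ 6 * r := by exact_mod_cast hT
  set β : ℝ := 3 / 4 + (1 - 3 / 4) * Real.exp (-1) with hβ
  have hβ1 : β ≤ 0.842 := by
    have := coinBase_le
    rw [coinBase] at this
    rw [hβ]
    linarith
  have hβ0 : 0 < β := by positivity
  have hE : β ^ (((22 * r : ℕ) : ℝ) / qI * (qI - r)) ≤ (1 / 32) ^ r := by
    calc β ^ (((22 * r : ℕ) : ℝ) / qI * (qI - r)) ≤ β ^ ((21 * r : ℕ) : ℝ) := by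
          refine Real.rpow_le_rpow_of_exponent_ge hβ0 (by linarith) ?_
          push_cast
          rw [div_mul_eq_mul_div, le_div_iff₀ hI]
          linarith [mul_le_mul_of_nonneg_left hrq (Nat.cast_nonneg (α := ℝ) r),
            mul_self_nonneg (r : ℝ)]
      _ = (β ^ 21) ^ r := by rw [Real.rpow_natCast, pow_mul]
      _ ≤ (1 / 32) ^ r := by
          gcongr
          calc β ^ 21 ≤ 0.842 ^ 21 := by gcongr
            _ ≤ 1 / 32 := by norm_num
  have hm : ((T - r : ℕ) : ℝ) ≤ r := by
    have : T - r ≤ r := by omega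
    exact_mod_cast this
  have hm2 : (2 : ℝ) ^ (T - r) ≤ 2 ^ r := pow_le_pow_right₀ (by norm_num) (by omega)
  have hr2 : (r : ℝ) ≤ 2 ^ r := by exact_mod_cast (Nat.lt_two_pow_self (n := r)).le
  have hU1 : (qU : ℝ) ≤ 2 ^ r := by
    refine le_trans ?_ hsq
    have h1 : (1 : ℝ) ≤ qU := by linarith [h.size.2.1]
    have h2 : (1 : ℝ) ≤ N := by linarith [h.size.2.2.2]
    have h3 : (qU : ℝ) ≤ N * qU ^ 2 := by nlinarith [mul_nonneg hU.le hU.le]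
    nlinarith
  have hq1 : (qI : ℝ) ≤ 0.02 * (qU * r) := by
    linarith [mul_le_mul_of_nonneg_left hs hI.le, mul_le_mul_of_nonneg_left hTr hU.le]
  have h1q : 0.9 ≤ 1 - (r : ℝ) / qI := by
    have : (r : ℝ) / qI ≤ 0.1 := by rw [div_le_iff₀ hI]; linarith
    linarith
  calc ((T - r : ℕ) : ℝ) * (2 ^ (T - r) * β ^ (((22 * r : ℕ) : ℝ) / qI * (qI - r)))
      ≤ r * (2 ^ r * (1 / 32) ^ r) := by gcongr
    _ = r * (1 / 16) ^ r := by rw [← mul_pow]; norm_num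
    _ ≤ 0.9 / (8 * qI) := by
        rw [le_div_iff₀ (by positivity)]
        have h16 : (2 : ℝ) ^ r * (2 ^ r * 2 ^ r) * (1 / 16) ^ r ≤ 1 := by
          rw [← mul_pow, ← mul_pow, ← mul_pow]
          exact pow_le_one₀ (by norm_num) (by norm_num)
        have h8 : (r : ℝ) * (8 * qI) ≤ 0.16 * (2 ^ r * (2 ^ r * 2 ^ r)) := by
          calc (r : ℝ) * (8 * qI) ≤ r * (8 * (0.02 * (qU * r))) := by gcongr
            _ = 0.16 * (r * (qU * r)) := by ring
            _ ≤ 0.16 * (2 ^ r * (2 ^ r * 2 ^ r)) := by gcongr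
        calc (r : ℝ) * (1 / 16) ^ r * (8 * qI) = r * (8 * qI) * (1 / 16) ^ r := by ring
          _ ≤ 0.16 * (2 ^ r * (2 ^ r * 2 ^ r)) * (1 / 16) ^ r := by gcongr
          _ = 0.16 * (2 ^ r * (2 ^ r * 2 ^ r) * (1 / 16) ^ r) := by ring
          _ ≤ 0.9 := by linarith
    _ ≤ (1 - (r : ℝ) / qI) / (8 * qI) := by gcongr

/-- Relations between the parameters if the number of representatives is moderate. -/
lemma Admissible.bounds_of_kHybrid_le (h : Admissible N qU qI) {T Y : ℝ} (hT : 1 ≤ T)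
    (hY0 : 0 ≤ Y) (hY : Y ^ 2 = rI N qI * qI * T / qU)
    (hk : 8 * rU N qU + 2 * Y ≤ qI / 3) (hq : (qI : ℝ) * rI N qI ≤ qU * T) :
    0 < Y ∧ Y ≤ T ∧ 6 * (rI N qI * T) ≤ qU * Y ∧ 6 * (rI N qI : ℝ) ≤ qU := by
  obtain ⟨hN, hU, hI⟩ := h.cast_pos
  have hs := h.rI_ge
  have hr := h.rU_ge
  set s : ℝ := ((rI N qI : ℕ) : ℝ)
  have hYU : Y ^ 2 * qU = s * qI * T := by rw [hY]; field_simp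
  have hYpos : 0 < Y := by
    refine hY0.lt_of_ne fun e => ?_
    rw [← e, zero_pow two_ne_zero, zero_mul] at hYU
    have : 0 < s * qI * T := by positivity
    linarith
  have hYT : Y ≤ T := by
    refine le_of_sq_le_sq (le_of_mul_le_mul_right ?_ hU) (by linarith)
    rw [hYU]
    linarith [mul_le_mul_of_nonneg_left hq (show 0 ≤ T by linarith)]
  have h1 : 6 * Y ≤ qI := by linarith
  have h2 : 6 * (s * T) ≤ qU * Y := by
    refine le_of_mul_le_mul_right (a := (qI : ℝ)) ?_ hI
    calc 6 * (s * T) * qI = 6 * (Y ^ 2 * qU) := by rw [hYU]; ring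
      _ = (qU * Y) * (6 * Y) := by ring
      _ ≤ qU * Y * qI := by gcongr
  refine ⟨hYpos, hYT, h2, ?_⟩
  refine le_of_mul_le_mul_right (a := T) ?_ (by linarith)
  linarith [mul_le_mul_of_nonneg_left hYT hU.le]

set_option maxHeartbeats 400000 in
/-- If both users and items are clustered with a moderate number of representatives, then the
regret is at most the one of exploration, and bounded by the hybrid curve up to a factor. -/
lemma Admissible.regret_hybrid_le [NeZero N] [NeZero qU] [NeZero qI]
    (h : Admissible N qU qI) {draw : ℕ → ℕ} (hd : Function.Injective draw) {T : ℕ} (hT : 1 ≤ T)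
    (hk : kHybrid N qU qI T ≤ qI / 3) (hq : (qI : ℝ) * rI N qI ≤ qU * T)
    {p : Params} (hrU : p.rU = rU N qU) (hrI : p.rI = rI N qI)
    (hIusr : p.Iusr = rU N qU) (hIrep : p.Irep = ⌈3 * kHybrid N qU qI T⌉₊)
    (hIexp : p.Iexp = ⌈16 * (qI / kHybrid N qU qI T) * T⌉₊) :
    regret qU qI (policy (N := N) p draw) T ≤ T / 2 ∧
      regret qU qI (policy (N := N) p draw) T ≤
        11 * (rU N qU + 1 / N * √(qI * qU * rI N qI * T)) := by
  obtain ⟨hN, hU, hI⟩ := h.cast_pos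
  obtain ⟨hn, hU2, -, hMN⟩ := h.size
  have hT1 : (1 : ℝ) ≤ T := by exact_mod_cast hT
  have hT0 : (0 : ℝ) < T := by linarith
  have hs66 := h.rI_ge
  have hr88 := h.rU_ge
  have hrM := h.rU_mul_qU_le
  have hwin := h.window_numerics (T := T)
  set Y := √((rI N qI : ℝ) * qI * T / qU) with hY
  have hY2 : Y ^ 2 = rI N qI * qI * T / qU := Real.sq_sqrt (by positivity)
  have hle : kHybrid N qU qI T = 8 * rU N qU + 2 * Y := rfl
  obtain ⟨hY0, hYT, hsT, hsU⟩ := h.bounds_of_kHybrid_le hT1 (Real.sqrt_nonneg _) hY2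
    (by rw [← hle]; exact hk) hq
  have hD : √((qI : ℝ) * qU * rI N qI * T) = qU * Y := by
    rw [show (qI : ℝ) * qU * rI N qI * T = (qU * Y) ^ 2 by rw [mul_pow, hY2]; field_simp]
    exact Real.sqrt_sq (by positivity)
  rw [hD]
  -- The term `8 * rU` of `kHybrid` is there for this; it also provides the `24 * r` representatives
  -- used below.
  have h2r : (2 : ℝ) ^ (-(kHybrid N qU qI T / 4)) ≤ 1 / N :=
    h.two_rpow_neg_le (by rw [hle]; linarith [h.rU_bounds.1, h.size.2.2.1])
  set l := kHybrid N qU qI T with hl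
  set r := rU N qU with hr
  set s := rI N qI with hs
  have hl16 : 16 ≤ l := by linarith
  have hlpos : 0 < l := by linarith
  have hlq : 3 * l ≤ qI := by linarith
  have hsU' : p.rI ≤ qU := by
    rw [hrI]
    have : (s : ℝ) ≤ qU := by linarith
    exact_mod_cast this
  have hsN' : p.rI ≤ N := by
    refine hsU'.trans ?_
    have : (qU : ℝ) ≤ N := by linarith
    exact_mod_cast this
  have hIrep1 : 3 * l ≤ p.Irep := by rw [hIrep]; exact Nat.le_ceil _
  have hIrep2 : (p.Irep : ℝ) ≤ 3 * l + 1 := by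
    rw [hIrep]; exact (Nat.ceil_lt_add_one (by positivity)).le
  have hIexp1 : 16 * (qI / l) * T ≤ p.Iexp := by rw [hIexp]; exact Nat.le_ceil _
  have hIexp2 : (p.Iexp : ℝ) ≤ 16 * (qI / l) * T + 1 := by
    rw [hIexp]; exact (Nat.ceil_lt_add_one (by positivity)).le
  have hNpos : 0 < N := by exact_mod_cast hN
  have : NeZero (drawBound N p T) := ⟨by
    rw [drawBound]
    have : 0 < T * N := Nat.mul_pos (by omega) hNpos
    omega⟩
  have hpU : p.rU ≤ p.Iusr := by rw [hrU, hIusr]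
  have hKle : p.Iusr + p.Irep + p.Iexp ≤ drawBound N p T := by rw [drawBound]; omega
  set z : ℝ := qU / N with hz
  have hz0 : 0 < z := by positivity
  have hz1 : z ≤ 1 / 2420 := by
    rw [hz, div_le_div_iff₀ hN (by norm_num)]; linarith
  have hTN : (T : ℝ) / N ≤ Y * z / 396 := by
    rw [hz, ← mul_div_assoc, div_div, div_le_div_iff₀ hN (by positivity)]
    have : 396 * (T : ℝ) ≤ Y * qU := by linarith [mul_le_mul_of_nonneg_right hs66 hT0.le]
    linarith [mul_le_mul_of_nonneg_right this hN.le]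
  have hTN0 : 0 ≤ (T : ℝ) / N := by positivity
  have hYz : Y * z ≤ T / 2420 := by
    have : Y * z ≤ T * (1 / 2420) := by gcongr
    linarith
  have hYz0 : 0 < Y * z := by positivity
  set ε : ℝ := (2 / Real.exp 1) ^ T with hε
  have hTε : T * ε ≤ 4 := mul_two_div_exp_pow_le T
  have hmax : ∀ ω : Sample N qU qI (drawBound N p T), LargeTypes ω.1 →
      (exploreTime p ω.rate : ℝ) ≤ 1.02 * r + 20 * (Y * z) + 2.002 := fun ω hω => by
    refine (exploreTime_le_of_largeTypes hpU hω hIrep2 hIexp2).trans ?_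
    rw [hIusr, hrI]
    have h1 : 2 * (3 * l + 1) * z ≤ 0.02 * r + 12 * (Y * z) + 0.001 := by
      rw [hle]
      linarith [mul_le_mul_of_nonneg_left hz1 (Nat.cast_nonneg (α := ℝ) r)]
    -- Here `2 * Y ≤ l` makes item clustering as cheap as finding preferences, both of order `Y *
    -- z`.
    have h2 : (16 * (qI / l) * T + 1) * (s : ℝ) / N ≤ 8 * (Y * z) + 0.001 := by
      have e : (16 * (qI / l) * T + 1) * (s : ℝ) / N = 16 * (Y ^ 2 * z) / l + s / N := by
        rw [hY2, hz]; field_simp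
      rw [e]
      refine add_le_add ?_ ?_
      · rw [div_le_iff₀ hlpos]
        linarith [mul_le_mul_of_nonneg_left (show 2 * Y ≤ l by linarith) hYz0.le]
      · rw [div_le_iff₀ hN]; linarith
    linarith
  have hW : ∀ (σ : Equiv.Perm (Fin N)) u, 𝔼 ω : Sample N qU qI (drawBound N p T),
      ((confused p σ ω.rate u).card : ℝ) ≤ 51 * (T / N) := fun σ u => by
    refine (avg_confused_le p σ u hsN' hsU').trans ?_
    rw [hrI]
    exact h.confused_le (mul_add_one_le hl16 hlq hT1) (by positivity) (by positivity)
      hIexp2 hIrep2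
  have he : ∀ (σ : Equiv.Perm (Fin N)) u, 𝔼 ω : Sample N qU qI (drawBound N p T),
      (open Classical in if PureClusters p ω.rate ∧ (pool p σ ω.rate u).card < T then (1 : ℝ)
        else 0) ≤ 1 / N + ε := fun σ u => by
    refine (avg_short_pool_le p σ u T hlpos (by linarith) hKle hIrep1 ?_).trans ?_
    · calc 16 * (qI : ℝ) * T = l * (16 * (qI / l) * T) := by field_simp
        _ ≤ l * p.Iexp := by gcongr
    · gcongr
  have hreg := (h.regret_clustered_le hd hIusr (tmin := 0) (fun _ => Nat.zero_le _) hmax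
    (by positivity) he hW).1
  rw [Nat.sub_zero, show (T : ℝ) * (1 / N + (1 / N + ε)) = 2 * (T / N) + T * ε by ring] at hreg
  constructor
  -- The bound `1.02 * r + …` for the exploration time is useless for `T` close to `r`, so the
  -- exchange argument takes over there. For larger `T` the gap absorbs the errors.
  · rcases le_or_gt (5 * T) (6 * r) with hTr | hTr
    · have hrq : 24 * (r : ℝ) ≤ qI := by linarith
      have hrq' : 24 * r ≤ qI := by exact_mod_cast hrq
      have h24 : 24 * r ≤ p.Irep := by
        have : 24 * (r : ℝ) ≤ p.Irep := by linarith
        exact_mod_cast this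
      have hr0 : 0 < r := by
        have : (0 : ℝ) < r := by linarith
        exact_mod_cast this
      refine regret_le_half_of_window p hd (n := 22 * r) hT hpU (by omega) (by omega) (by omega)
        (by omega) ?_
      rw [hIusr]
      exact hwin hrq' hTr hq
    · have hTr' : 6 * (r : ℝ) < 5 * T := by exact_mod_cast hTr
      linarith
  · rw [show 1 / (N : ℝ) * (qU * Y) = Y * z by rw [hz]; ring]
    linarith

set_option maxHeartbeats 400000 in
/-- If users and items are clustered completely, then the regret is at most the one of exploration,
and bounded by the curve for a long horizon up to a factor. -/
lemma Admissible.regret_full_le [NeZero N] [NeZero qU] [NeZero qI]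
    (h : Admissible N qU qI) {draw : ℕ → ℕ} (hd : Function.Injective draw) {T : ℕ}
    (hTq : qI * Real.logb 2 (N * qI) ≤ T) (hsU : rI N qI ≤ qU)
    {p : Params} (hrU : p.rU = rU N qU) (hrI : p.rI = rI N qI)
    (hIusr : p.Iusr = rU N qU) (hIrep : p.Irep = ⌈qI * Real.logb 2 (N * qI)⌉₊)
    (hIexp : p.Iexp = ⌈16 * ((qI : ℝ) / qI) * T⌉₊) :
    regret qU qI (policy (N := N) p draw) T ≤ T / 2 ∧
      regret qU qI (policy (N := N) p draw) T ≤
        20 * (rU N qU + qU / N * (qI * Real.logb 2 (N * qI)) + rI N qI / N * T) := by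
  obtain ⟨hN, hU, hI⟩ := h.cast_pos
  obtain ⟨hn, hU2, -, hMN⟩ := h.size
  have hs66 := h.rI_ge
  have hr88 := h.rU_ge
  have hrq := h.rU_le_qI
  have hq2 := h.qI_ge
  have hsL := h.rI_bounds.1
  have hL33 := h.logb_mul_ge
  set L := Real.logb 2 (N * qI) with hL
  set r := rU N qU with hr
  set s := rI N qI with hs
  have hqT : 33 * (qI : ℝ) ≤ T := by linarith [mul_le_mul_of_nonneg_left hL33 hI.le]
  have hT0 : (0 : ℝ) < T := by linarith
  have h2q : (2 : ℝ) ^ (-((qI : ℝ) / 4)) ≤ 1 / N :=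
    h.two_rpow_neg_le (by linarith [h.le_qI])
  have hsUr : (s : ℝ) ≤ qU := by exact_mod_cast hsU
  have hsU' : p.rI ≤ qU := by rw [hrI]; exact hsU
  have hsN' : p.rI ≤ N := by
    refine hsU'.trans ?_
    have : (qU : ℝ) ≤ N := by linarith
    exact_mod_cast this
  have hIrep1 : qI * L ≤ p.Irep := by rw [hIrep]; exact Nat.le_ceil _
  have hIrep2 : (p.Irep : ℝ) ≤ qI * L + 1 := by
    rw [hIrep]; exact (Nat.ceil_lt_add_one (by positivity)).le
  have hqq : 16 * ((qI : ℝ) / qI) * T = 16 * T := by rw [div_self hI.ne', mul_one]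
  rw [hqq] at hIexp
  have hIexp1 : 16 * (T : ℝ) ≤ p.Iexp := by rw [hIexp]; exact Nat.le_ceil _
  have hIexp2 : (p.Iexp : ℝ) ≤ 16 * T + 1 := by
    rw [hIexp]; exact (Nat.ceil_lt_add_one (by positivity)).le
  have hNpos : 0 < N := by exact_mod_cast hN
  have hTpos : 0 < T := by exact_mod_cast hT0
  have : NeZero (drawBound N p T) := ⟨by
    rw [drawBound]
    have : 0 < T * N := Nat.mul_pos hTpos hNpos
    omega⟩
  have hpU : p.rU ≤ p.Iusr := by rw [hrU, hIusr]
  have hKle : p.Iusr + p.Irep + p.Iexp ≤ drawBound N p T := by rw [drawBound]; omega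
  set z : ℝ := qU / N with hz
  have hz0 : 0 < z := by positivity
  have hz1 : z ≤ 1 / 2420 := by
    rw [hz, div_le_div_iff₀ hN (by norm_num)]; linarith
  set A : ℝ := z * (qI * L) with hA
  set B : ℝ := s / N * T with hB
  have hA0 : 0 ≤ A := by positivity
  have hB0 : 0 ≤ B := by positivity
  have hA1 : A ≤ T / 2420 := by
    have : A ≤ 1 / 2420 * T := by rw [hA]; gcongr
    linarith
  have hB1 : B ≤ T / 2420 := by
    have : (s : ℝ) / N ≤ 1 / 2420 := by
      rw [div_le_div_iff₀ hN (by norm_num)]; linarith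
    have : B ≤ 1 / 2420 * T := by rw [hB]; gcongr
    linarith
  have hTN : (T : ℝ) / N ≤ B / 66 := by
    rw [hB, div_mul_eq_mul_div, div_div, div_le_div_iff₀ hN (by positivity)]
    have : 0 < (T : ℝ) * N := by positivity
    linarith [mul_le_mul_of_nonneg_right hs66 this.le]
  have hTN0 : 0 ≤ (T : ℝ) / N := by positivity
  set ε : ℝ := (2 / Real.exp 1) ^ T with hε
  have hTε : T * ε ≤ 4 := mul_two_div_exp_pow_le T
  have hmax : ∀ ω : Sample N qU qI (drawBound N p T), LargeTypes ω.1 →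
      (exploreTime p ω.rate : ℝ) ≤ r + 2 * A + 17 * B + 2.001 := fun ω hω => by
    refine (exploreTime_le_of_largeTypes hpU hω hIrep2 hIexp2).trans ?_
    rw [hIusr, hrI]
    have h1 : 2 * (qI * L + 1) * z ≤ 2 * A + 0.001 := by
      rw [show 2 * (qI * L + 1) * z = 2 * A + 2 * z by rw [hA]; ring]
      linarith
    have h2 : (16 * T + 1) * (s : ℝ) / N ≤ 17 * B := by
      rw [show 17 * B = 17 * T * s / N by rw [hB]; ring]
      gcongr
      linarith
    linarith
  have hW : ∀ (σ : Equiv.Perm (Fin N)) u, 𝔼 ω : Sample N qU qI (drawBound N p T),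
      ((confused p σ ω.rate u).card : ℝ) ≤ 18 * L * (T / N) := fun σ u => by
    refine (avg_confused_le p σ u hsN' hsU').trans ?_
    rw [hrI]
    refine h.confused_le ?_ (by positivity) (by positivity) hIexp2 hIrep2
    have h1 : (16 * T + 1 : ℝ) ≤ 17 * T := by linarith
    have h2 : qI * L + 1 ≤ 18 / 17 * (qI * L) := by linarith [mul_le_mul_of_nonneg_left hL33 hI.le]
    calc (16 * T + 1 : ℝ) * (qI * L + 1) ≤ 17 * T * (18 / 17 * (qI * L)) := by gcongr
      _ = 18 * L * (qI * T) := by ring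
  -- The extra factor `L`, due to the `qI * L` representatives, is absorbed by `rI ≥ 2 * L`.
  have hW1 : 18 * L * ((T : ℝ) / N) ≤ 9 * B := by
    calc 18 * L * ((T : ℝ) / N) = 9 * (2 * L) * (T / N) := by ring
      _ ≤ 9 * s * (T / N) := by gcongr
      _ = 9 * B := by rw [hB]; ring
  have he : ∀ (σ : Equiv.Perm (Fin N)) u, 𝔼 ω : Sample N qU qI (drawBound N p T),
      (open Classical in if PureClusters p ω.rate ∧ (pool p σ ω.rate u).card < T then (1 : ℝ)
        else 0) ≤ 1 / N + ε := fun σ u => by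
    refine (avg_short_pool_le p σ u T hI le_rfl hKle ?_ ?_).trans ?_
    · refine le_trans ?_ hIrep1
      linarith [mul_le_mul_of_nonneg_left hL33 hI.le]
    · calc 16 * (qI : ℝ) * T = qI * (16 * T) := by ring
        _ ≤ qI * p.Iexp := by gcongr
    · gcongr
  have hreg := (h.regret_clustered_le hd hIusr (tmin := 0) (fun _ => Nat.zero_le _) hmax
    (by positivity) he hW).1
  rw [Nat.sub_zero, show (T : ℝ) * (1 / N + (1 / N + ε)) = 2 * (T / N) + T * ε by ring] at hreg
  constructor <;> linarith

end Hybrid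


/-! ### The choice of the parameters -/

section Choice

variable {N qU qI : ℕ}

/-- By monotonicity in `T`, from some larger time that satisfies the condition. -/
lemma kItem_le_of_lt {T : ℝ} (hT : 0 < T) (h : T < tItem N qU qI) : kItem N qI T ≤ rU N qU := by
  rw [tItem] at h
  rcases Set.eq_empty_or_nonempty {T : ℝ | 0 < T ∧ kItem N qI T ≤ rU N qU} with he | hne
  · rw [he, Real.sSup_empty] at h
    linarith
  · obtain ⟨T', ⟨h1, h2⟩, h3⟩ := exists_lt_of_lt_csSup hne h
    refine le_trans ?_ h2
    have := Real.logb_le_logb_of_le (b := 2) (by norm_num) hT h3.le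
    unfold kItem
    gcongr

lemma kHybrid_le_of_lt {T : ℝ} (hT : 0 < T) (h : T < tHybrid N qU qI) :
    kHybrid N qU qI T ≤ qI / 3 := by
  rw [tHybrid] at h
  rcases Set.eq_empty_or_nonempty {T : ℝ | 0 < T ∧ kHybrid N qU qI T ≤ qI / 3} with he | hne
  -- The supremum of the empty set is `0` by default, in accordance with the convention for
  -- `tHybrid`, and excludes `T > 0`.
  · rw [he, Real.sSup_empty] at h
    linarith
  · obtain ⟨T', ⟨h1, h2⟩, h3⟩ := exists_lt_of_lt_csSup hne h
    refine le_trans ?_ h2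
    unfold kHybrid
    gcongr

/-- The curve for a long horizon lies above the hybrid one. -/
lemma Admissible.hybrid_le_full (h : Admissible N qU qI) {T : ℝ} (hT : 0 ≤ T) :
    1 / N * √(qI * qU * rI N qI * T) ≤
      qU / N * (qI * Real.logb 2 (N * qI)) + rI N qI / N * T := by
  obtain ⟨hN, hU, hI⟩ := h.cast_pos
  have hL := h.logb_mul_ge
  have hs := h.rI_bounds.2
  set L := Real.logb 2 (N * qI)
  set s : ℝ := ((rI N qI : ℕ) : ℝ) with hs'
  have hs0 : 0 ≤ s := Nat.cast_nonneg _
  have key : √(qI * qU * s * T) ≤ qU * (qI * L) + s * T := by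
    refine Real.sqrt_le_iff.2 ⟨by positivity, ?_⟩
    have h1 : (qI : ℝ) * qU * s * T * 1 ≤ qI * qU * s * T * (4 * L) := by
      gcongr
      linarith
    -- The inequality of arithmetic and geometric means for the two costs, with `4 * L ≥ 1`.
    nlinarith [sq_nonneg ((qU : ℝ) * (qI * L) - s * T)]
  calc 1 / (N : ℝ) * √(qI * qU * s * T) ≤ 1 / N * (qU * (qI * L) + s * T) := by gcongr
    _ = _ := by ring

/-- The item curve is at least the number of representatives, up to a factor. -/
lemma Admissible.kItem_le_RI (h : Admissible N qU qI) {T : ℝ} (hT : 2 ≤ T)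
    (hk : kItem N qI T ≤ rU N qU) : kItem N qI T ≤ 16 * RI N qU qI T := by
  obtain ⟨hN, hU, hI⟩ := h.cast_pos
  have hL := h.logb_mul_ge
  have hr := h.rU_ge
  rw [RI]
  split_ifs
  · rw [kItem]
    linarith [Real.sqrt_nonneg (qI * rI N qI / N * T)]
  · have : 0 ≤ 1 / (N : ℝ) * √(qI * qU * rI N qI * T) := by positivity
    linarith
  · have : 0 ≤ qU / (N : ℝ) * (qI * Real.logb 2 (N * qI)) + rI N qI / N * T := by positivity
    linarith

lemma Admissible.hybrid_le_RI (h : Admissible N qU qI) {T : ℝ} (hT : 2 ≤ T)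
    (hk : ¬ kItem N qI T ≤ rU N qU) :
    rU N qU + 1 / N * √(qI * qU * rI N qI * T) ≤ RI N qU qI T := by
  rw [RI, if_neg fun hlt => hk (kItem_le_of_lt (by linarith) hlt)]
  split_ifs
  · exact le_rfl
  · linarith [h.hybrid_le_full (T := T) (by linarith)]

lemma full_eq_RI {T : ℝ} (hT : 2 ≤ T) (hk : ¬ kItem N qI T ≤ rU N qU)
    (hk' : ¬ kHybrid N qU qI T ≤ qI / 3) :
    RI N qU qI T = rU N qU + qU / N * (qI * Real.logb 2 (N * qI)) + rI N qI / N * T := by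
  rw [RI, if_neg fun hlt => hk (kItem_le_of_lt (by linarith) hlt),
    if_neg fun hlt => hk' (kHybrid_le_of_lt (by linarith) hlt)]

/-- With item clustering, the regret is at most the one of exploration, and `RI` up to a factor. -/
lemma Admissible.regret_itemClust_le [NeZero N] [NeZero qU] [NeZero qI]
    (h : Admissible N qU qI) {draw : ℕ → ℕ} (hd : Function.Injective draw) {T : ℕ} (hT : 2 ≤ T)
    (hR : RI N qU qI T < RU N qU T) :
    regret qU qI (policy (N := N) (paramsItemClust N qU qI T) draw) T ≤ T / 2 ∧
      regret qU qI (policy (N := N) (paramsItemClust N qU qI T) draw) T ≤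
        100 * RI N qU qI T := by
  obtain ⟨hN, hU, hI⟩ := h.cast_pos
  have hT2 : (2 : ℝ) ≤ T := by exact_mod_cast hT
  have hr := h.rU_ge
  have hrq := h.rU_le_qI
  have hL := h.logb_mul_ge
  rw [RU] at hR
  by_cases hk : kItem N qI T ≤ rU N qU
  · have hell : ell N qU qI T = kItem N qI T := by rw [ell, if_pos hk]
    have h1 := h.regret_singletons_le hd hT hk (p := paramsItemClust N qU qI T) rfl rfl
      (by simp only [paramsItemClust, hell, if_neg (not_lt.2 hk)])
      (by simp only [paramsItemClust, hell]; rw [if_pos (by linarith)])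
      (by simp only [paramsItemClust, hell])
    have h2 : 0 ≤ kItem N qI T := by
      have := Real.logb_nonneg (b := 2) (by norm_num) (x := (T : ℝ)) (by linarith)
      unfold kItem
      positivity
    exact ⟨h1.1, by linarith [h1.2, h.kItem_le_RI hT2 hk]⟩
  by_cases hk' : kHybrid N qU qI T ≤ qI / 3
  · have hell : ell N qU qI T = kHybrid N qU qI T := by rw [ell, if_neg hk, if_pos hk']
    have hRI := h.hybrid_le_RI hT2 hk
    have hlt : (rU N qU : ℝ) < kHybrid N qU qI T := by
      have : 0 ≤ √((rI N qI : ℝ) * qI * T / qU) := Real.sqrt_nonneg _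
      rw [kHybrid]; linarith
    -- Item clustering is used only if `RI < RU`, which here says `√(qI * qU * rI * T) < qU * T`;
    -- square and cancel.
    have hq : (qI : ℝ) * rI N qI ≤ qU * T := by
      have h1 : 1 / (N : ℝ) * √(qI * qU * rI N qI * T) < 1 / N * (qU * T) := by
        have : (qU : ℝ) / N * T = 1 / N * (qU * T) := by ring
        linarith
      have h2 : √(qI * qU * rI N qI * T) < qU * T := lt_of_mul_lt_mul_left h1 (by positivity)
      rw [Real.sqrt_lt' (by positivity)] at h2
      refine le_of_mul_le_mul_right (a := (qU : ℝ) * T) ?_ (by positivity)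
      nlinarith
    have h1 := h.regret_hybrid_le hd (by omega) hk' hq (p := paramsItemClust N qU qI T) rfl rfl
      (by simp only [paramsItemClust, hell, if_pos hlt])
      (by simp only [paramsItemClust, hell, if_pos hk'])
      (by simp only [paramsItemClust, hell])
    have : 0 ≤ 1 / (N : ℝ) * √(qI * qU * rI N qI * T) := by positivity
    exact ⟨h1.1, by linarith [h1.2]⟩
  · have hell : ell N qU qI T = qI := by rw [ell, if_neg hk, if_neg hk']
    have hRI := full_eq_RI hT2 hk hk'
    have hgt : ¬ ((qI : ℝ) ≤ qI / 3) := by linarith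
    have h0 : (qU : ℝ) * (qI * Real.logb 2 (N * qI)) + rI N qI * T < qU * T := by
      rw [hRI] at hR
      have : 1 / (N : ℝ) * (qU * (qI * Real.logb 2 (N * qI)) + rI N qI * T) <
          1 / N * (qU * T) := by
        have e1 : (qU : ℝ) / N * T = 1 / N * (qU * T) := by ring
        have e2 : 1 / (N : ℝ) * (qU * (qI * Real.logb 2 (N * qI)) + rI N qI * T) =
          qU / N * (qI * Real.logb 2 (N * qI)) + rI N qI / N * T := by ring
        linarith
      exact lt_of_mul_lt_mul_left this (by positivity)
    have h1 : qI * Real.logb 2 (N * qI) ≤ T := by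
      refine le_of_mul_le_mul_left (a := (qU : ℝ)) ?_ hU
      have : 0 ≤ (rI N qI : ℝ) * T := by positivity
      linarith
    have h2 : rI N qI ≤ qU := by
      have : (rI N qI : ℝ) ≤ qU := by
        refine le_of_mul_le_mul_right (a := (T : ℝ)) ?_ (by linarith)
        have : 0 ≤ (qU : ℝ) * (qI * Real.logb 2 (N * qI)) := by positivity
        linarith
      exact_mod_cast this
    have h3 := h.regret_full_le hd h1 h2 (p := paramsItemClust N qU qI T) rfl rfl
      (by simp only [paramsItemClust, hell]; rw [if_pos (by linarith)])
      (by simp only [paramsItemClust, hell, if_neg hgt])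
      (by simp only [paramsItemClust, hell])
    rw [← hRI] at h3
    have : 0 ≤ RI N qU qI T := by rw [hRI]; positivity
    exact ⟨h3.1, by linarith [h3.2]⟩

lemma Admissible.one_le_paramsItemClust_Irep (h : Admissible N qU qI) {T : ℕ} (hT : 1 ≤ T) :
    1 ≤ (paramsItemClust N qU qI T).Irep := by
  obtain ⟨hN, hU, hI⟩ := h.cast_pos
  have hr := h.rU_ge
  have hL := h.logb_mul_ge
  have hs := h.rI_ge
  have hT1 : (1 : ℝ) ≤ T := by exact_mod_cast hT
  have hell : 0 < ell N qU qI T := by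
    rw [ell]
    split_ifs
    · have h1 := Real.logb_nonneg (b := 2) (by norm_num) hT1
      have h2 : 0 < √((qI : ℝ) * rI N qI / N * T) := Real.sqrt_pos.2 (by positivity)
      rw [kItem]
      linarith
    · have : 0 ≤ √((rI N qI : ℝ) * qI * T / qU) := Real.sqrt_nonneg _
      rw [kHybrid]; linarith
    · exact hI
  simp only [paramsItemClust]
  split_ifs
  · exact Nat.ceil_pos.2 (by positivity)
  · exact Nat.ceil_pos.2 (by positivity)

/-- There is at least one representative, so the first step belongs to the exploration. -/
lemma Admissible.regret_itemClust_one_le [NeZero N] [NeZero qU] [NeZero qI]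
    (h : Admissible N qU qI) {draw : ℕ → ℕ} (hd : Function.Injective draw) :
    regret qU qI (policy (N := N) (paramsItemClust N qU qI 1) draw) 1 ≤ 1 / 2 := by
  have hNpos : 0 < N := by exact_mod_cast h.cast_pos.1
  have : NeZero (drawBound N (paramsItemClust N qU qI 1) 1) := ⟨by rw [drawBound]; omega⟩
  have := regret_le_half_of_le (N := N) (qU := qU) (qI := qI) (paramsItemClust N qU qI 1) hd 1
    fun ω => by
      have := one_le_prefsTime (paramsItemClust N qU qI 1) ω.rate
        (h.one_le_paramsItemClust_Irep le_rfl)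
      rw [exploreTime]
      omega
  simpa using this

end Choice

end RecSys

theorem mainTheorem3 :
    ∃ C : ℝ, 0 < C ∧
      ∀ (N qU qI T : ℕ) (draw : ℕ → ℕ),
        100 < N →
        20 * (qU : ℝ) * Real.logb 2 qU ^ 2 < N →
        100 * Real.logb 2 N ≤ qU →
        100 * Real.logb 2 N ≤ qI →
        Function.Injective draw →
        1 ≤ T →
        RecSys.regret qU qI (RecSys.recommendationSystem N qU qI T draw) T ≤
            min ((T : ℝ) / 2) (C * RecSys.RU N qU T) ∧
          (2 ≤ T →
            RecSys.regret qU qI (RecSys.recommendationSystem N qU qI T draw) T ≤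
              min ((T : ℝ) / 2) (min (C * RecSys.RU N qU T) (C * RecSys.RI N qU qI T))) := by
  -- The largest constant needed is `64 = 4 * 16`, from singleton clusters; the other regimes need
  -- at most `20`.
  refine ⟨100, by norm_num, fun N qU qI T draw hN hqU hU hI hd hT => ?_⟩
  have h : RecSys.Admissible N qU qI := ⟨hN, hqU, hU, hI⟩
  obtain ⟨hN0, hU0, hI0⟩ := h.cast_pos
  have : NeZero N := ⟨by omega⟩
  have : NeZero qU := ⟨by rintro rfl; simp at hU0⟩
  have : NeZero qI := ⟨by rintro rfl; simp at hI0⟩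
  have hRU : 1 ≤ RecSys.RU N qU T := by
    have h1 := h.rU_ge
    have h2 : 0 ≤ (qU : ℝ) / N * T := by positivity
    rw [RecSys.RU]
    linarith
  have hdef : RecSys.recommendationSystem N qU qI T draw =
      RecSys.policy (RecSys.params N qU qI T) draw := rfl
  rw [hdef, RecSys.params]
  split_ifs with hc
  · obtain ⟨h1, h2⟩ := h.regret_noItemClust_le hd hT
    refine ⟨le_min h1 (by linarith), fun _ => le_min h1 (le_min (by linarith) (by linarith))⟩
  · rw [not_le] at hc
    rcases hT.eq_or_lt with rfl | hT2
    · have h1 := h.regret_itemClust_one_le hd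
      refine ⟨le_min (by simpa using h1) (by linarith), fun h2 => absurd h2 (by norm_num)⟩
    · obtain ⟨h1, h2⟩ := h.regret_itemClust_le hd hT2 hc
      exact ⟨le_min h1 (by linarith), fun _ => le_min h1 (le_min (by linarith) (by linarith))⟩
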